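/- Let $S^1=\mathbb R/2\pi\mathbb Z$ with its quotient metric $d$, let $f:S^1\to S^1$ and $\sigma:S^1\to(0,\infty)$ be $C^\infty$, and let $\chi$ be a standard normal random variable. Let $B(S^1)$ be the space of bounded Borel measurable functions on $S^1$ with the sup-norm (complexified, since eigenvalues may be complex), let $\|\cdot\|_\infty$ also denote the operator norm on it, and for $\varepsilon>0$ let $T^\varepsilon:B(S^1)\to B(S^1)$, $T^\varepsilon\phi(x)=\mathbb E[\phi(f(x)+\varepsilon\sigma(x)\chi)]$, be the transition operator of $X_{n+1}=f(X_n)+\varepsilon\sigma(X_n)\chi_n \pmod{2\pi}$. An eigendensity of an operator $T$ for $\lambda$ is a nonzero $g\in L^1(S^1)$ with $\int (T\phi)\,g\,dx=\lambda\int\phi\, g\,dx$ for all $\phi\in B(S^1)$. Let $H_n$ be the Hermite polynomials, $\sum_n H_n(x)z^n/n!=e^{2xz-z^2}$, and $h_n(x)=e^{-x^2}H_n(x)$. For $x,p\in S^1$, $x-p$ denotes the representative in $(-\pi,\pi]$. **Theorem 8.** Suppose that $f$ has two distinct fixed points $x_s,x_u$ with $c_k:=f'(x_k)\notin[-1,1]$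 for $k=s,u$, and a period-two orbit $\{x_1,x_2\}$, $x_1\ne x_2$, $f(x_1)=x_2$, $f(x_2)=x_1$, with $c_i:=f'(x_i)$ and $c_1c_2\in(-1,1)$, such that $d(f^n(x),\{x_1,x_2\})\to0$ for all $x\in S^1\setminus\{x_s,x_u\}$. Let $$\beta_k=\sqrt{\frac{c_k^2-1}{2\sigma^2(x_k)}}\ (k=s,u),\qquad \alpha_i=\frac{\alpha}{\sigma_i}\ (i=1,2),\qquad \alpha=\sqrt{\frac{1-(c_1c_2)^2}{2}},$$ $$\sigma_1=\sqrt{c_2^2\sigma^2(x_1)+\sigma^2(x_2)},\qquad \sigma_2=\sqrt{c_1^2\sigma^2(x_2)+\sigma^2(x_1)}.$$ Then for every $r>0$ there are $\varepsilon_0,L,K,\kappa>0$ such that for every $\varepsilon\in(0,\varepsilon_0)$ one can write $T^\varepsilon=T^\varepsilon_{lp}+T^\varepsilon_{up}$ with bounded real operators such that $\|T^\varepsilon_{lp}\|_\infty<r$ and every eigenvalue $\lambda^\varepsilon$ of $T^\varepsilon_{up}$ with $|\lambda^\varepsilon|>r$ is of one of the following two kinds. (i) For some $j\ge0$ and some $\lambda\in\mathbb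 C$ with $\lambda^2=(c_1c_2)^j$ (either branch of $\sqrt{(c_1c_2)^j}$), $|\lambda^\varepsilon-\lambda|\le L\varepsilon$; moreover $T^\varepsilon_{up}$ has an eigendensity for $\lambda^\varepsilon$, and every such eigendensity is, for almost every $x$, of the form $$\sum_{i=1}^2 a_i\left[h_j\left(\frac{\alpha_i(x-x_i)}{\varepsilon}\right)+O(\varepsilon)\right]$$ with constants $a_1,a_2\in\mathbb C$. (ii) For some $j\ge0$ and $k\in\{s,u\}$, $\left|\lambda^\varepsilon-|c_k|^{-1}c_k^{-j}\right|\le L\varepsilon$; moreover every eigenfunction of $T^\varepsilon_{up}$ for $\lambda^\varepsilon$ is of the form $$a\left[h_j\left(\frac{\beta_k(x-x_k)}{\varepsilon}\right)+O(\varepsilon)\right]$$ with a constant $a\in\mathbb C$. Here the $O(\varepsilon)$ term that belongs to the profile centred at $p\in\{x_1,x_2,x_s,x_u\}$ is bounded by $K\varepsilon e^{-\kappa d(x,p)^2/\varepsilon^2}$. Conversely, for each $j\ge 0$ and each $\lambda$ with $\lambda^2=(c_1c_2)^j$ and $|\lambda|>r$ there is an eigenvalue $\lambda^\varepsilon$ of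 $T^\varepsilon_{up}$ as in (i) with these $j,\lambda$, and for each $j\ge 0$ and $k\in\{s,u\}$ with $|c_k|^{-1}|c_k|^{-j}>r$ there is an eigenvalue of $T^\varepsilon_{up}$ as in (ii) with these $j,k$. -/

import Mathlib

open MeasureTheory ProbabilityTheory Filter Topology
open scoped ContDiff

/-- The period `2π` of the circle is positive. -/
instance instFactTwoPiPos : Fact (0 < 2 * Real.pi) := ⟨Real.two_pi_pos⟩

/-- The circle `S¹ = ℝ / 2πℤ`, with its quotient metric, Borel σ-algebra and Lebesgue measure. -/
abbrev S1 : Type := AddCircle (2 * Real.pi)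

/-- The representative in `(-π, π]` of a point of the circle; `rep (x - y)` is the signed
displacement from `y` to `x`, written `x - y` when `x` is near `y`. -/
noncomputable def rep (x : S1) : ℝ :=
  (AddCircle.equivIoc (2 * Real.pi) (-Real.pi) x : ℝ)

/-- `f` is a smooth (`C^∞`) self-map of the circle: it has a smooth lift to the line. -/
def IsSmoothCircleMap (f : S1 → S1) : Prop :=
  ∃ F : ℝ → ℝ, ContDiff ℝ ∞ F ∧ ∀ t : ℝ, f (t : S1) = ((F t : ℝ) : S1)

/-- `g` is a smooth (`C^∞`) real function on the circle. -/
def IsSmoothCircleFun (g : S1 → ℝ) : Prop :=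
  ContDiff ℝ ∞ (fun t : ℝ => g (t : S1))

/-- The derivative `f'(x) ∈ ℝ` of a self-map of the circle, in the angular coordinate. -/
noncomputable def circleDeriv (f : S1 → S1) (x : S1) : ℝ :=
  deriv (fun t : ℝ => rep (f (x + (t : S1)) - f x)) 0

/-- `B(S¹)`: bounded Borel measurable functions on the circle with the sup-norm. Values are
complex, since the eigenvalues and eigenfunctions may be. -/
def BddMeas : Submodule ℂ (lp (fun _ : S1 => ℂ) ⊤) where
  carrier := {φ | Measurable (fun x : S1 => φ x)}
  add_mem' := by
    intro φ ψ hφ hψ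
    exact Measurable.add hφ hψ
  zero_mem' := by
    exact measurable_const
  smul_mem' := by
    intro c φ hφ
    exact Measurable.const_smul hφ c

noncomputable instance instCoeFunBddMeas : CoeFun BddMeas (fun _ => S1 → ℂ) :=
  ⟨fun φ => (φ : lp (fun _ : S1 => ℂ) ⊤)⟩

theorem BddMeas.measurable (φ : BddMeas) : Measurable (fun x : S1 => φ x) := φ.2

theorem BddMeas.norm_apply_le (φ : BddMeas) (x : S1) : ‖φ x‖ ≤ ‖φ‖ :=
  lp.norm_apply_le_norm ENNReal.top_ne_zero (φ : lp (fun _ : S1 => ℂ) ⊤) x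

/-- A bounded measurable function as an element of `B(S¹)`. -/
noncomputable def BddMeas.mk (φ : S1 → ℂ) (hφ : Measurable φ) (C : ℝ) (hC : ∀ x, ‖φ x‖ ≤ C) :
    BddMeas :=
  ⟨⟨φ, memℓp_infty ⟨C, by rintro _ ⟨x, rfl⟩; exact hC x⟩⟩, hφ⟩

/-- One step `f(x) + ε σ(x) z (mod 2π)` of the perturbed system with noise value `z`. -/
noncomputable def noisyStep (f : S1 → S1) (σ : S1 → ℝ) (ε : ℝ) (x : S1) (z : ℝ) : S1 :=
  f x + ((ε * σ x * z : ℝ) : S1)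

/-- The transition function `𝔼 [φ (f(x) + ε σ(x) χ)]`, with `χ` standard normal. -/
noncomputable def stepMean (f : S1 → S1) (σ : S1 → ℝ) (ε : ℝ) (φ : S1 → ℂ) (x : S1) : ℂ :=
  ∫ z : ℝ, φ (noisyStep f σ ε x z) ∂(gaussianReal 0 1)

theorem measurable_noisyStep (f : C(S1, S1)) (σ : C(S1, ℝ)) (ε : ℝ) :
    Measurable (fun p : S1 × ℝ => noisyStep f σ ε p.1 p.2) := by
  have : Continuous (fun p : S1 × ℝ => noisyStep f σ ε p.1 p.2) := by
    unfold noisyStep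
    refine (f.continuous.comp continuous_fst).add ?_
    refine (AddCircle.continuous_mk' (2 * Real.pi)).comp ?_
    fun_prop
  exact this.measurable

theorem measurable_stepMean (f : C(S1, S1)) (σ : C(S1, ℝ)) (ε : ℝ) (φ : BddMeas) :
    Measurable (stepMean f σ ε φ) := by
  have h : StronglyMeasurable
      (Function.uncurry fun (x : S1) (z : ℝ) => φ (noisyStep f σ ε x z)) :=
    ((BddMeas.measurable φ).comp (measurable_noisyStep f σ ε)).stronglyMeasurable
  exact (h.integral_prod_right (ν := gaussianReal 0 1)).measurable

theorem integrable_step (f : C(S1, S1)) (σ : C(S1, ℝ)) (ε : ℝ) (φ : BddMeas) (x : S1) :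
    Integrable (fun z : ℝ => φ (noisyStep f σ ε x z)) (gaussianReal 0 1) := by
  refine Integrable.of_bound (C := ‖φ‖) ?_ (ae_of_all _ fun z => BddMeas.norm_apply_le φ _)
  exact ((BddMeas.measurable φ).comp
    ((measurable_noisyStep f σ ε).comp measurable_prodMk_left)).aestronglyMeasurable

theorem norm_stepMean_le (f : C(S1, S1)) (σ : C(S1, ℝ)) (ε : ℝ) (φ : BddMeas) (x : S1) :
    ‖stepMean f σ ε φ x‖ ≤ ‖φ‖ := by
  have h := norm_integral_le_of_norm_le_const (μ := gaussianReal 0 1)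
    (f := fun z : ℝ => φ (noisyStep f σ ε x z)) (ae_of_all _ fun z => BddMeas.norm_apply_le φ _)
  simpa [stepMean] using h

/-- The Markov transition operator `T^ε` of `X_{n+1} = f(X_n) + ε σ(X_n) χ_n (mod 2π)`, acting on
`B(S¹)` by `(T^ε φ)(x) = 𝔼 [φ (f(x) + ε σ(x) χ)]`. -/
noncomputable def transitionOp (f : C(S1, S1)) (σ : C(S1, ℝ)) (ε : ℝ) : BddMeas →L[ℂ] BddMeas :=
  LinearMap.mkContinuous
    { toFun := fun φ => BddMeas.mk (stepMean f σ ε φ) (measurable_stepMean f σ ε φ) ‖φ‖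
        (norm_stepMean_le f σ ε φ)
      map_add' := by
        intro φ ψ
        apply Subtype.ext
        apply Subtype.ext
        funext x
        exact integral_add (integrable_step f σ ε φ x) (integrable_step f σ ε ψ x)
      map_smul' := by
        intro c φ
        apply Subtype.ext
        apply Subtype.ext
        funext x
        exact integral_const_mul c _ }
    1 (by
      intro φ
      rw [one_mul]
      exact lp.norm_le_of_forall_le (norm_nonneg φ) (norm_stepMean_le f σ ε φ))

/-- The operator is (the complexification of) an operator on real bounded measurable functions. -/
def IsRealOp (T : BddMeas →L[ℂ] BddMeas) : Prop :=
  ∀ φ : BddMeas, (∀ x, (φ x).im = 0) → ∀ x, (T φ x).im = 0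

/-- `g` is an eigendensity of `T` for `lam`: a nonzero integrable density such that the (complex)
measure `g(x) dx` is an eigenmeasure of `T`, that is `∫ (T φ) g dx = lam ∫ φ g dx`
for all `φ ∈ B(S¹)`. -/
structure IsEigendensity (T : BddMeas →L[ℂ] BddMeas) (lam : ℂ) (g : S1 → ℂ) : Prop where
  integrable : Integrable g volume
  ne_zero : ¬ (g =ᵐ[volume] 0)
  eigen : ∀ φ : BddMeas, ∫ x, T φ x * g x = lam * ∫ x, φ x * g x

/-- The (physicists') Hermite polynomials `H_n`, with `∑ H_n(x) zⁿ / n! = exp (2 x z - z²)`. -/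
noncomputable def hermitePoly : ℕ → Polynomial ℝ
  | 0 => 1
  | n + 1 => 2 * Polynomial.X * hermitePoly n - Polynomial.derivative (hermitePoly n)

/-- The Hermite function `h_n(x) = e^{-x²} H_n(x)`. -/
noncomputable def hermiteFn (n : ℕ) (x : ℝ) : ℝ :=
  Real.exp (-x ^ 2) * (hermitePoly n).eval x

/-- The Hermite profile `h_n (s (x - p) / ε)` of order `n` and scaling `s`, centred at `p`. -/
noncomputable def profile (n : ℕ) (s ε : ℝ) (p x : S1) : ℝ :=
  hermiteFn n (s * rep (x - p) / ε)

/-- The Gaussian weight `exp (-κ d(x, p)² / ε²)` that controls remainders. -/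
noncomputable def gaussWeight (κ ε : ℝ) (p x : S1) : ℝ :=
  Real.exp (-κ * dist x p ^ 2 / ε ^ 2)

/-- Scaling at an unstable fixed point with multiplier `c` and noise intensity `s`:
`β = √((c² - 1) / (2 s²))`. -/
noncomputable def betaScale (c s : ℝ) : ℝ :=
  Real.sqrt ((c ^ 2 - 1) / (2 * s ^ 2))

/-- Scaling at the point `p` of a stable period two orbit `{p, q}`, where `c, s` are the
derivative of `f` and the value of `σ` at `p`, and `c', s'` those at `q`:
`√((1 - (c c')²) / 2) / √(c'² s² + s'²)`. -/
noncomputable def alphaScale (c c' s s' : ℝ) : ℝ :=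
  Real.sqrt ((1 - (c * c') ^ 2) / 2) / Real.sqrt (c' ^ 2 * s ^ 2 + s' ^ 2)

/-- `lam` is an eigenvalue of `T` within `L ε` of `|c|⁻¹ c⁻ʲ`, `c = f'(p)`, and all
eigenfunctions for `lam` are of the form `a (h_j (β (x - p) / ε) + O(ε))`, where the `O(ε)` term
is at most `K ε exp (-κ d(x, p)² / ε²)`. -/
def IsUnstableEigenvalue (f : S1 → S1) (σ : S1 → ℝ) (L K κ ε : ℝ) (T : BddMeas →L[ℂ] BddMeas)
    (p : S1) (j : ℕ) (lam : ℂ) : Prop :=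
  Module.End.HasEigenvalue (T : BddMeas →ₗ[ℂ] BddMeas) lam ∧
  ‖lam - ((|circleDeriv f p|⁻¹ * (circleDeriv f p ^ j)⁻¹ : ℝ) : ℂ)‖ ≤ L * ε ∧
  ∀ φ : BddMeas, Module.End.HasEigenvector (T : BddMeas →ₗ[ℂ] BddMeas) lam φ →
    ∃ a : ℂ, ∀ x : S1,
      ‖φ x - a * (profile j (betaScale (circleDeriv f p) (σ p)) ε p x : ℂ)‖
        ≤ K * ε * (‖a‖ * gaussWeight κ ε p x)

/-- `lam` is an eigenvalue of `T` within `L ε` of `z`, it has an eigendensity, and all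
eigendensities for `lam` are of the form `∑ᵢ aᵢ (h_j (αᵢ (x - pᵢ) / ε) + O(ε))`, where the `i`-th
`O(ε)` term is at most `K ε exp (-κ d(x, pᵢ)² / ε²)`; used with `z² = (f'(p₁) f'(p₂))ʲ`. -/
def IsStableEigenvalue (f : S1 → S1) (σ : S1 → ℝ) (L K κ ε : ℝ) (T : BddMeas →L[ℂ] BddMeas)
    (p₁ p₂ : S1) (j : ℕ) (z lam : ℂ) : Prop :=
  Module.End.HasEigenvalue (T : BddMeas →ₗ[ℂ] BddMeas) lam ∧
  ‖lam - z‖ ≤ L * ε ∧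
  (∃ g : S1 → ℂ, IsEigendensity T lam g) ∧
  ∀ g : S1 → ℂ, IsEigendensity T lam g →
    ∃ a₁ a₂ : ℂ, ∀ᵐ x : S1,
      ‖g x -
          (a₁ * (profile j (alphaScale (circleDeriv f p₁) (circleDeriv f p₂) (σ p₁) (σ p₂))
              ε p₁ x : ℂ) +
           a₂ * (profile j (alphaScale (circleDeriv f p₂) (circleDeriv f p₁) (σ p₂) (σ p₁))
              ε p₂ x : ℂ))‖
        ≤ K * ε * (‖a₁‖ * gaussWeight κ ε p₁ x + ‖a₂‖ * gaussWeight κ ε p₂ x)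

/-! Since `Tlp` only has to be small in norm, `Tup` may be any kernel operator whose rows are within
`r / 2`, in total variation, of the rows of the transition kernel. This freedom is used to build one
whose spectrum outside the disc of radius `r` can be computed exactly.

Write `ε = M⁻⁴` and cut the Gaussian noise off at `M` standard deviations. On arcs of radius `R ε M`
around the two fixed points and the two periodic points, `f` is replaced by its linearisation and
`σ` by its value at the centre; elsewhere the truncated kernel is kept (`eventually_local_row`,
`eventually_noiseKernel_row`). For suitable radii the dynamics makes this kernel block triangular:
nothing enters an arc around a repelling point from outside, nothing leaves the union of the two
attracting arcs, and outside all arcs there are no long chains (`exists_chain_bound`), so that part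
is nilpotent. Hence eigenvalues of modulus above `r` come from the blocks alone. Eigenfunctions for
repeller eigenvalues live on the repelling arcs, eigendensities for attractor eigenvalues on the
attracting arcs (`IsRepellerAttractor.right_support`, `IsRepellerAttractor.left_support`); the
Fredholm alternative (`exists_eigen_of_transpose`) passes between a kernel and its transpose.

On the line, a linear Gaussian transfer operator maps `h_j(α x)` to a multiple of `h_j(α' x)` as
soon as the variances match (`integral_hermiteFn_mul_stdG`). The scalings `betaScale` and
`alphaScale` solve exactly this matching condition, for the fixed points and around the two-cycle;
the multipliers are `|c|⁻¹ c⁻ʲ`, and `(c₁ c₂) ^ j` for a full turn of the cycle. Cutting off spoils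
the identity only by exponentially small errors. They are repaired by cut-off Hermite functions that
stay exactly biorthogonal to the Hermite polynomials (`exists_isCutHermite`), and by a finite rank
correction of the kernel under which these functions are mapped exactly to multiples of each other
(`exists_blockLine_sub_le`).

It remains to exclude other large eigenvalues of a block. Once the first `J` cut-off Hermite
functions are split off, the remainder has vanishing moments of order below `J`. A truncated
Gaussian acts on moments by a triangular matrix whose diagonal is bounded by the moduli of the exact
multipliers, which are small from order `J` on. So all moments of the remainder vanish, and a
bounded function of bounded support without moments is zero by Weierstrass approximation
(`eq_zero_of_transferLine_pair`).

Coincidences between eigenvalues of different blocks would mix the eigenfunctions. They are avoided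
by shifting the multipliers of the two repelling points by `e^{-M}` and `2 e^{-M}`, which is far
below `ε`. -/

/-! ### Compactness of Hilbert–Schmidt operators. -/

/-- A Hilbert–Schmidt operator is compact. -/
theorem isCompactOperator_of_summable_sq {H : Type*} [NormedAddCommGroup H]
    [InnerProductSpace ℂ H] [CompleteSpace H] {ι : Type*} (b : HilbertBasis ι ℂ H)
    (A : H →L[ℂ] H) (hA : Summable fun i => ‖A (b i)‖ ^ 2) : IsCompactOperator A := by
  classical
  -- The restrictions of `A` to finitely many basis vectors have finite rank; they converge to `A`
  -- in operator norm.
  let F : Finset ι → (H →L[ℂ] H) := fun s =>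
    ∑ i ∈ s, (innerSL ℂ (b i)).smulRight (A (b i))
  have hF : ∀ s, IsCompactOperator (F s) := by
    intro s
    have : ∀ s : Finset ι, F s ∈ compactOperator (RingHom.id ℂ) H H := by
      intro s
      refine Submodule.sum_mem _ fun i _ => ?_
      have h1 : IsCompactOperator (innerSL ℂ (b i) : H →L[ℂ] ℂ) :=
        isCompactOperator_of_locallyCompactSpace_dom _
      have h2 := h1.clm_comp (ContinuousLinearMap.toSpanSingleton ℂ (A (b i)))
      exact h2
    exact this s
  refine isCompactOperator_of_tendsto (F := F) (l := atTop) ?_ (Eventually.of_forall hF)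
  rw [Metric.tendsto_atTop]
  intro ε hε
  have hε2 : 0 < (ε / 2) ^ 2 := by positivity
  -- Outside `s` the squared Hilbert–Schmidt sum is below `(ε / 2) ^ 2`, so Cauchy–Schwarz together
  -- with Bessel's inequality bounds the tail by `ε / 2`.
  obtain ⟨s, hs⟩ := summable_iff_vanishing_norm.1 hA _ hε2
  refine ⟨s, fun n hn => ?_⟩
  rw [dist_eq_norm]
  refine lt_of_le_of_lt (ContinuousLinearMap.opNorm_le_bound _ (by positivity : 0 ≤ ε / 2) ?_)
    (half_lt_self hε)
  intro x
  have hx : HasSum (fun i => (inner ℂ (b i) x) • A (b i)) (A x) := by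
    have := (b.hasSum_repr x).mapL A
    simpa [HilbertBasis.repr_apply_apply] using this
  have hlim : Tendsto (fun t : Finset ι => ‖F n x - ∑ i ∈ t, (inner ℂ (b i) x) • A (b i)‖) atTop
      (𝓝 ‖F n x - A x‖) := (tendsto_const_nhds.sub hx).norm
  refine le_of_tendsto hlim ?_
  filter_upwards [eventually_ge_atTop n] with t ht
  have h1 : F n x - ∑ i ∈ t, (inner ℂ (b i) x) • A (b i)
      = - ∑ i ∈ t \ n, (inner ℂ (b i) x) • A (b i) := by
    rw [← Finset.sum_sdiff ht]
    simp [F]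
  rw [h1, norm_neg]
  have h2 : ∑ i ∈ t \ n, ‖A (b i)‖ ^ 2 ≤ (ε / 2) ^ 2 := by
    have := hs (t \ n) (by
      refine Finset.disjoint_of_subset_right hn ?_
      exact Finset.sdiff_disjoint)
    exact (le_abs_self _).trans this.le
  have h3 : ∑ i ∈ t \ n, ‖inner ℂ (b i) x‖ ^ 2 ≤ ‖x‖ ^ 2 :=
    b.orthonormal.sum_inner_products_le x
  calc ‖∑ i ∈ t \ n, (inner ℂ (b i) x) • A (b i)‖
      ≤ ∑ i ∈ t \ n, ‖A (b i)‖ * ‖inner ℂ (b i) x‖ := by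
        refine (norm_sum_le _ _).trans (Finset.sum_le_sum fun i _ => ?_)
        rw [norm_smul, mul_comm]
    _ ≤ √(∑ i ∈ t \ n, ‖A (b i)‖ ^ 2) * √(∑ i ∈ t \ n, ‖inner ℂ (b i) x‖ ^ 2) :=
        Real.sum_mul_le_sqrt_mul_sqrt _ _ _
    _ ≤ (ε / 2) * ‖x‖ := by
        refine mul_le_mul ?_ ?_ (Real.sqrt_nonneg _) (by positivity)
        · exact Real.sqrt_le_iff.2 ⟨by positivity, h2⟩
        · exact Real.sqrt_le_iff.2 ⟨by positivity, h3⟩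

/-! ### Integral operators with bounded kernels: blocks, triangularity, Fredholm alternative. -/

section Kernel

variable {X : Type*} [MeasurableSpace X]

/-- The integral operator with kernel `K`. -/
noncomputable def kerInt (μ : Measure X) (K : X → X → ℝ) (φ : X → ℂ) (x : X) : ℂ :=
  ∫ y, (K x y : ℂ) * φ y ∂μ

/-- A measurable kernel that is bounded. -/
structure IsBddKernel (K : X → X → ℝ) : Prop where
  measurable : Measurable (Function.uncurry K)
  bdd : ∃ C : ℝ, ∀ x y, |K x y| ≤ C

/-- A bounded measurable function with `∫ K(x,y) φ(y) dy = lam φ(x)` for every `x`. -/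
structure IsKernelEigen (μ : Measure X) (K : X → X → ℝ) (lam : ℂ) (φ : X → ℂ) : Prop where
  measurable : Measurable φ
  bdd : ∃ C : ℝ, ∀ x, ‖φ x‖ ≤ C
  eigen : ∀ x, kerInt μ K φ x = lam * φ x

theorem IsBddKernel.swap {K : X → X → ℝ} (hK : IsBddKernel K) :
    IsBddKernel (fun x y => K y x) :=
  ⟨hK.measurable.comp measurable_swap, hK.bdd.imp fun _ h x y => h y x⟩

theorem IsBddKernel.measurable_right {K : X → X → ℝ} (hK : IsBddKernel K) (x : X) :
    Measurable (K x) := hK.measurable.comp measurable_prodMk_left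

/-- Multiplication of a kernel by indicators in both variables. -/
noncomputable def blockKernel (A : Set X) (K : X → X → ℝ) (x y : X) : ℝ :=
  A.indicator 1 x * A.indicator 1 y * K x y

theorem IsBddKernel.block {K : X → X → ℝ} (hK : IsBddKernel K) {A : Set X}
    (hA : MeasurableSet A) : IsBddKernel (blockKernel A K) := by
  refine ⟨?_, ?_⟩
  · have h : Measurable (A.indicator (1 : X → ℝ)) := measurable_one.indicator hA
    exact ((h.comp measurable_fst).mul (h.comp measurable_snd)).mul hK.measurable
  · obtain ⟨C, hC⟩ := hK.bdd
    refine ⟨C, fun x y => ?_⟩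
    have h0 := hC x y
    have h1 := abs_nonneg (K x y)
    unfold blockKernel
    by_cases hx : x ∈ A <;> by_cases hy : y ∈ A <;> simp [hx, hy] <;> linarith

variable {μ : Measure X}

theorem IsBddKernel.integrable_mul {K : X → X → ℝ} (hK : IsBddKernel K) {φ : X → ℂ}
    (hφ : Integrable φ μ) (x : X) : Integrable (fun y => (K x y : ℂ) * φ y) μ := by
  obtain ⟨C, hC⟩ := hK.bdd
  refine hφ.bdd_mul (c := C) ?_ (ae_of_all _ fun y => ?_)
  · exact (Complex.measurable_ofReal.comp (hK.measurable_right x)).aestronglyMeasurable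
  · simpa using hC x y

theorem kerInt_congr_ae {K : X → X → ℝ} {φ ψ : X → ℂ} (h : φ =ᵐ[μ] ψ) (x : X) :
    kerInt μ K φ x = kerInt μ K ψ x :=
  integral_congr_ae (h.mono fun y hy => by simp [hy])

theorem IsBddKernel.norm_kerInt_le {K : X → X → ℝ} {C : ℝ} (hC : ∀ x y, |K x y| ≤ C)
    {φ : X → ℂ} (hφ : Integrable φ μ) (x : X) : ‖kerInt μ K φ x‖ ≤ C * ∫ y, ‖φ y‖ ∂μ := by
  rw [← integral_const_mul]
  refine norm_integral_le_of_norm_le (hφ.norm.const_mul C) (ae_of_all _ fun y => ?_)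
  rw [norm_mul]
  exact mul_le_mul_of_nonneg_right (by simpa using hC x y) (norm_nonneg _)

/-- An eigenfunction for a nonzero eigenvalue that vanishes almost everywhere vanishes. -/
theorem IsKernelEigen.eq_zero_of_ae {K : X → X → ℝ} {lam : ℂ} (hl : lam ≠ 0) {φ : X → ℂ}
    (h : IsKernelEigen μ K lam φ) (h0 : φ =ᵐ[μ] 0) : φ = 0 := by
  funext x
  have h1 := h.eigen x
  rw [kerInt_congr_ae h0] at h1
  simpa [kerInt, hl] using h1.symm

theorem norm_sq_Lp_two (f : Lp ℂ 2 μ) : ‖f‖ ^ 2 = ∫ y, ‖f y‖ ^ 2 ∂μ := by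
  have h := L2.inner_def (𝕜 := ℂ) f f
  rw [inner_self_eq_norm_sq_to_K] at h
  have h2 : ∀ y, inner ℂ (f y) (f y) = ((‖f y‖ ^ 2 : ℝ) : ℂ) := fun y => by
    rw [inner_self_eq_norm_sq_to_K]; norm_cast
  simp_rw [h2] at h
  rw [integral_complex_ofReal] at h
  refine Complex.ofReal_injective ?_
  rw [← h]
  simp

/-- Restriction of an eigenfunction to a set that is closed under the kernel. -/
theorem IsKernelEigen.indicator {K : X → X → ℝ} {lam : ℂ} {φ : X → ℂ}
    (h : IsKernelEigen μ K lam φ) {S : Set X} (hS : MeasurableSet S)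
    (hcl : ∀ x ∈ S, ∀ y, y ∉ S → φ y ≠ 0 → K x y = 0) :
    IsKernelEigen μ (blockKernel S K) lam (S.indicator φ) := by
  refine ⟨h.measurable.indicator hS, ?_, fun x => ?_⟩
  · obtain ⟨C, hC⟩ := h.bdd
    exact ⟨C, fun x => (norm_indicator_le_norm_self φ x).trans (hC x)⟩
  · by_cases hx : x ∈ S
    · rw [Set.indicator_of_mem hx, ← h.eigen x]
      refine integral_congr_ae (ae_of_all _ fun y => ?_)
      by_cases hy : y ∈ S
      · simp [blockKernel, hx, hy]
      · by_cases h0 : φ y = 0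
        · simp [h0, hy]
        · simp [hcl x hx y hy h0, hy]
    · simp [kerInt, blockKernel, hx]

theorem IsKernelEigen.eq_zero_of_notMem {K : X → X → ℝ} {lam : ℂ} (hl : lam ≠ 0) {φ : X → ℂ}
    {Z : Set X} (h : IsKernelEigen μ (blockKernel Z K) lam φ) {x : X} (hx : x ∉ Z) : φ x = 0 := by
  have := h.eigen x
  simpa [kerInt, blockKernel, hx, hl] using this.symm

/-- Extension by zero of an eigenfunction of a block. -/
theorem IsKernelEigen.of_block {K : X → X → ℝ} {lam : ℂ} (hl : lam ≠ 0) {φ : X → ℂ} {Z : Set X}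
    (h : IsKernelEigen μ (blockKernel Z K) lam φ) (hZ : ∀ x, x ∉ Z → ∀ y ∈ Z, K x y = 0) :
    IsKernelEigen μ K lam φ := by
  refine ⟨h.measurable, h.bdd, fun x => ?_⟩
  rw [← h.eigen x]
  refine integral_congr_ae (ae_of_all _ fun y => ?_)
  by_cases hy : y ∈ Z
  · by_cases hx : x ∈ Z
    · simp [blockKernel, hx, hy]
    · simp [blockKernel, hx, hZ x hx y hy]
  · simp [h.eq_zero_of_notMem hl hy]

/-- An eigenfunction that vanishes on `S` vanishes on a set `W` from which the kernel leads only to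
`S` and `W`, if there are no long chains in `W`. -/
theorem IsKernelEigen.eq_zero_of_chain {K : X → X → ℝ} {lam : ℂ} (hl : lam ≠ 0) {φ : X → ℂ}
    (h : IsKernelEigen μ K lam φ) {S W : Set X} (hS : ∀ x ∈ S, φ x = 0)
    (hW : ∀ x ∈ W, ∀ y, K x y ≠ 0 → y ∈ S ∨ y ∈ W) {n : ℕ}
    (hn : ∀ c : ℕ → X, (∀ i ≤ n, c i ∈ W) → ∃ i < n, K (c i) (c (i + 1)) = 0) :
    ∀ x ∈ W, φ x = 0 := by
  by_contra! hcon
  obtain ⟨x, hx, hφx⟩ := hcon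
  -- Where `φ` is nonzero so is the integral of the kernel against `φ`, hence the kernel leads to
  -- another point where `φ` is nonzero, and this point cannot lie in `S`. Iterating produces an
  -- arbitrarily long chain in `W`.
  have hstep : ∀ z : {z // z ∈ W ∧ φ z ≠ 0}, ∃ y : {z // z ∈ W ∧ φ z ≠ 0},
      K z.1 y.1 ≠ 0 := by
    rintro ⟨z, hz, hφz⟩
    by_contra! hcon
    have h1 : kerInt μ K φ z = 0 := by
      refine integral_eq_zero_of_ae (ae_of_all _ fun y => ?_)
      by_cases hK : K z y = 0
      · simp [hK]
      · by_cases hy : φ y = 0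
        · simp [hy]
        · rcases hW z hz y hK with h2 | h2
          · exact absurd (hS y h2) hy
          · exact absurd (hcon ⟨y, h2, hy⟩) hK
    rw [h.eigen z] at h1
    simp [hl, hφz] at h1
  choose nxt hnxt using hstep
  obtain ⟨i, -, hi⟩ := hn (fun i => (nxt^[i] ⟨x, hx, hφx⟩).1) fun i _ => (nxt^[i] _).2.1
  simp only [Function.iterate_succ_apply'] at hi
  exact hnxt _ hi

/-- If the kernel is triangular with respect to the partition `S`, `W`, `Z`, the block of `S` has
no eigenfunction and the block of `W` is nilpotent, then eigenfunctions live on `Z`. -/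
theorem IsKernelEigen.eq_zero_of_triangular {K : X → X → ℝ} {lam : ℂ} (hl : lam ≠ 0) {φ : X → ℂ}
    (h : IsKernelEigen μ K lam φ) {S W Z : Set X} (hSm : MeasurableSet S)
    (hcov : ∀ x, x ∈ S ∨ x ∈ W ∨ x ∈ Z)
    (hS : ∀ x ∈ S, ∀ y, y ∉ S → K x y = 0)
    (hblock : ∀ ψ, IsKernelEigen μ (blockKernel S K) lam ψ → ψ = 0)
    (hW : ∀ x ∈ W, ∀ y, K x y ≠ 0 → y ∈ S ∨ y ∈ W) {n : ℕ}
    (hn : ∀ c : ℕ → X, (∀ i ≤ n, c i ∈ W) → ∃ i < n, K (c i) (c (i + 1)) = 0) :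
    ∀ x, x ∉ Z → φ x = 0 := by
  have h0 : ∀ x ∈ S, φ x = 0 := by
    have := hblock _ (h.indicator hSm fun x hx y hy _ => hS x hx y hy)
    intro x hx
    simpa [hx] using congrFun this x
  have h1 := h.eq_zero_of_chain hl h0 hW hn
  intro x hx
  rcases hcov x with h2 | h2 | h2
  exacts [h0 x h2, h1 x h2, absurd h2 hx]

variable [IsFiniteMeasure μ]

theorem IsBddKernel.measurable_kerInt {K : X → X → ℝ} (hK : IsBddKernel K) {φ : X → ℂ}
    (hφ : Measurable φ) : Measurable (kerInt μ K φ) := by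
  have h : StronglyMeasurable (Function.uncurry fun x y => (K x y : ℂ) * φ y) :=
    ((Complex.measurable_ofReal.comp hK.measurable).mul (hφ.comp measurable_snd)).stronglyMeasurable
  exact (h.integral_prod_right (ν := μ)).measurable

theorem IsKernelEigen.integrable {K : X → X → ℝ} {lam : ℂ} {φ : X → ℂ}
    (h : IsKernelEigen μ K lam φ) : Integrable φ μ := by
  obtain ⟨C, hC⟩ := h.bdd
  exact Integrable.of_bound h.measurable.aestronglyMeasurable C (ae_of_all _ hC)

/-- An integrable function satisfying the eigenvalue equation almost everywhere has a bounded
representative satisfying it everywhere. -/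
theorem exists_isKernelEigen_of_ae {K : X → X → ℝ} (hK : IsBddKernel K) {lam : ℂ} (hl : lam ≠ 0)
    {φ : X → ℂ} (hφ : Integrable φ μ) (h : ∀ᵐ x ∂μ, kerInt μ K φ x = lam * φ x) :
    ∃ ψ, IsKernelEigen μ K lam ψ ∧ ψ =ᵐ[μ] φ := by
  obtain ⟨C, hC⟩ := hK.bdd
  -- The good representative is `lam⁻¹ K φ`: it is defined everywhere, and bounded because the
  -- kernel is bounded and `φ` is integrable.
  have hae : (fun x => lam⁻¹ * kerInt μ K φ x) =ᵐ[μ] φ := by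
    filter_upwards [h] with x hx
    rw [hx, inv_mul_cancel_left₀ hl]
  refine ⟨fun x => lam⁻¹ * kerInt μ K φ x, ⟨?_, ?_, fun x => ?_⟩, hae⟩
  · have h1 : kerInt μ K φ = kerInt μ K (hφ.1.mk φ) :=
      funext fun x => kerInt_congr_ae hφ.1.ae_eq_mk x
    rw [h1]
    exact (hK.measurable_kerInt hφ.1.stronglyMeasurable_mk.measurable).const_mul _
  · refine ⟨‖lam⁻¹‖ * (C * ∫ y, ‖φ y‖ ∂μ), fun x => ?_⟩
    rw [norm_mul]
    exact mul_le_mul_of_nonneg_left (IsBddKernel.norm_kerInt_le hC hφ x) (norm_nonneg _)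
  · rw [kerInt_congr_ae hae, mul_inv_cancel_left₀ hl]

theorem IsBddKernel.memLp_kerInt {K : X → X → ℝ} (hK : IsBddKernel K) {φ : X → ℂ}
    (hφ : Integrable φ μ) : MemLp (kerInt μ K φ) 2 μ := by
  obtain ⟨C, hC⟩ := hK.bdd
  have h1 : kerInt μ K φ = kerInt μ K (hφ.1.mk φ) :=
    funext fun x => kerInt_congr_ae hφ.1.ae_eq_mk x
  refine MemLp.of_bound ?_ (C * ∫ y, ‖φ y‖ ∂μ)
    (ae_of_all _ fun x => IsBddKernel.norm_kerInt_le hC hφ x)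
  rw [h1]
  exact (hK.measurable_kerInt hφ.1.stronglyMeasurable_mk.measurable).aestronglyMeasurable

theorem integrable_of_Lp_two (f : Lp ℂ 2 μ) : Integrable f μ :=
  (Lp.memLp f).integrable (by norm_num)

theorem integral_norm_Lp_le (f : Lp ℂ 2 μ) :
    ∫ y, ‖f y‖ ∂μ ≤ √(μ.real Set.univ) * ‖f‖ := by
  have h1 := norm_sq_Lp_two f
  have hm : MemLp (fun y => ‖f y‖) 2 μ := (Lp.memLp f).norm
  have h2 := integral_mul_le_Lp_mul_Lq_of_nonneg (μ := μ) Real.HolderConjugate.two_two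
    (f := fun _ => (1 : ℝ)) (g := fun y => ‖f y‖) (ae_of_all _ fun _ => zero_le_one)
    (ae_of_all _ fun _ => norm_nonneg _) (by simpa using memLp_const 1) (by simpa using hm)
  simp only [one_mul, integral_const, smul_eq_mul, Real.rpow_two, ← h1, one_pow,
    mul_one] at h2
  rw [← Real.sqrt_eq_rpow, ← Real.sqrt_eq_rpow, Real.sqrt_sq (norm_nonneg _)] at h2
  exact h2

/-- The integral operator on `L²`. -/
noncomputable def kerL2 (μ : Measure X) [IsFiniteMeasure μ] {K : X → X → ℝ} (hK : IsBddKernel K) :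
    Lp ℂ 2 μ →L[ℂ] Lp ℂ 2 μ :=
  LinearMap.mkContinuousOfExistsBound
    { toFun := fun f => (hK.memLp_kerInt (integrable_of_Lp_two f)).toLp
      map_add' := by
        intro f g
        rw [← MemLp.toLp_add]
        refine MemLp.toLp_congr _ _ (ae_of_all _ fun x => ?_)
        rw [kerInt_congr_ae (Lp.coeFn_add f g)]
        simp only [kerInt, Pi.add_apply, mul_add]
        exact integral_add (hK.integrable_mul (integrable_of_Lp_two f) x)
          (hK.integrable_mul (integrable_of_Lp_two g) x)
      map_smul' := by
        intro c f
        rw [RingHom.id_apply, ← MemLp.toLp_const_smul]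
        refine MemLp.toLp_congr _ _ (ae_of_all _ fun x => ?_)
        rw [kerInt_congr_ae (Lp.coeFn_smul c f)]
        simp only [kerInt, Pi.smul_apply, smul_eq_mul, mul_left_comm _ c]
        exact integral_const_mul c _ }
    (by
      obtain ⟨C, hC⟩ := hK.bdd
      have hC0 : ∀ f : Lp ℂ 2 μ, C * ∫ y, ‖f y‖ ∂μ ≤ |C| * (√(μ.real Set.univ) * ‖f‖) := fun f =>
        mul_le_mul (le_abs_self C) (integral_norm_Lp_le f)
          (integral_nonneg fun _ => norm_nonneg _) (abs_nonneg _)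
      refine ⟨(μ.real Set.univ) ^ (2 : ENNReal).toReal⁻¹ * (|C| * √(μ.real Set.univ)), fun f => ?_⟩
      refine (Lp.norm_le_of_ae_bound (C := |C| * (√(μ.real Set.univ) * ‖f‖)) (by positivity)
        ?_).trans ?_
      · have := (hK.memLp_kerInt (integrable_of_Lp_two f)).coeFn_toLp
        filter_upwards [this] with x hx
        change ‖((hK.memLp_kerInt (integrable_of_Lp_two f)).toLp) x‖ ≤ _
        rw [hx]
        exact (IsBddKernel.norm_kerInt_le hC (integrable_of_Lp_two f) x).trans (hC0 f)
      · apply le_of_eq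
        simp only [measureUnivNNReal, measureReal_def, ENNReal.coe_toNNReal_eq_toReal]
        ring)

theorem kerL2_coeFn {K : X → X → ℝ} (hK : IsBddKernel K) (f : Lp ℂ 2 μ) :
    kerL2 μ hK f =ᵐ[μ] kerInt μ K f :=
  (hK.memLp_kerInt (integrable_of_Lp_two f)).coeFn_toLp

/-- Hilbert–Schmidt bound: the value of the operator at `x` is an inner product with the row of `x`,
so Bessel's inequality bounds the sum over a basis by the integral of the squared norms of the rows.
-/
theorem isCompactOperator_kerL2 {K : X → X → ℝ} (hK : IsBddKernel K) :
    IsCompactOperator (kerL2 μ hK) := by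
  obtain ⟨C, hC⟩ := hK.bdd
  obtain ⟨w, b, -⟩ := exists_hilbertBasis ℂ (Lp ℂ 2 μ)
  refine isCompactOperator_of_summable_sq b _ ?_
  have hrow : ∀ x, MemLp (fun y => (K x y : ℂ)) 2 μ := fun x =>
    MemLp.of_bound (Complex.measurable_ofReal.comp (hK.measurable_right x)).aestronglyMeasurable C
      (ae_of_all _ fun y => by simpa using hC x y)
  have hnorm := norm_sq_Lp_two (μ := μ)
  have hinner : ∀ x (f : Lp ℂ 2 μ), kerInt μ K f x = inner ℂ ((hrow x).toLp) f := by
    intro x f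
    rw [L2.inner_def]
    refine integral_congr_ae ?_
    filter_upwards [(hrow x).coeFn_toLp] with y hy
    rw [hy]
    simp [mul_comm]
  have hrn : ∀ x, ‖(hrow x).toLp‖ ^ 2 ≤ μ.real Set.univ * C ^ 2 := by
    intro x
    rw [hnorm]
    have : ∫ y, ‖((hrow x).toLp) y‖ ^ 2 ∂μ = ∫ y, ‖(K x y : ℂ)‖ ^ 2 ∂μ := by
      refine integral_congr_ae ?_
      filter_upwards [(hrow x).coeFn_toLp] with y hy
      rw [hy]
    rw [this]
    calc ∫ y, ‖(K x y : ℂ)‖ ^ 2 ∂μ ≤ ∫ _, C ^ 2 ∂μ := by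
          refine integral_mono_of_nonneg (ae_of_all _ fun y => by positivity) (integrable_const _)
            (ae_of_all _ fun y => ?_)
          have := hC x y
          simp only [Complex.norm_real, Real.norm_eq_abs]
          exact pow_le_pow_left₀ (abs_nonneg _) this 2
      _ = μ.real Set.univ * C ^ 2 := by simp
  refine summable_of_sum_le (c := μ.real Set.univ * (μ.real Set.univ * C ^ 2))
    (fun i => by positivity) fun s => ?_
  have hAi : ∀ i, ‖kerL2 μ hK (b i)‖ ^ 2 = ∫ x, ‖inner ℂ ((hrow x).toLp) (b i)‖ ^ 2 ∂μ := by
    intro i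
    rw [hnorm]
    refine integral_congr_ae ?_
    filter_upwards [kerL2_coeFn hK (b i)] with x hx
    rw [hx, hinner]
  have hint : ∀ i, Integrable (fun x => ‖inner ℂ ((hrow x).toLp) (b i)‖ ^ 2) μ := by
    intro i
    have h1 : MemLp (kerInt μ K (b i)) 2 μ := hK.memLp_kerInt (integrable_of_Lp_two _)
    have h2 := h1.norm.integrable_sq
    refine h2.congr (ae_of_all _ fun x => ?_)
    simp only [hinner]
  simp_rw [hAi]
  rw [← integral_finsetSum _ fun i _ => hint i]
  calc ∫ x, ∑ i ∈ s, ‖inner ℂ ((hrow x).toLp) (b i)‖ ^ 2 ∂μ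
      ≤ ∫ _, (μ.real Set.univ * C ^ 2) ∂μ := by
        refine integral_mono_of_nonneg
          (ae_of_all _ fun y => Finset.sum_nonneg fun i _ => by positivity)
          (integrable_const _) (ae_of_all _ fun x => ?_)
        refine le_trans ?_ (hrn x)
        have := b.orthonormal.sum_inner_products_le (s := s) ((hrow x).toLp)
        refine le_trans (Finset.sum_le_sum fun i _ => ?_) this
        rw [norm_inner_symm]
    _ = μ.real Set.univ * (μ.real Set.univ * C ^ 2) := by simp

/-- Fubini for a bounded kernel. -/
theorem integral_kerInt_mul_comm {K : X → X → ℝ} (hK : IsBddKernel K) {φ g : X → ℂ}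
    (hφ : Integrable φ μ) (hg : Integrable g μ) :
    ∫ x, kerInt μ K φ x * g x ∂μ = ∫ y, φ y * kerInt μ (fun x y => K y x) g y ∂μ := by
  obtain ⟨C, hC⟩ := hK.bdd
  have hprod : Integrable (Function.uncurry fun x y => (K x y : ℂ) * φ y * g x) (μ.prod μ) := by
    have h1 : Integrable (fun z : X × X => g z.1 * φ z.2) (μ.prod μ) := hg.mul_prod hφ
    have h2 := h1.bdd_mul (f := fun z : X × X => (K z.1 z.2 : ℂ)) (c := C)
      (Complex.measurable_ofReal.comp hK.measurable).aestronglyMeasurable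
      (ae_of_all _ fun z => by simpa using hC z.1 z.2)
    refine h2.congr (ae_of_all _ fun z => ?_)
    simp only [Function.uncurry]
    ring
  calc ∫ x, kerInt μ K φ x * g x ∂μ = ∫ x, ∫ y, (K x y : ℂ) * φ y * g x ∂μ ∂μ := by
        simp only [kerInt, integral_mul_const]
    _ = ∫ y, ∫ x, (K x y : ℂ) * φ y * g x ∂μ ∂μ := integral_integral_swap hprod
    _ = ∫ y, φ y * kerInt μ (fun x y => K y x) g y ∂μ := by
        refine integral_congr_ae (ae_of_all _ fun y => ?_)
        simp only [kerInt]
        rw [← integral_const_mul]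
        refine integral_congr_ae (ae_of_all _ fun x => ?_)
        simp only
        ring

/-- Fredholm: a nonzero eigenvalue of the transposed kernel is an eigenvalue of the kernel. -/
theorem exists_eigen_of_transpose {K : X → X → ℝ} (hK : IsBddKernel K) {lam : ℂ} (hl : lam ≠ 0)
    {g : X → ℂ} (hg : IsKernelEigen μ (fun x y => K y x) lam g) (hg0 : g ≠ 0) :
    ∃ φ, φ ≠ 0 ∧ IsKernelEigen μ K lam φ := by
  -- Riesz–Schauder: `lam` is either an eigenvalue on `L²`, whose eigenvector has a bounded
  -- representative, or in the resolvent set.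
  rcases (isCompactOperator_kerL2 (μ := μ) hK).hasEigenvalue_or_mem_resolventSet hl with h | h
  · obtain ⟨v, hv⟩ := h.exists_hasEigenvector
    have hv1 : kerL2 μ hK v = lam • v := hv.apply_eq_smul
    have hae : ∀ᵐ x ∂μ, kerInt μ K v x = lam * v x := by
      filter_upwards [kerL2_coeFn hK v, Lp.coeFn_smul lam v] with x h1 h2
      rw [← h1, hv1, h2]
      simp
    obtain ⟨ψ, hψ, hψv⟩ := exists_isKernelEigen_of_ae hK hl (integrable_of_Lp_two v) hae
    refine ⟨ψ, fun h0 => hv.2 ?_, hψ⟩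
    refine Lp.eq_zero_iff_ae_eq_zero.2 ?_
    rw [h0] at hψv
    exact hψv.symm
  -- In the resolvent set one can solve `(lam - K) v = conj g`. Pairing bilinearly with the
  -- transposed eigenfunction `g` makes the left side vanish and turns the right side into `∫ ‖g‖ ^
  -- 2`.
  · exfalso
    apply hg0
    rw [spectrum.mem_resolventSet_iff, ContinuousLinearMap.isUnit_iff_bijective] at h
    refine hg.eq_zero_of_ae hl ?_
    obtain ⟨C, hC⟩ := hg.bdd
    have hgL : MemLp (fun x => (starRingEnd ℂ) (g x)) 2 μ := by
      refine MemLp.of_bound ?_ C (ae_of_all _ fun x => by simpa using hC x)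
      exact (Complex.continuous_conj.measurable.comp hg.measurable).aestronglyMeasurable
    obtain ⟨v, hv⟩ := h.2 hgL.toLp
    have hvi := integrable_of_Lp_two v
    have hbd : ∀ {u : X → ℂ}, Integrable u μ → Integrable (fun x => u x * g x) μ := fun hu =>
      hu.mul_bdd (c := C) hg.measurable.aestronglyMeasurable (ae_of_all _ hC)
    have h1 : ∫ x, kerInt μ K v x * g x ∂μ = lam * ∫ x, v x * g x ∂μ := by
      rw [integral_kerInt_mul_comm hK hvi hg.integrable, ← integral_const_mul]
      refine integral_congr_ae (ae_of_all _ fun x => ?_)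
      simp only [hg.eigen x]
      ring
    have h2 : ∀ᵐ x ∂μ, lam * v x - kerInt μ K v x = (starRingEnd ℂ) (g x) := by
      have hv' : lam • v - kerL2 μ hK v = hgL.toLp := by
        rw [← hv]; simp [Algebra.algebraMap_eq_smul_one]
      have h3 := Lp.coeFn_sub (lam • v) (kerL2 μ hK v)
      rw [hv'] at h3
      filter_upwards [h3, hgL.coeFn_toLp, kerL2_coeFn hK v, Lp.coeFn_smul lam v]
        with x a1 a2 a3 a4
      rw [← a2, a1, Pi.sub_apply, a3, a4]
      simp
    have h3 : ∫ x, (‖g x‖ ^ 2 : ℝ) ∂μ = 0 := by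
      have : ∫ x, ((‖g x‖ ^ 2 : ℝ) : ℂ) ∂μ = 0 := by
        calc ∫ x, ((‖g x‖ ^ 2 : ℝ) : ℂ) ∂μ
            = ∫ x, (lam * (v x * g x) - kerInt μ K v x * g x) ∂μ := by
              refine integral_congr_ae ?_
              filter_upwards [h2] with x hx
              have : ((‖g x‖ ^ 2 : ℝ) : ℂ) = (starRingEnd ℂ) (g x) * g x := by
                rw [mul_comm, Complex.mul_conj, Complex.normSq_eq_norm_sq]
              rw [this, ← hx]
              ring
          _ = 0 := by
              rw [integral_sub ((hbd hvi).const_mul _)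
                (hbd ((hK.memLp_kerInt hvi).integrable (by norm_num))), integral_const_mul, h1,
                sub_self]
      rw [integral_complex_ofReal] at this
      exact_mod_cast this
    have hint : Integrable (fun x => ‖g x‖ ^ 2) μ := by
      refine Integrable.of_bound (C := C ^ 2) (hg.measurable.norm.pow_const 2).aestronglyMeasurable
        (ae_of_all _ fun x => ?_)
      rw [Real.norm_eq_abs, abs_of_nonneg (by positivity)]
      exact pow_le_pow_left₀ (norm_nonneg _) (hC x) 2
    have h4 := (integral_eq_zero_iff_of_nonneg (fun x => by positivity) hint).1 h3
    filter_upwards [h4] with x hx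
    simpa using hx

end Kernel

/-! ### The Gaussian density and its derivative. -/

/-- The standard Gaussian density. -/
noncomputable def stdG (u : ℝ) : ℝ := Real.exp (-u ^ 2 / 2) / √(2 * Real.pi)

theorem stdG_nonneg (u : ℝ) : 0 ≤ stdG u := by unfold stdG; positivity

theorem stdG_le_one (u : ℝ) : stdG u ≤ 1 := by
  unfold stdG
  rw [div_le_one (by positivity)]
  have h1 : Real.exp (-u ^ 2 / 2) ≤ 1 := Real.exp_le_one_iff.2 (by nlinarith [sq_nonneg u])
  refine h1.trans (Real.one_le_sqrt.2 ?_)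
  nlinarith [Real.pi_gt_three]

theorem stdG_neg (u : ℝ) : stdG (-u) = stdG u := by simp [stdG]

theorem continuous_stdG : Continuous stdG := by unfold stdG; fun_prop

theorem hasDerivAt_stdG (u : ℝ) : HasDerivAt stdG (-u * stdG u) u := by
  have h : HasDerivAt (fun u : ℝ => -u ^ 2 / 2) (-u) u := by
    exact (((hasDerivAt_pow 2 u).neg).div_const 2).congr_deriv (by norm_num; ring)
  refine (h.exp.div_const (√(2 * Real.pi))).congr_deriv ?_
  unfold stdG
  ring

theorem abs_mul_stdG_le (u : ℝ) : |u * stdG u| ≤ 1 := by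
  unfold stdG
  have h1 : |u| ≤ Real.exp (u ^ 2 / 2) := by
    have := Real.add_one_le_exp (u ^ 2 / 2)
    nlinarith [sq_nonneg (|u| - 1), sq_abs u]
  have h2 : (1 : ℝ) ≤ √(2 * Real.pi) := Real.one_le_sqrt.2 (by nlinarith [Real.pi_gt_three])
  have h3 : 0 < Real.exp (-u ^ 2 / 2) := Real.exp_pos _
  rw [abs_mul, abs_div, abs_of_pos h3, abs_of_pos (by linarith : 0 < √(2 * Real.pi))]
  rw [← mul_div_assoc, div_le_one (by linarith)]
  calc |u| * Real.exp (-u ^ 2 / 2) ≤ Real.exp (u ^ 2 / 2) * Real.exp (-u ^ 2 / 2) := by gcongr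
    _ = 1 := by rw [← Real.exp_add]; simp; ring
    _ ≤ _ := h2

/-! ### Hermite functions: ladder relation, growth, orthogonality. -/

section Hermite

theorem hermiteFn_zero (x : ℝ) : hermiteFn 0 x = Real.exp (-x ^ 2) := by
  simp [hermiteFn, hermitePoly]

/-- The recursion defining the polynomials is what makes differentiation raise the index; both
orthogonality and the action of Gaussian kernels follow from this by parts. -/
theorem hasDerivAt_hermiteFn (n : ℕ) (x : ℝ) :
    HasDerivAt (hermiteFn n) (-hermiteFn (n + 1) x) x := by
  have h : HasDerivAt (fun u : ℝ => -u ^ 2) (-(2 * x)) x := by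
    exact (hasDerivAt_pow 2 x).neg.congr_deriv (by norm_num)
  refine (h.exp.mul ((hermitePoly n).hasDerivAt x)).congr_deriv ?_
  simp only [hermiteFn, hermitePoly, Polynomial.eval_sub, Polynomial.eval_mul,
    Polynomial.eval_X, Polynomial.eval_ofNat]
  ring

theorem continuous_hermiteFn (n : ℕ) : Continuous (hermiteFn n) := by
  unfold hermiteFn
  fun_prop

theorem degree_hermitePoly (n : ℕ) :
    (hermitePoly n).natDegree ≤ n ∧ (hermitePoly n).coeff n = 2 ^ n := by
  induction n with
  | zero => simp [hermitePoly]
  | succ n ih =>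
    constructor
    · refine (Polynomial.natDegree_sub_le _ _).trans (max_le ?_ ?_)
      · refine (Polynomial.natDegree_mul_le).trans ?_
        have h2 : (2 * Polynomial.X : Polynomial ℝ).natDegree ≤ 1 := by
          refine Polynomial.natDegree_mul_le.trans ?_
          simp
        linarith [ih.1]
      · exact ((Polynomial.natDegree_derivative_le _).trans (Nat.sub_le _ _)).trans
          (ih.1.trans (Nat.le_succ n))
    · have h1 : (Polynomial.derivative (hermitePoly n)).coeff (n + 1) = 0 := by
        refine Polynomial.coeff_eq_zero_of_natDegree_lt ?_
        exact lt_of_le_of_lt ((Polynomial.natDegree_derivative_le _).trans (Nat.sub_le _ _))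
          (Nat.lt_succ_of_le ih.1)
      have h2 : (2 * Polynomial.X * hermitePoly n).coeff (n + 1) = 2 * 2 ^ n := by
        rw [mul_assoc, show (2 : Polynomial ℝ) = Polynomial.C 2 from rfl, Polynomial.coeff_C_mul,
          Polynomial.coeff_X_mul, ih.2]
      rw [hermitePoly, Polynomial.coeff_sub, h1, h2]
      ring

/-- Polynomials of degree less than `n` are combinations of the first `n` Hermite polynomials. -/
theorem mem_span_hermitePoly (n : ℕ) (p : Polynomial ℝ) (hp : p.natDegree < n) :
    ∃ v : ℕ → ℝ, p = ∑ k ∈ Finset.range n, v k • hermitePoly k := by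
  induction n generalizing p with
  | zero => omega
  | succ n ih =>
    -- The leading coefficient of `hermitePoly n` is `2 ^ n`; this subtraction lowers the degree.
    set q := p - (p.coeff n / 2 ^ n) • hermitePoly n with hq
    have hqc : q.coeff n = 0 := by
      rw [hq, Polynomial.coeff_sub, Polynomial.coeff_smul, (degree_hermitePoly n).2]
      field_simp
      simp
    have hqd : q.natDegree ≤ n := by
      refine (Polynomial.natDegree_sub_le _ _).trans (max_le (Nat.lt_succ_iff.1 hp) ?_)
      exact (Polynomial.natDegree_smul_le _ _).trans (degree_hermitePoly n).1
    rcases Nat.eq_zero_or_pos n with h0 | h0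
    · subst h0
      refine ⟨fun _ => p.coeff 0 / 2 ^ 0, ?_⟩
      rw [Polynomial.eq_C_of_natDegree_le_zero hqd, hqc] at hq
      simp only [Polynomial.C_0] at hq
      simp only [zero_add, Finset.sum_range_one]
      exact (sub_eq_zero.1 hq.symm)
    · have hlt : q.natDegree < n := by
        rcases hqd.lt_or_eq with h | h
        · exact h
        · rw [← h] at hqc
          rw [Polynomial.leadingCoeff_eq_zero.1 hqc]
          simpa using h0
      obtain ⟨v, hv⟩ := ih q hlt
      refine ⟨fun k => if k < n then v k else p.coeff n / 2 ^ n, ?_⟩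
      rw [Finset.sum_range_succ]
      have : ∑ k ∈ Finset.range n, (if k < n then v k else p.coeff n / 2 ^ n) • hermitePoly k
          = q := by
        rw [hv]
        refine Finset.sum_congr rfl fun k hk => ?_
        rw [if_pos (Finset.mem_range.1 hk)]
      rw [this]
      simp [hq]

theorem exists_abs_eval_le_exp (p : Polynomial ℝ) :
    ∃ C : ℝ, 0 < C ∧ ∀ x : ℝ, |p.eval x| ≤ C * Real.exp |x| := by
  induction p using Polynomial.induction_on' with
  | add p q hp hq =>
    obtain ⟨C, hC, h1⟩ := hp
    obtain ⟨D, hD, h2⟩ := hq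
    refine ⟨C + D, by positivity, fun x => ?_⟩
    rw [Polynomial.eval_add]
    have := abs_add_le (p.eval x) (q.eval x)
    have := h1 x
    have := h2 x
    linarith
  | monomial n a =>
    refine ⟨(|a| + 1) * n.factorial, by positivity, fun x => ?_⟩
    rw [Polynomial.eval_monomial, abs_mul, abs_pow]
    have h := Real.pow_div_factorial_le_exp |x| (abs_nonneg x) n
    rw [div_le_iff₀ (by positivity)] at h
    calc |a| * |x| ^ n ≤ (|a| + 1) * (Real.exp |x| * n.factorial) := by
          gcongr
          linarith
      _ = _ := by ring

/-- Half of the Gaussian exponent absorbs the polynomial, since `|x| ≤ 1 / 2 + x ^ 2 / 2`. -/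
theorem exists_abs_eval_mul_gauss_le (p : Polynomial ℝ) :
    ∃ C : ℝ, 0 < C ∧ ∀ x : ℝ, |Real.exp (-x ^ 2) * p.eval x| ≤ C * Real.exp (-x ^ 2 / 2) := by
  obtain ⟨C, hC, h⟩ := exists_abs_eval_le_exp p
  refine ⟨C * Real.exp (1 / 2), by positivity, fun x => ?_⟩
  rw [abs_mul, abs_of_pos (Real.exp_pos _)]
  calc Real.exp (-x ^ 2) * |p.eval x| ≤ Real.exp (-x ^ 2) * (C * Real.exp |x|) := by
        gcongr; exact h x
    _ = C * Real.exp (-x ^ 2 + |x|) := by rw [Real.exp_add]; ring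
    _ ≤ C * Real.exp (1 / 2 + -x ^ 2 / 2) := by
        refine mul_le_mul_of_nonneg_left (Real.exp_le_exp.2 ?_) hC.le
        nlinarith [sq_nonneg (|x| - 1), sq_abs x]
    _ = _ := by rw [Real.exp_add]; ring

theorem exists_abs_eval_le_pow (p : Polynomial ℝ) :
    ∃ C : ℝ, 0 < C ∧ ∀ x R : ℝ, |x| ≤ R → 1 ≤ R → |p.eval x| ≤ C * R ^ p.natDegree := by
  refine ⟨∑ i ∈ Finset.range (p.natDegree + 1), |p.coeff i| + 1,
    by positivity, fun x R hx hR => ?_⟩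
  rw [Polynomial.eval_eq_sum_range]
  have h1 : |∑ i ∈ Finset.range (p.natDegree + 1), p.coeff i * x ^ i|
      ≤ ∑ i ∈ Finset.range (p.natDegree + 1), |p.coeff i| * R ^ p.natDegree := by
    refine (Finset.abs_sum_le_sum_abs _ _).trans (Finset.sum_le_sum fun i hi => ?_)
    rw [abs_mul, abs_pow]
    have : |x| ^ i ≤ R ^ p.natDegree :=
      (pow_le_pow_left₀ (abs_nonneg x) hx i).trans
        (pow_le_pow_right₀ hR (Nat.lt_succ_iff.1 (Finset.mem_range.1 hi)))
    gcongr
  rw [← Finset.sum_mul] at h1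
  have : 0 ≤ R ^ p.natDegree := by positivity
  linarith

theorem integrable_gauss_mul_eval (p : Polynomial ℝ) :
    Integrable fun x : ℝ => Real.exp (-x ^ 2) * p.eval x := by
  obtain ⟨C, hC, h⟩ := exists_abs_eval_mul_gauss_le p
  have h1 : Integrable fun x : ℝ => C * Real.exp (-x ^ 2 / 2) := by
    have := (integrable_exp_neg_mul_sq (b := 1 / 2) (by norm_num)).const_mul C
    refine this.congr (ae_of_all _ fun x => ?_)
    simp only
    ring_nf
  refine h1.mono' ?_ (ae_of_all _ h)
  exact (by fun_prop : Continuous fun x : ℝ => Real.exp (-x ^ 2) * p.eval x).aestronglyMeasurable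

theorem integrable_hermiteFn_mul_eval (n : ℕ) (p : Polynomial ℝ) :
    Integrable fun x : ℝ => hermiteFn n x * p.eval x := by
  refine (integrable_gauss_mul_eval (hermitePoly n * p)).congr (ae_of_all _ fun x => ?_)
  simp [hermiteFn]
  ring

/-- Integration by parts trades one Hermite index for one derivative of the polynomial, so `n` steps
annihilate every polynomial of degree below `n`. -/
theorem integral_hermiteFn_succ_mul (n : ℕ) (p : Polynomial ℝ) :
    ∫ x, hermiteFn (n + 1) x * p.eval x
      = ∫ x, hermiteFn n x * (Polynomial.derivative p).eval x := by
  have h := integral_mul_deriv_eq_deriv_mul_of_integrable (u := fun x => p.eval x)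
    (u' := fun x => (Polynomial.derivative p).eval x) (v := hermiteFn n)
    (v' := fun x => -hermiteFn (n + 1) x) (fun x _ => p.hasDerivAt x)
    (fun x _ => hasDerivAt_hermiteFn n x) ?_ ?_ ?_
  · have h1 : ∀ x, p.eval x * -hermiteFn (n + 1) x = -(hermiteFn (n + 1) x * p.eval x) :=
      fun x => by ring
    simp_rw [h1, integral_neg] at h
    rw [neg_inj] at h
    rw [h]
    simp_rw [mul_comm]
  · refine (integrable_hermiteFn_mul_eval (n + 1) p).neg.congr (ae_of_all _ fun x => ?_)
    simp [mul_comm]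
  · refine (integrable_hermiteFn_mul_eval n (Polynomial.derivative p)).congr
      (ae_of_all _ fun x => ?_)
    simp [mul_comm]
  · refine (integrable_hermiteFn_mul_eval n p).congr (ae_of_all _ fun x => ?_)
    simp [mul_comm]

theorem integral_hermiteFn_mul_of_lt (n : ℕ) (p : Polynomial ℝ) (hp : p.natDegree < n) :
    ∫ x, hermiteFn n x * p.eval x = 0 := by
  induction n generalizing p with
  | zero => omega
  | succ n ih =>
    rw [integral_hermiteFn_succ_mul]
    rcases Nat.eq_zero_or_pos p.natDegree with h0 | h0
    · rw [Polynomial.derivative_of_natDegree_zero h0]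
      simp
    · refine ih _ ?_
      have := Polynomial.natDegree_derivative_lt (p := p) (by omega)
      omega

/-- The normalisation `∫ h_n H_n`. -/
noncomputable def hermiteNorm (n : ℕ) : ℝ := ∫ x, hermiteFn n x * (hermitePoly n).eval x

theorem integral_hermiteFn_mul_hermitePoly (i j : ℕ) :
    ∫ x, hermiteFn j x * (hermitePoly i).eval x = if i = j then hermiteNorm j else 0 := by
  rcases lt_trichotomy i j with h | h | h
  · rw [if_neg h.ne]
    exact integral_hermiteFn_mul_of_lt j _ ((degree_hermitePoly i).1.trans_lt h)
  · subst h
    simp [hermiteNorm]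
  · rw [if_neg h.ne']
    rw [← integral_hermiteFn_mul_of_lt i (hermitePoly j) ((degree_hermitePoly j).1.trans_lt h)]
    refine integral_congr_ae (ae_of_all _ fun x => ?_)
    simp only [hermiteFn]
    ring

theorem hermitePoly_ne_zero (n : ℕ) : hermitePoly n ≠ 0 := fun h => by
  have := (degree_hermitePoly n).2
  rw [h] at this
  simp at this
  exact absurd this.symm (by positivity)

theorem hermiteNorm_pos (n : ℕ) : 0 < hermiteNorm n := by
  have h1 : ∀ x, hermiteFn n x * (hermitePoly n).eval x
      = Real.exp (-x ^ 2) * ((hermitePoly n).eval x) ^ 2 := fun x => by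
    simp only [hermiteFn]; ring
  unfold hermiteNorm
  rw [integral_pos_iff_support_of_nonneg (fun x => by rw [h1]; positivity)
    (integrable_hermiteFn_mul_eval n _)]
  have h2 : (Function.support fun x => hermiteFn n x * (hermitePoly n).eval x)
      = ((hermitePoly n).roots.toFinset : Set ℝ)ᶜ := by
    ext x
    simp [h1, hermitePoly_ne_zero, Polynomial.IsRoot]
  rw [h2]
  have h3 : volume ((hermitePoly n).roots.toFinset : Set ℝ) = 0 :=
    (Finset.finite_toSet _).measure_zero _
  rw [measure_compl (Finset.measurableSet _) (by rw [h3]; simp), h3]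
  simp

end Hermite

/-! ### Gaussian transfer operators acting on Hermite functions. -/

section Mehler

variable {α α' a b : ℝ}

theorem integrable_hermiteFn (n : ℕ) : Integrable (hermiteFn n) := by
  simpa using integrable_hermiteFn_mul_eval n 1

theorem integrable_hermiteFn_comp_mul (n : ℕ) (hα : α ≠ 0) :
    Integrable fun x => hermiteFn n (α * x) := (integrable_hermiteFn n).comp_mul_left' hα

/-- Completing the square in `x`: the condition `hrel` says precisely that the Gaussian left over in
`y` has exponent `α' ^ 2`. -/
theorem integral_gauss_mul_stdG (hα : 0 < α) (hα' : 0 < α') (ha : a ≠ 0)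
    (hrel : a ^ 2 * α ^ 2 = α' ^ 2 * (b ^ 2 + 2 * α ^ 2)) (y : ℝ) :
    ∫ x, hermiteFn 0 (α * x) * stdG (a * y - b * x)
      = α' / (|a| * α) * hermiteFn 0 (α' * y) := by
  set A : ℝ := α ^ 2 + b ^ 2 / 2 with hA
  have hApos : 0 < A := by positivity
  have hrel' : α' ^ 2 = a ^ 2 * α ^ 2 / (2 * A) := by
    rw [eq_div_iff (by positivity), hrel, hA]; ring
  have h1 : ∀ x, hermiteFn 0 (α * x) * stdG (a * y - b * x)
      = Real.exp (-(α' * y) ^ 2) / √(2 * Real.pi) *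
        Real.exp (-A * (x - a * b * y / (2 * A)) ^ 2) := by
    intro x
    rw [hermiteFn_zero, stdG, mul_div_assoc', ← Real.exp_add, div_mul_eq_mul_div, ← Real.exp_add]
    congr 2
    rw [mul_pow α', hrel']
    field_simp
    rw [hA]
    ring
  simp_rw [h1]
  rw [integral_const_mul, integral_sub_right_eq_self (fun x => Real.exp (-A * x ^ 2)),
    integral_gaussian, hermiteFn_zero]
  have h2 : α' / (|a| * α) = √(Real.pi / A) / √(2 * Real.pi) := by
    rw [← Real.sqrt_div (by positivity)]
    symm
    rw [Real.sqrt_eq_iff_mul_self_eq (by positivity) (by positivity)]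
    rw [← sq, div_pow, mul_pow, sq_abs, hrel']
    have : a ^ 2 ≠ 0 := by positivity
    field_simp
  rw [h2]
  ring

theorem hasDerivAt_integral_hermiteFn_mul_stdG (n : ℕ) (hα : α ≠ 0) (y : ℝ) :
    HasDerivAt (fun y => ∫ x, hermiteFn n (α * x) * stdG (a * y - b * x))
      (∫ x, hermiteFn n (α * x) * (-(a * y - b * x) * stdG (a * y - b * x) * a)) y := by
  have hint := integrable_hermiteFn_comp_mul n hα
  have hc := continuous_hermiteFn n
  have hg := continuous_stdG
  refine (hasDerivAt_integral_of_dominated_loc_of_deriv_le (μ := volume) (s := Set.univ)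
    (F := fun y x => hermiteFn n (α * x) * stdG (a * y - b * x))
    (F' := fun y x => hermiteFn n (α * x) * (-(a * y - b * x) * stdG (a * y - b * x) * a))
    (bound := fun x => |hermiteFn n (α * x)| * |a|) Filter.univ_mem ?_ ?_ ?_ ?_ ?_ ?_).2
  · refine Eventually.of_forall fun y => ?_
    exact (by fun_prop : Continuous fun x => hermiteFn n (α * x) * stdG (a * y - b * x))
      |>.aestronglyMeasurable
  · refine hint.mul_bdd (c := 1) ?_ (ae_of_all _ fun x => ?_)
    · exact (by fun_prop : Continuous fun x => stdG (a * y - b * x)).aestronglyMeasurable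
    · rw [Real.norm_eq_abs, abs_of_nonneg (stdG_nonneg _)]
      exact stdG_le_one _
  · exact (by fun_prop : Continuous fun x =>
      hermiteFn n (α * x) * (-(a * y - b * x) * stdG (a * y - b * x) * a)).aestronglyMeasurable
  · refine ae_of_all _ fun x y _ => ?_
    rw [norm_mul, norm_mul, Real.norm_eq_abs, Real.norm_eq_abs, Real.norm_eq_abs, neg_mul, abs_neg]
    have := abs_mul_stdG_le (a * y - b * x)
    have h2 := abs_nonneg a
    have : |(a * y - b * x) * stdG (a * y - b * x)| * |a| ≤ |a| := by nlinarith
    exact mul_le_mul_of_nonneg_left this (abs_nonneg _)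
  · exact hint.abs.mul_const _
  · refine ae_of_all _ fun x y _ => ?_
    have h1 : HasDerivAt (fun y => a * y - b * x) a y := by
      simpa using ((hasDerivAt_id y).const_mul a).sub_const (b * x)
    exact ((hasDerivAt_stdG _).comp y h1).const_mul _

/-- Integration by parts in `x` moves the raising derivative onto the Gaussian kernel. -/
theorem integral_hermiteFn_succ_mul_stdG (n : ℕ) (hα : α ≠ 0) (y : ℝ) :
    ∫ x, hermiteFn (n + 1) (α * x) * stdG (a * y - b * x)
      = ∫ x, hermiteFn n (α * x) * (-(a * y - b * x) * stdG (a * y - b * x) * (-b)) * α⁻¹ := by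
  have hint := fun n => integrable_hermiteFn_comp_mul (α := α) n hα
  have hc := fun n => continuous_hermiteFn n
  have hg := continuous_stdG
  have hu : ∀ x, HasDerivAt (fun x => hermiteFn n (α * x)) (-hermiteFn (n + 1) (α * x) * α) x := by
    intro x
    have h1 : HasDerivAt (fun x => α * x) α x := by simpa using (hasDerivAt_id x).const_mul α
    exact (hasDerivAt_hermiteFn n (α * x)).comp x h1
  have hv : ∀ x, HasDerivAt (fun x => stdG (a * y - b * x))
      (-(a * y - b * x) * stdG (a * y - b * x) * (-b)) x := by
    intro x
    have h1 : HasDerivAt (fun x => a * y - b * x) (-b) x := by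
      simpa using ((hasDerivAt_id x).const_mul b).const_sub (a * y)
    exact (hasDerivAt_stdG _).comp x h1
  have hgm : Continuous fun x => stdG (a * y - b * x) := by fun_prop
  have hbd : ∀ x, ‖stdG (a * y - b * x)‖ ≤ 1 := fun x => by
    rw [Real.norm_eq_abs, abs_of_nonneg (stdG_nonneg _)]
    exact stdG_le_one _
  have h := integral_mul_deriv_eq_deriv_mul_of_integrable (fun x _ => hu x) (fun x _ => hv x)
    ?_ ?_ ?_
  · rw [integral_mul_const, h]
    rw [← integral_neg, ← integral_mul_const]
    refine integral_congr_ae (ae_of_all _ fun x => ?_)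
    simp only
    field_simp
  · refine (hint n).mul_bdd (c := |b|) ?_ (ae_of_all _ fun x => ?_)
    · exact (by fun_prop : Continuous fun x =>
        -(a * y - b * x) * stdG (a * y - b * x) * (-b)).aestronglyMeasurable
    · rw [norm_mul, neg_mul, norm_neg, norm_neg]
      have := abs_mul_stdG_le (a * y - b * x)
      simp only [Real.norm_eq_abs]
      nlinarith [abs_nonneg b]
  · refine (((hint (n + 1)).neg).mul_const α).mul_bdd (c := 1) hgm.aestronglyMeasurable
      (ae_of_all _ hbd)
  · exact (hint n).mul_bdd (c := 1) hgm.aestronglyMeasurable (ae_of_all _ hbd)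

/-- Gaussian transition kernels map Hermite functions to Hermite functions. -/
theorem integral_hermiteFn_mul_stdG (hα : 0 < α) (hα' : 0 < α') (ha : a ≠ 0)
    (hrel : a ^ 2 * α ^ 2 = α' ^ 2 * (b ^ 2 + 2 * α ^ 2)) (n : ℕ) (y : ℝ) :
    ∫ x, hermiteFn n (α * x) * stdG (a * y - b * x)
      = α' / (|a| * α) * (b * α' / (a * α)) ^ n * hermiteFn n (α' * y) := by
  induction n generalizing y with
  | zero => simpa using integral_gauss_mul_stdG hα hα' ha hrel y
  | succ n ih =>
    -- The derivative in `y` is computed twice, under the integral sign and from the induction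
    -- hypothesis.
    have h1 := hasDerivAt_integral_hermiteFn_mul_stdG (a := a) (b := b) n hα.ne' y
    have h2 : HasDerivAt (fun y => ∫ x, hermiteFn n (α * x) * stdG (a * y - b * x))
        (α' / (|a| * α) * (b * α' / (a * α)) ^ n * (-hermiteFn (n + 1) (α' * y) * α')) y := by
      simp_rw [ih]
      have h1 : HasDerivAt (fun x => α' * x) α' y := by simpa using (hasDerivAt_id y).const_mul α'
      exact ((hasDerivAt_hermiteFn n (α' * y)).comp y h1).const_mul _
    have h3 := h1.unique h2
    rw [integral_hermiteFn_succ_mul_stdG n hα.ne']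
    -- The kernel depends on `a y - b x` only, so its `x`-derivative is `-b / a` times its
    -- `y`-derivative.
    have h4 : ∀ x, hermiteFn n (α * x) * (-(a * y - b * x) * stdG (a * y - b * x) * (-b)) * α⁻¹
        = hermiteFn n (α * x) * (-(a * y - b * x) * stdG (a * y - b * x) * a)
          * (-b / (a * α)) := fun x => by
      field_simp
    simp_rw [h4]
    rw [integral_mul_const, h3, pow_succ]
    field_simp

end Mehler

/-! ### Compactly supported substitutes for Hermite functions, exactly biorthogonal to the
polynomials. -/

section CutHermite

/-- Bounded functions on `[-1, 1]` that are dual to the first `J` scaled Hermite polynomials. -/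
theorem exists_dual_hermite (J : ℕ) {α : ℝ} (hα : 0 < α) :
    ∃ (B : ℝ) (b : ℕ → ℝ → ℝ), 0 < B ∧ ∀ k < J, Measurable (b k) ∧ (∀ x, 1 < |x| → b k x = 0) ∧
      (∀ x, |b k x| ≤ B) ∧
      ∀ i < J, ∫ x, b k x * (hermitePoly i).eval (α * x) = if i = k then 1 else 0 := by
  classical
  let P : (Fin J → ℝ) →ₗ[ℝ] Polynomial ℝ :=
    { toFun := fun v => ∑ k, v k • hermitePoly k
      map_add' := by intro u v; simp [add_smul, Finset.sum_add_distrib]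
      map_smul' := by intro c v; simp [mul_smul, Finset.smul_sum] }
  have hint : ∀ p q : Polynomial ℝ,
      IntegrableOn (fun x => p.eval (α * x) * q.eval (α * x)) (Set.Icc (-1) 1) := fun p q =>
    (by fun_prop : Continuous fun x => p.eval (α * x) * q.eval (α * x)).continuousOn.integrableOn_Icc
  -- `Φ` is the Gram matrix of the scaled Hermite polynomials in `L²[-1, 1]`; once it is invertible,
  -- preimages of unit vectors give the dual functions.
  let Φ : (Fin J → ℝ) →ₗ[ℝ] (Fin J → ℝ) :=
    { toFun := fun v i => ∫ x in Set.Icc (-1) 1,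
        (P v).eval (α * x) * (hermitePoly i).eval (α * x)
      map_add' := by
        intro u v
        funext i
        simp only [map_add, Polynomial.eval_add, add_mul, Pi.add_apply]
        exact integral_add (hint _ _) (hint _ _)
      map_smul' := by
        intro c v
        funext i
        simp only [map_smul, Polynomial.eval_smul, smul_eq_mul, mul_assoc, Pi.smul_apply,
          RingHom.id_apply]
        exact integral_const_mul _ _ }
  have hinj : Function.Injective Φ := by
    rw [← LinearMap.ker_eq_bot, LinearMap.ker_eq_bot']
    intro v hv
    have h1 : ∫ x in Set.Icc (-1) 1, (P v).eval (α * x) * (P v).eval (α * x) = 0 := by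
      have h2 : ∀ x, (P v).eval (α * x) * (P v).eval (α * x)
          = ∑ i, v i * ((P v).eval (α * x) * (hermitePoly i).eval (α * x)) := by
        intro x
        conv_lhs => enter [2]; simp only [P, LinearMap.coe_mk, AddHom.coe_mk]
        rw [Polynomial.eval_finsetSum, Finset.mul_sum]
        refine Finset.sum_congr rfl fun i _ => ?_
        simp only [Polynomial.eval_smul, smul_eq_mul]
        ring
      simp_rw [h2]
      rw [integral_finsetSum _ fun i _ => (hint _ _).const_mul _]
      refine Finset.sum_eq_zero fun i _ => ?_
      rw [integral_const_mul]
      have : ∫ x in Set.Icc (-1) 1, (P v).eval (α * x) * (hermitePoly i).eval (α * x) = 0 :=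
        congrFun hv i
      rw [this, mul_zero]
    rw [setIntegral_eq_zero_iff_of_nonneg_ae (ae_of_all _ fun x => mul_self_nonneg _)
      (hint _ _)] at h1
    have h2 : Set.EqOn (fun x => (P v).eval (α * x) * (P v).eval (α * x)) 0 (Set.Icc (-1) 1) :=
      Measure.eqOn_Icc_of_ae_eq _ (by norm_num) h1
        (by fun_prop : Continuous fun x => (P v).eval (α * x) * (P v).eval (α * x)).continuousOn
        continuousOn_const
    -- A polynomial of zero norm on an interval has infinitely many roots; the coefficients then
    -- vanish by orthogonality with the Gaussian weight.
    have h3 : P v = 0 := by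
      refine Polynomial.eq_zero_of_infinite_isRoot _ ?_
      refine Set.Infinite.mono (s := (fun x => α * x) '' Set.Icc (-1) 1) ?_ ?_
      · rintro _ ⟨x, hx, rfl⟩
        simpa using h2 hx
      · refine Set.Infinite.image ?_ (Set.Icc_infinite (by norm_num))
        exact (mul_right_injective₀ hα.ne').injOn
    funext i
    have h4 : ∫ x, hermiteFn i x * (P v).eval x = v i * hermiteNorm i := by
      have h5 : ∀ x, hermiteFn i x * (P v).eval x
          = ∑ k, v k * (hermiteFn i x * (hermitePoly k).eval x) := by
        intro x
        simp only [P, LinearMap.coe_mk, AddHom.coe_mk]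
        rw [Polynomial.eval_finsetSum, Finset.mul_sum]
        refine Finset.sum_congr rfl fun i _ => ?_
        simp only [Polynomial.eval_smul, smul_eq_mul]
        ring
      simp_rw [h5]
      rw [integral_finsetSum _ fun k _ => (integrable_hermiteFn_mul_eval _ _).const_mul _]
      simp_rw [integral_const_mul, integral_hermiteFn_mul_hermitePoly]
      rw [Finset.sum_eq_single i]
      · simp
      · intro k _ hk
        rw [if_neg (fun h => hk (Fin.ext h)), mul_zero]
      · simp
    rw [h3] at h4
    simpa [(hermiteNorm_pos i).ne'] using h4.symm
  have hsurj : Function.Surjective Φ := LinearMap.injective_iff_surjective.1 hinj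
  choose v hv using fun k : Fin J => hsurj (Pi.single k 1)
  have hbdd : ∀ p : Polynomial ℝ, ∃ B, ∀ x ∈ Set.Icc (-1 : ℝ) 1, ‖p.eval (α * x)‖ ≤ B := fun p =>
    isCompact_Icc.exists_bound_of_continuousOn
      (by fun_prop : Continuous fun x => p.eval (α * x)).continuousOn
  choose B hB using fun k => hbdd (P (v k))
  refine ⟨∑ k, |B k| + 1, fun k => if h : k < J then
    (Set.Icc (-1) 1).indicator (fun x => (P (v ⟨k, h⟩)).eval (α * x)) else 0, by positivity, ?_⟩
  intro k hk
  simp only [dif_pos hk]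
  refine ⟨?_, ?_, ?_, ?_⟩
  · exact (by fun_prop : Continuous fun x => (P (v ⟨k, hk⟩)).eval (α * x)).measurable.indicator
      measurableSet_Icc
  · intro x hx
    rw [Set.indicator_of_notMem]
    rintro ⟨h1, h2⟩
    exact absurd (abs_le.2 ⟨h1, h2⟩) (not_le.2 hx)
  · intro x
    have h1 : |B ⟨k, hk⟩| ≤ ∑ k, |B k| :=
      Finset.single_le_sum (f := fun k => |B k|) (fun _ _ => abs_nonneg _) (Finset.mem_univ _)
    by_cases hx : x ∈ Set.Icc (-1 : ℝ) 1
    · rw [Set.indicator_of_mem hx]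
      have := hB ⟨k, hk⟩ x hx
      rw [Real.norm_eq_abs] at this
      linarith [le_abs_self (B ⟨k, hk⟩)]
    · rw [Set.indicator_of_notMem hx]
      simp only [abs_zero]
      positivity
  · intro i hi
    have h1 := congrFun (hv ⟨k, hk⟩) ⟨i, hi⟩
    have h2 : ∫ x, (Set.Icc (-1) 1).indicator (fun x => (P (v ⟨k, hk⟩)).eval (α * x)) x
        * (hermitePoly i).eval (α * x)
        = ∫ x in Set.Icc (-1) 1, (P (v ⟨k, hk⟩)).eval (α * x) * (hermitePoly i).eval (α * x) := by
      rw [← integral_indicator measurableSet_Icc]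
      refine integral_congr_ae (ae_of_all _ fun x => ?_)
      by_cases hx : x ∈ Set.Icc (-1 : ℝ) 1 <;> simp [hx]
    rw [h2]
    refine h1.trans ?_
    simp [Pi.single_apply]

/-- `e` is a family of functions on `[-A, A]` close to `h_j (α x)`, exactly biorthogonal to the
first `J` scaled Hermite polynomials. -/
structure IsCutHermite (J : ℕ) (α A C κ : ℝ) (e : ℕ → ℝ → ℝ) : Prop where
  measurable : ∀ j < J, Measurable (e j)
  support : ∀ j < J, ∀ x, A < |x| → e j x = 0
  biorth : ∀ j < J, ∀ i < J, ∫ x, e j x * (hermitePoly i).eval (α * x)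
    = if i = j then hermiteNorm j / α else 0
  approx : ∀ j < J, ∀ x, |e j x - hermiteFn j (α * x)|
    ≤ C * Real.exp (-κ * A ^ 2) * Real.exp (-κ * x ^ 2)

theorem exists_isCutHermite (J : ℕ) {α : ℝ} (hα : 0 < α) :
    ∃ C > 0, ∃ κ > 0, ∀ A : ℝ, 1 ≤ A → ∃ e, IsCutHermite J α A C κ e := by
  classical
  obtain ⟨B, b, hB, hb⟩ := exists_dual_hermite J hα
  choose G hG0 hG using fun p : Polynomial ℝ => exists_abs_eval_mul_gauss_le p
  -- The products of `hermiteFn` with polynomials decay like `exp (-α ^ 2 x ^ 2 / 2)`. For `|x| > A`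
  -- one half of this exponent pays for `exp (-κ A ^ 2)` and the other half for `exp (-κ x ^ 2)`.
  set κ : ℝ := α ^ 2 / 4 with hκ
  have hκ0 : 0 < κ := by positivity
  have hgauss : Integrable fun x : ℝ => Real.exp (-κ * x ^ 2) := integrable_exp_neg_mul_sq hκ0
  set I : ℝ := ∫ x : ℝ, Real.exp (-κ * x ^ 2) with hI
  have hI0 : 0 ≤ I := integral_nonneg fun _ => (Real.exp_pos _).le
  have hdec : ∀ (p : Polynomial ℝ) (A x : ℝ), 1 ≤ A → A < |x| →
      |Real.exp (-(α * x) ^ 2) * p.eval (α * x)|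
        ≤ G p * Real.exp (-κ * A ^ 2) * Real.exp (-κ * x ^ 2) := by
    intro p A x hA hx
    refine (hG p (α * x)).trans ?_
    rw [mul_assoc, ← Real.exp_add]
    refine mul_le_mul_of_nonneg_left (Real.exp_le_exp.2 ?_) (hG0 p).le
    have : A ^ 2 ≤ x ^ 2 := by rw [← sq_abs x]; exact pow_le_pow_left₀ (by linarith) hx.le 2
    rw [hκ]
    nlinarith [sq_nonneg α]
  set T : ℝ := ∑ j ∈ Finset.range J, ∑ i ∈ Finset.range J, G (hermitePoly j * hermitePoly i)
    with hT
  have hT1 : ∀ j < J, ∀ i < J, G (hermitePoly j * hermitePoly i) ≤ T := by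
    intro j hj i hi
    have h1 : G (hermitePoly j * hermitePoly i)
        ≤ ∑ i ∈ Finset.range J, G (hermitePoly j * hermitePoly i) :=
      Finset.single_le_sum (f := fun i => G (hermitePoly j * hermitePoly i))
        (fun _ _ => (hG0 _).le) (Finset.mem_range.2 hi)
    refine h1.trans ?_
    exact Finset.single_le_sum
      (f := fun j => ∑ i ∈ Finset.range J, G (hermitePoly j * hermitePoly i))
      (fun _ _ => Finset.sum_nonneg fun _ _ => (hG0 _).le) (Finset.mem_range.2 hj)
  have hT0 : 0 ≤ T := Finset.sum_nonneg fun _ _ => Finset.sum_nonneg fun _ _ => (hG0 _).le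
  -- The sum of the `G` controls the part cut off beyond `A`. The second term controls the
  -- correction, which lives on `[-1, 1]`, where `exp κ` compensates `exp (-κ x ^ 2)`.
  refine ⟨∑ j ∈ Finset.range J, G (hermitePoly j) + J * (T * I * B) * Real.exp κ + 1, ?_,
    κ, hκ0, fun A hA => ?_⟩
  · have : 0 ≤ ∑ j ∈ Finset.range J, G (hermitePoly j) := Finset.sum_nonneg fun _ _ => (hG0 _).le
    positivity
  -- `τ i j` is the part of the biorthogonality integral lost by restricting to `[-A, A]`, hence a
  -- Gaussian tail.
  set τ : ℕ → ℕ → ℝ := fun i j => (if i = j then hermiteNorm j / α else 0)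
    - ∫ x in Set.Icc (-A) A, hermiteFn j (α * x) * (hermitePoly i).eval (α * x) with hτ
  have hintH : ∀ i j, Integrable fun x => hermiteFn j (α * x) * (hermitePoly i).eval (α * x) :=
    fun i j => (integrable_hermiteFn_mul_eval j (hermitePoly i)).comp_mul_left' hα.ne'
  have hfull : ∀ i j, ∫ x, hermiteFn j (α * x) * (hermitePoly i).eval (α * x)
      = if i = j then hermiteNorm j / α else 0 := by
    intro i j
    rw [Measure.integral_comp_mul_left (fun x => hermiteFn j x * (hermitePoly i).eval x),
      integral_hermiteFn_mul_hermitePoly]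
    split_ifs
    · rw [abs_of_pos (by positivity), smul_eq_mul]; ring
    · simp
  have hτb : ∀ i < J, ∀ j < J, |τ i j| ≤ T * I * Real.exp (-κ * A ^ 2) := by
    intro i hi j hj
    have h1 : τ i j = ∫ x in (Set.Icc (-A) A)ᶜ,
        hermiteFn j (α * x) * (hermitePoly i).eval (α * x) := by
      rw [hτ]
      simp only
      rw [← hfull, ← integral_add_compl measurableSet_Icc (hintH i j)]
      ring
    rw [h1, ← integral_indicator measurableSet_Icc.compl]
    have h2 := norm_integral_le_of_norm_le (μ := volume)
      (f := (Set.Icc (-A) A)ᶜ.indicator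
        fun x => hermiteFn j (α * x) * (hermitePoly i).eval (α * x))
      (hgauss.const_mul (T * Real.exp (-κ * A ^ 2))) (ae_of_all _ fun x => ?_)
    · rw [integral_const_mul] at h2
      rw [Real.norm_eq_abs] at h2
      refine h2.trans (le_of_eq ?_)
      ring
    · by_cases hx : x ∈ (Set.Icc (-A) A)ᶜ
      · rw [Set.indicator_of_mem hx]
        have hx' : A < |x| := by
          by_contra hcon
          exact hx (abs_le.1 (not_lt.1 hcon))
        have h3 := hdec (hermitePoly j * hermitePoly i) A x hA hx'
        rw [Polynomial.eval_mul, ← mul_assoc] at h3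
        refine h3.trans ?_
        have := hT1 j hj i hi
        gcongr
      · rw [Set.indicator_of_notMem hx, norm_zero]
        positivity
  -- The sharp cut-off of the Hermite function, with the lost integrals restored by the dual
  -- functions `b i`.
  refine ⟨fun j x => (Set.Icc (-A) A).indicator (fun x => hermiteFn j (α * x)) x
    + ∑ i ∈ Finset.range J, τ i j * b i x, ?_, ?_, ?_, ?_⟩
  · intro j hj
    refine Measurable.add ?_ ?_
    · have := continuous_hermiteFn j
      exact (by fun_prop : Continuous fun x => hermiteFn j (α * x)).measurable.indicator
        measurableSet_Icc
    · exact Finset.measurable_fun_sum _ fun i hi => ((hb i (Finset.mem_range.1 hi)).1).const_mul _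
  · intro j hj x hx
    have h1 : x ∉ Set.Icc (-A) A := fun h => absurd (abs_le.2 h) (not_le.2 hx)
    simp only [Set.indicator_of_notMem h1, zero_add]
    refine Finset.sum_eq_zero fun i hi => ?_
    rw [(hb i (Finset.mem_range.1 hi)).2.1 x (lt_of_le_of_lt hA hx), mul_zero]
  · intro j hj i hi
    simp only [add_mul, Finset.sum_mul]
    have hbint : ∀ k < J, Integrable fun x => b k x * (hermitePoly i).eval (α * x) := by
      intro k hk
      obtain ⟨h1, h2, h3, -⟩ := hb k hk
      have hI : IntegrableOn (fun x => b k x * (hermitePoly i).eval (α * x)) (Set.Icc (-1) 1) := by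
        have hc : Continuous fun x => (hermitePoly i).eval (α * x) := by fun_prop
        exact (hc.continuousOn.integrableOn_Icc (a := -1) (b := 1)).bdd_mul
          h1.aestronglyMeasurable (ae_of_all _ h3)
      rw [← integrableOn_iff_integrable_of_support_subset (s := Set.Icc (-1) 1)]
      · exact hI
      · intro x hx
        by_contra hcon
        apply hx
        have : 1 < |x| := by
          by_contra h
          exact hcon (abs_le.1 (not_lt.1 h))
        simp [h2 x this]
    have hind : ∀ x, (Set.Icc (-A) A).indicator (fun x => hermiteFn j (α * x)) x
        * (hermitePoly i).eval (α * x) = (Set.Icc (-A) A).indicator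
          (fun x => hermiteFn j (α * x) * (hermitePoly i).eval (α * x)) x := by
      intro x
      by_cases hx : x ∈ Set.Icc (-A) A <;> simp [hx]
    simp_rw [hind]
    rw [integral_add ((hintH i j).indicator measurableSet_Icc), integral_finsetSum,
      integral_indicator measurableSet_Icc]
    · simp_rw [mul_assoc, integral_const_mul]
      have : ∑ k ∈ Finset.range J, τ k j * ∫ x, b k x * (hermitePoly i).eval (α * x)
          = τ i j := by
        rw [Finset.sum_eq_single i]
        · rw [(hb i hi).2.2.2 i hi, if_pos rfl, mul_one]
        · intro k hk hki
          rw [(hb k (Finset.mem_range.1 hk)).2.2.2 i hi, if_neg (Ne.symm hki), mul_zero]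
        · intro h
          exact absurd (Finset.mem_range.2 hi) h
      rw [this, hτ]
      ring
    · intro k hk
      simp_rw [mul_assoc]
      exact (hbint k (Finset.mem_range.1 hk)).const_mul _
    · simp_rw [mul_assoc]
      exact integrable_finsetSum _ fun k hk => (hbint k (Finset.mem_range.1 hk)).const_mul _
  · intro j hj x
    have hGj : G (hermitePoly j) ≤ ∑ j ∈ Finset.range J, G (hermitePoly j) :=
      Finset.single_le_sum (f := fun j => G (hermitePoly j)) (fun _ _ => (hG0 _).le)
        (Finset.mem_range.2 hj)
    by_cases hx : x ∈ Set.Icc (-A) A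
    · simp only [Set.indicator_of_mem hx, add_sub_cancel_left]
      by_cases hx1 : |x| ≤ 1
      · have h1 : |∑ i ∈ Finset.range J, τ i j * b i x|
            ≤ ∑ i ∈ Finset.range J, T * I * Real.exp (-κ * A ^ 2) * B := by
          refine (Finset.abs_sum_le_sum_abs _ _).trans (Finset.sum_le_sum fun i hi => ?_)
          rw [abs_mul]
          have hi' := Finset.mem_range.1 hi
          exact mul_le_mul (hτb i hi' j hj) ((hb i hi').2.2.1 x) (abs_nonneg _) (by positivity)
        rw [Finset.sum_const, Finset.card_range, nsmul_eq_mul] at h1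
        refine h1.trans ?_
        have h2 : 1 ≤ Real.exp κ * Real.exp (-κ * x ^ 2) := by
          rw [← Real.exp_add]
          refine Real.one_le_exp ?_
          have : x ^ 2 ≤ 1 := by rw [← sq_abs]; exact pow_le_one₀ (abs_nonneg _) hx1
          nlinarith
        calc (J : ℝ) * (T * I * Real.exp (-κ * A ^ 2) * B)
            = (J * (T * I * B)) * Real.exp (-κ * A ^ 2) * 1 := by ring
          _ ≤ (J * (T * I * B)) * Real.exp (-κ * A ^ 2)
              * (Real.exp κ * Real.exp (-κ * x ^ 2)) := by gcongr
          _ = (J * (T * I * B) * Real.exp κ) * Real.exp (-κ * A ^ 2) * Real.exp (-κ * x ^ 2) := by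
              ring
          _ ≤ _ := by
              gcongr
              linarith [hG0 (hermitePoly j)]
      · have : ∑ i ∈ Finset.range J, τ i j * b i x = 0 := by
          refine Finset.sum_eq_zero fun i hi => ?_
          rw [(hb i (Finset.mem_range.1 hi)).2.1 x (not_le.1 hx1), mul_zero]
        rw [this, abs_zero]
        have : 0 ≤ ∑ j ∈ Finset.range J, G (hermitePoly j) :=
          Finset.sum_nonneg fun _ _ => (hG0 _).le
        positivity
    · have hx' : A < |x| := by
        by_contra hcon
        exact hx (abs_le.1 (not_lt.1 hcon))
      simp only [Set.indicator_of_notMem hx, zero_add]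
      have : ∑ i ∈ Finset.range J, τ i j * b i x = 0 := by
        refine Finset.sum_eq_zero fun i hi => ?_
        rw [(hb i (Finset.mem_range.1 hi)).2.1 x (lt_of_le_of_lt hA hx'), mul_zero]
      rw [this, zero_sub, abs_neg]
      refine (hdec (hermitePoly j) A x hA hx').trans ?_
      gcongr
      have : 0 ≤ (J : ℝ) * (T * I * B) * Real.exp κ := by positivity
      linarith

end CutHermite

/-! ### Truncated Gaussian transfer operators and their triangular action on moments. -/

section Transfer

/-- The Gaussian density truncated at `M`. -/
noncomputable def cutG (M u : ℝ) : ℝ := (Set.Icc (-M) M).indicator stdG u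

theorem cutG_nonneg (M u : ℝ) : 0 ≤ cutG M u := Set.indicator_nonneg (fun _ _ => stdG_nonneg _) u

theorem cutG_le_stdG (M u : ℝ) : cutG M u ≤ stdG u :=
  Set.indicator_le_self' (fun _ _ => stdG_nonneg _) u

theorem cutG_le_one (M u : ℝ) : cutG M u ≤ 1 := (cutG_le_stdG M u).trans (stdG_le_one u)

theorem cutG_eq_zero {M u : ℝ} (h : M < |u|) : cutG M u = 0 :=
  Set.indicator_of_notMem (fun h' : u ∈ Set.Icc (-M) M => absurd (abs_le.2 h') (not_le.2 h)) _

theorem measurable_cutG (M : ℝ) : Measurable (cutG M) :=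
  continuous_stdG.measurable.indicator measurableSet_Icc

theorem stdG_sub_cutG_le (M u : ℝ) (hM : 0 ≤ M) : stdG u - cutG M u ≤ Real.exp (-M ^ 2 / 2) := by
  by_cases h : |u| ≤ M
  · rw [cutG, Set.indicator_of_mem (Set.mem_Icc.2 (abs_le.1 h)), sub_self]
    positivity
  · rw [cutG_eq_zero (not_le.1 h), sub_zero]
    have h1 : stdG u ≤ Real.exp (-u ^ 2 / 2) := by
      refine div_le_self (Real.exp_pos _).le (Real.one_le_sqrt.2 ?_)
      nlinarith [Real.pi_gt_three]
    refine h1.trans (Real.exp_le_exp.2 ?_)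
    have : M ^ 2 ≤ u ^ 2 := by rw [← sq_abs u]; exact pow_le_pow_left₀ hM (not_le.1 h).le 2
    linarith

theorem integrable_stdG : Integrable stdG := by
  have := (integrable_exp_neg_mul_sq (b := 1 / 2) (by norm_num)).div_const (√(2 * Real.pi))
  refine this.congr (ae_of_all _ fun x => ?_)
  simp only [stdG]
  ring_nf

theorem integral_stdG : ∫ u, stdG u = 1 := by
  have h1 : ∀ u, stdG u = Real.exp (-(1 / 2) * u ^ 2) / √(2 * Real.pi) := fun u => by
    unfold stdG; ring_nf
  simp_rw [h1]
  rw [integral_div, integral_gaussian, div_eq_one_iff_eq (by positivity)]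
  congr 1
  ring

theorem integrable_cutG (M : ℝ) : Integrable (cutG M) :=
  integrable_stdG.indicator measurableSet_Icc

theorem integral_cutG_le_one (M : ℝ) : ∫ u, cutG M u ≤ 1 := by
  rw [← integral_stdG]
  exact integral_mono (integrable_cutG M) integrable_stdG (cutG_le_stdG M)

/-- A bounded measurable function supported in `[-A, A]`. -/
structure IsBddSupp (A : ℝ) (ψ : ℝ → ℂ) : Prop where
  measurable : Measurable ψ
  bdd : ∃ C, ∀ x, ‖ψ x‖ ≤ C
  support : ∀ x, A < |x| → ψ x = 0

theorem IsBddSupp.add {A : ℝ} {ψ χ : ℝ → ℂ} (h : IsBddSupp A ψ) (h' : IsBddSupp A χ) :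
    IsBddSupp A (fun x => ψ x + χ x) := by
  obtain ⟨C, hC⟩ := h.bdd
  obtain ⟨D, hD⟩ := h'.bdd
  exact ⟨h.measurable.add h'.measurable,
    ⟨C + D, fun x => (norm_add_le _ _).trans (add_le_add (hC x) (hD x))⟩,
    fun x hx => by rw [h.support x hx, h'.support x hx, add_zero]⟩

theorem IsBddSupp.const_mul {A : ℝ} {ψ : ℝ → ℂ} (h : IsBddSupp A ψ) (c : ℂ) :
    IsBddSupp A (fun x => c * ψ x) := by
  obtain ⟨C, hC⟩ := h.bdd
  exact ⟨h.measurable.const_mul c,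
    ⟨‖c‖ * C, fun x => by rw [norm_mul]; exact mul_le_mul_of_nonneg_left (hC x) (norm_nonneg c)⟩,
    fun x hx => by rw [h.support x hx, mul_zero]⟩

theorem IsBddSupp.sum {A : ℝ} {ι : Type*} (s : Finset ι) {ψ : ι → ℝ → ℂ}
    (h : ∀ i ∈ s, IsBddSupp A (ψ i)) : IsBddSupp A (fun x => ∑ i ∈ s, ψ i x) := by
  classical
  induction s using Finset.induction_on with
  | empty => exact ⟨by simp, ⟨0, by simp⟩, by simp⟩
  | insert i s hi ih =>
    simp_rw [Finset.sum_insert hi]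
    exact (h i (Finset.mem_insert_self i s)).add (ih fun j hj => h j (Finset.mem_insert_of_mem hj))

theorem IsBddSupp.sub {A : ℝ} {ψ χ : ℝ → ℂ} (h : IsBddSupp A ψ) (h' : IsBddSupp A χ) :
    IsBddSupp A (fun x => ψ x - χ x) := by
  simpa [sub_eq_add_neg] using h.add (h'.const_mul (-1))

theorem IsBddSupp.integrable {A : ℝ} {ψ : ℝ → ℂ} (h : IsBddSupp A ψ) : Integrable ψ := by
  obtain ⟨C, hC⟩ := h.bdd
  rw [← integrableOn_iff_integrable_of_support_subset (s := Set.Icc (-A) A)]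
  · exact Measure.integrableOn_of_bounded (by simp) h.measurable.aestronglyMeasurable
      (ae_of_all _ hC)
  · intro x hx
    by_contra hcon
    exact hx (h.support x (by
      by_contra h
      exact hcon (abs_le.1 (not_lt.1 h))))

theorem IsBddSupp.continuous_mul {A : ℝ} {ψ : ℝ → ℂ} (h : IsBddSupp A ψ) {g : ℝ → ℂ}
    (hg : Continuous g) : IsBddSupp A (fun x => g x * ψ x) := by
  obtain ⟨C, hC⟩ := h.bdd
  obtain ⟨D, hD⟩ := (isCompact_Icc (a := -A) (b := A)).exists_bound_of_continuousOn hg.continuousOn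
  refine ⟨hg.measurable.mul h.measurable, ⟨|D| * |C|, fun x => ?_⟩,
    fun x hx => by rw [h.support x hx, mul_zero]⟩
  by_cases hx : A < |x|
  · rw [h.support x hx, mul_zero, norm_zero]
    positivity
  · rw [norm_mul]
    exact mul_le_mul ((hD x (abs_le.1 (not_lt.1 hx))).trans (le_abs_self D))
      ((hC x).trans (le_abs_self C)) (norm_nonneg _) (abs_nonneg _)

theorem integrable_of_bounded_box {F : ℝ × ℝ → ℂ} (hF : Measurable F) {C A B : ℝ}
    (hC : ∀ z, ‖F z‖ ≤ C) (h1 : ∀ z : ℝ × ℝ, A < |z.1| → F z = 0)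
    (h2 : ∀ z : ℝ × ℝ, B < |z.2| → F z = 0) : Integrable F (volume.prod volume) := by
  rw [← integrableOn_iff_integrable_of_support_subset
    (s := Set.Icc (-A) A ×ˢ Set.Icc (-B) B)]
  · refine Measure.integrableOn_of_bounded (M := C) ?_ hF.aestronglyMeasurable (ae_of_all _ hC)
    rw [Measure.prod_prod]
    simp [ENNReal.mul_eq_top]
  · intro z hz
    constructor
    · by_contra hcon
      exact hz (h1 z (by by_contra h; exact hcon (abs_le.1 (not_lt.1 h))))
    · by_contra hcon
      exact hz (h2 z (by by_contra h; exact hcon (abs_le.1 (not_lt.1 h))))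

/-- The truncated Gaussian transfer operator `r ↦ ∫ w g_M(a y - b x) r(x) dx`. -/
noncomputable def transferLine (w a b M : ℝ) (r : ℝ → ℂ) (y : ℝ) : ℂ :=
  ∫ x, ((w * cutG M (a * y - b * x) : ℝ) : ℂ) * r x

variable {w a b M A A' : ℝ}

theorem measurable_transferLine_kernel :
    Measurable fun z : ℝ × ℝ => w * cutG M (a * z.2 - b * z.1) :=
  ((measurable_cutG M).comp (by fun_prop)).const_mul w

theorem integrable_transferLine {r : ℝ → ℂ} (hr : Integrable r) (y : ℝ) :
    Integrable fun x => ((w * cutG M (a * y - b * x) : ℝ) : ℂ) * r x := by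
  refine hr.bdd_mul (c := |w|) ?_ (ae_of_all _ fun x => ?_)
  · exact (Complex.measurable_ofReal.comp
      (((measurable_cutG M).comp (by fun_prop)).const_mul w)).aestronglyMeasurable
  · rw [Complex.norm_real, Real.norm_eq_abs, abs_mul, abs_of_nonneg (cutG_nonneg _ _)]
    exact mul_le_of_le_one_right (abs_nonneg w) (cutG_le_one _ _)

theorem norm_transferLine_le {r : ℝ → ℂ} (hr : Integrable r) (y : ℝ) :
    ‖transferLine w a b M r y‖ ≤ |w| * ∫ x, ‖r x‖ := by
  rw [← integral_const_mul]
  refine norm_integral_le_of_norm_le (hr.norm.const_mul _) (ae_of_all _ fun x => ?_)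
  rw [norm_mul, Complex.norm_real, Real.norm_eq_abs, abs_mul, abs_of_nonneg (cutG_nonneg _ _)]
  exact mul_le_mul_of_nonneg_right (mul_le_of_le_one_right (abs_nonneg w) (cutG_le_one _ _))
    (norm_nonneg _)

/-- If `|x| ≤ A` and the kernel does not vanish, then `|a| |y| ≤ M + |b| A`. Truncating the noise is
what makes bounded intervals invariant. -/
theorem IsBddSupp.transferLine {r : ℝ → ℂ} (hr : IsBddSupp A r) (ha : a ≠ 0)
    (hA : M + |b| * A ≤ |a| * A') :
    IsBddSupp A' (transferLine w a b M r) := by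
  refine ⟨?_, ⟨_, norm_transferLine_le hr.integrable⟩, fun y hy => ?_⟩
  · have h : StronglyMeasurable (Function.uncurry fun y x =>
        ((w * cutG M (a * y - b * x) : ℝ) : ℂ) * r x) :=
      ((Complex.measurable_ofReal.comp (measurable_transferLine_kernel.comp measurable_swap)).mul
        (hr.measurable.comp measurable_snd)).stronglyMeasurable
    exact (h.integral_prod_right (ν := volume)).measurable
  · refine integral_eq_zero_of_ae (ae_of_all _ fun x => ?_)
    by_cases hx : A < |x|
    · simp [hr.support x hx]
    · have h1 : M < |a * y - b * x| := by
        have h2 := abs_sub_abs_le_abs_sub (a * y) (b * x)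
        rw [abs_mul, abs_mul] at h2
        have h3 : |b| * |x| ≤ |b| * A :=
          mul_le_mul_of_nonneg_left (not_lt.1 hx) (abs_nonneg b)
        have h4 : |a| * A' < |a| * |y| := mul_lt_mul_of_pos_left hy (abs_pos.2 ha)
        linarith
      simp [cutG_eq_zero h1]

/-- The moments of a function on the line. -/
noncomputable def lineMoment (n : ℕ) (r : ℝ → ℂ) : ℂ := ∫ x : ℝ, (x : ℂ) ^ n * r x

/-- The matrix of the transfer operator on moments. -/
noncomputable def momentCoeff (w a b M : ℝ) (n k : ℕ) : ℝ :=
  |a|⁻¹ * w * (n.choose k * b ^ k / a ^ n * ∫ u, u ^ (n - k) * cutG M u)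

theorem integrable_pow_mul_cutG (n : ℕ) (M : ℝ) : Integrable fun u => u ^ n * cutG M u := by
  have h : IntegrableOn (fun u => u ^ n * stdG u) (Set.Icc (-M) M) := by
    have := continuous_stdG
    exact (by fun_prop : Continuous fun u => u ^ n * stdG u).continuousOn.integrableOn_Icc
  refine (h.integrable_indicator measurableSet_Icc).congr (ae_of_all _ fun u => ?_)
  by_cases hu : u ∈ Set.Icc (-M) M <;> simp [cutG, hu]

/-- Substituting `y = (u + b x) / a` and expanding binomially: integrating `y ^ n` against the
kernel gives a polynomial of degree at most `n` in `x`, even for truncated noise. -/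
theorem integral_pow_mul_kernel (ha : a ≠ 0) (n : ℕ) (x : ℝ) :
    ∫ y, y ^ n * (w * cutG M (a * y - b * x))
      = ∑ k ∈ Finset.range (n + 1), momentCoeff w a b M n k * x ^ k := by
  have h1 : ∀ y, y ^ n * (w * cutG M (a * y - b * x))
      = (fun z => (fun u => ((u + b * x) / a) ^ n * (w * cutG M u)) (z - b * x)) (a * y) := by
    intro y
    simp only [sub_add_cancel]
    rw [mul_div_cancel_left₀ _ ha]
  rw [integral_congr_ae (ae_of_all _ h1), Measure.integral_comp_mul_left (fun z => (fun u => ((u + b * x) / a) ^ n * (w * cutG M u)) (z - b * x)), integral_sub_right_eq_self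
    (fun u => ((u + b * x) / a) ^ n * (w * cutG M u))]
  have h2 : ∀ u, ((u + b * x) / a) ^ n * (w * cutG M u)
      = ∑ k ∈ Finset.range (n + 1),
        (w * (n.choose k * b ^ k / a ^ n) * x ^ k) * (u ^ (n - k) * cutG M u) := by
    intro u
    rw [div_pow, add_comm u, add_pow, Finset.sum_div, Finset.sum_mul]
    refine Finset.sum_congr rfl fun k _ => ?_
    rw [mul_pow]
    ring
  simp_rw [h2]
  rw [integral_finsetSum _ fun k _ => (integrable_pow_mul_cutG _ _).const_mul _, smul_eq_mul,
    Finset.mul_sum]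
  refine Finset.sum_congr rfl fun k _ => ?_
  rw [integral_const_mul, momentCoeff, abs_inv]
  ring

/-- By Fubini the moments are transformed by a lower triangular matrix; unlike the Hermite
identities this survives the truncation exactly. -/
theorem IsBddSupp.lineMoment_transferLine {r : ℝ → ℂ} (hr : IsBddSupp A r) (ha : a ≠ 0) (n : ℕ) :
    lineMoment n (_root_.transferLine w a b M r)
      = ∑ k ∈ Finset.range (n + 1), (momentCoeff w a b M n k : ℂ) * lineMoment k r := by
  obtain ⟨C, hC⟩ := hr.bdd
  set A' : ℝ := (M + |b| * A) / |a| with hA'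
  have hMA : M + |b| * A ≤ |a| * A' := by
    rw [hA', mul_div_cancel₀ _ (abs_pos.2 ha).ne']
  have hsupp : ∀ y x : ℝ, A' < |y| → |x| ≤ A → cutG M (a * y - b * x) = 0 := by
    intro y x hy hx
    refine cutG_eq_zero ?_
    have h2 := abs_sub_abs_le_abs_sub (a * y) (b * x)
    rw [abs_mul, abs_mul] at h2
    have h3 : |b| * |x| ≤ |b| * A := mul_le_mul_of_nonneg_left hx (abs_nonneg b)
    have h4 : |a| * A' < |a| * |y| := mul_lt_mul_of_pos_left hy (abs_pos.2 ha)
    linarith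
  have hprod : Integrable (Function.uncurry fun y x : ℝ =>
      (y : ℂ) ^ n * (((w * cutG M (a * y - b * x) : ℝ) : ℂ) * r x)) (volume.prod volume) := by
    refine integrable_of_bounded_box (C := |A'| ^ n * (|w| * |C|)) (A := A') (B := A) ?_ ?_ ?_ ?_
    · exact ((Complex.measurable_ofReal.comp measurable_fst).pow_const n).mul
        ((Complex.measurable_ofReal.comp
          (measurable_transferLine_kernel.comp measurable_swap)).mul
          (hr.measurable.comp measurable_snd))
    · rintro ⟨y, x⟩
      simp only [Function.uncurry]
      by_cases hx : A < |x|
      · simp only [hr.support x hx, mul_zero, norm_zero]; positivity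
      by_cases hy : A' < |y|
      · simp only [hsupp y x hy (not_lt.1 hx), mul_zero, Complex.ofReal_zero, zero_mul, norm_zero]
        positivity
      · rw [norm_mul, norm_mul, norm_pow, Complex.norm_real, Complex.norm_real, Real.norm_eq_abs,
          Real.norm_eq_abs, abs_mul, abs_of_nonneg (cutG_nonneg _ _)]
        have h1 : |y| ≤ |A'| := (not_lt.1 hy).trans (le_abs_self _)
        have h2 : |w| * cutG M (a * y - b * x) ≤ |w| :=
          mul_le_of_le_one_right (abs_nonneg w) (cutG_le_one _ _)
        have h3 : ‖r x‖ ≤ |C| := (hC x).trans (le_abs_self C)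
        have h4 := cutG_nonneg M (a * y - b * x)
        gcongr
    · rintro ⟨y, x⟩ hy
      simp only [Function.uncurry]
      by_cases hx : A < |x|
      · simp [hr.support x hx]
      · simp [hsupp y x hy (not_lt.1 hx)]
    · rintro ⟨y, x⟩ hx
      simp [Function.uncurry, hr.support x hx]
  calc lineMoment n (_root_.transferLine w a b M r)
      = ∫ y : ℝ, ∫ x : ℝ, (y : ℂ) ^ n * (((w * cutG M (a * y - b * x) : ℝ) : ℂ) * r x) := by
        simp only [lineMoment, _root_.transferLine, integral_const_mul]
    _ = ∫ x : ℝ, ∫ y : ℝ, (y : ℂ) ^ n * (((w * cutG M (a * y - b * x) : ℝ) : ℂ) * r x) :=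
        integral_integral_swap hprod
    _ = ∫ x : ℝ, ((∑ k ∈ Finset.range (n + 1), momentCoeff w a b M n k * x ^ k : ℝ) : ℂ)
          * r x := by
        refine integral_congr_ae (ae_of_all _ fun x => ?_)
        simp only
        rw [← integral_pow_mul_kernel ha n x, ← integral_complex_ofReal, ← integral_mul_const]
        refine integral_congr_ae (ae_of_all _ fun y => ?_)
        simp only
        push_cast
        ring
    _ = ∑ k ∈ Finset.range (n + 1), (momentCoeff w a b M n k : ℂ) * lineMoment k r := by
        have h1 : ∀ x : ℝ, ((∑ k ∈ Finset.range (n + 1), momentCoeff w a b M n k * x ^ k : ℝ) : ℂ)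
            * r x = ∑ k ∈ Finset.range (n + 1),
              (momentCoeff w a b M n k : ℂ) * ((x : ℂ) ^ k * r x) := by
          intro x
          push_cast
          rw [Finset.sum_mul]
          refine Finset.sum_congr rfl fun k _ => ?_
          ring
        simp_rw [h1]
        rw [integral_finsetSum]
        · simp_rw [integral_const_mul]
          rfl
        · intro k _
          refine Integrable.const_mul ?_ _
          exact (hr.continuous_mul (g := fun x : ℝ => (x : ℂ) ^ k) (by fun_prop)).integrable

/-- On the diagonal only the total mass of the truncated Gaussian enters, and this is at most one.
-/
theorem abs_momentCoeff_self_le (n : ℕ) :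
    |momentCoeff w a b M n n| ≤ |w| / |a| * |b / a| ^ n := by
  have h1 : momentCoeff w a b M n n = w / |a| * (b / a) ^ n * ∫ u, cutG M u := by
    simp only [momentCoeff, Nat.choose_self, Nat.sub_self, pow_zero, one_mul, Nat.cast_one, div_pow]
    ring
  rw [h1, abs_mul, abs_mul, abs_div, abs_abs, abs_pow]
  refine mul_le_of_le_one_right (by positivity) ?_
  rw [abs_of_nonneg (integral_nonneg (cutG_nonneg M))]
  exact integral_cutG_le_one M

theorem IsBddSupp.lineMoment_eval {r : ℝ → ℂ} (hr : IsBddSupp A r) (p : Polynomial ℝ) :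
    ∫ x, ((p.eval x : ℝ) : ℂ) * r x
      = ∑ k ∈ Finset.range (p.natDegree + 1), (p.coeff k : ℂ) * lineMoment k r := by
  have h1 : ∀ x : ℝ, ((p.eval x : ℝ) : ℂ) * r x
      = ∑ k ∈ Finset.range (p.natDegree + 1), (p.coeff k : ℂ) * ((x : ℂ) ^ k * r x) := by
    intro x
    rw [Polynomial.eval_eq_sum_range]
    push_cast
    rw [Finset.sum_mul]
    exact Finset.sum_congr rfl fun k _ => by ring
  simp_rw [h1]
  rw [integral_finsetSum]
  · simp_rw [integral_const_mul]
    rfl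
  · intro k _
    refine Integrable.const_mul ?_ _
    exact (hr.continuous_mul (g := fun x : ℝ => (x : ℂ) ^ k) (by fun_prop)).integrable

/-- A bounded function with bounded support all of whose moments vanish is zero almost
everywhere. -/
theorem IsBddSupp.ae_eq_zero_of_lineMoment {r : ℝ → ℂ} (hr : IsBddSupp A r)
    (h : ∀ n, lineMoment n r = 0) : r =ᵐ[volume] 0 := by
  refine ae_eq_zero_of_integral_contDiff_smul_eq_zero hr.integrable.locallyIntegrable ?_
  intro g hg _
  have hgr : IsBddSupp A (fun x => (g x : ℂ) * r x) :=
    hr.continuous_mul (Complex.continuous_ofReal.comp hg.continuous)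
  have h0 : ∫ x, g x • r x = ∫ x, (g x : ℂ) * r x := by simp [Complex.real_smul]
  rw [h0, ← norm_le_zero_iff]
  refine le_of_forall_pos_le_add fun δ hδ => ?_
  rw [zero_add]
  set I := ∫ x, ‖r x‖ with hI
  have hI0 : 0 ≤ I := integral_nonneg fun _ => norm_nonneg _
  -- By Weierstrass the test function is nearly a polynomial on the support of `r`, and polynomials
  -- integrate to zero against `r`.
  obtain ⟨p, hp⟩ := exists_polynomial_near_of_continuousOn (-A) A g hg.continuous.continuousOn
    (δ / (I + 1)) (by positivity)
  have hpr : IsBddSupp A (fun x => ((p.eval x : ℝ) : ℂ) * r x) :=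
    hr.continuous_mul (Complex.continuous_ofReal.comp p.continuous)
  have h1 : ∫ x, ((p.eval x : ℝ) : ℂ) * r x = 0 := by
    rw [hr.lineMoment_eval]
    simp [h]
  have h2 : ∫ x, (g x : ℂ) * r x = ∫ x, ((g x : ℂ) * r x - ((p.eval x : ℝ) : ℂ) * r x) := by
    rw [integral_sub hgr.integrable hpr.integrable, h1, sub_zero]
  rw [h2]
  calc ‖∫ x, ((g x : ℂ) * r x - ((p.eval x : ℝ) : ℂ) * r x)‖
      ≤ ∫ x, δ / (I + 1) * ‖r x‖ := by
        refine norm_integral_le_of_norm_le (hr.integrable.norm.const_mul _) (ae_of_all _ fun x => ?_)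
        by_cases hx : A < |x|
        · simp [hr.support x hx]
        · rw [← sub_mul, norm_mul, ← Complex.ofReal_sub, Complex.norm_real, Real.norm_eq_abs,
            abs_sub_comm]
          exact mul_le_mul_of_nonneg_right (hp x (abs_le.1 (not_lt.1 hx))).le (norm_nonneg _)
    _ = δ / (I + 1) * I := integral_const_mul _ _
    _ ≤ δ := by
        rw [div_mul_eq_mul_div, div_le_iff₀ (by positivity)]
        nlinarith

/-- A cyclic pair of transfer operators has no eigenfunctions with vanishing low moments for large
eigenvalues. -/
theorem eq_zero_of_transferLine_pair {w₁ a₁ b₁ w₂ a₂ b₂ A₁ A₂ : ℝ} (ha₁ : a₁ ≠ 0) (ha₂ : a₂ ≠ 0)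
    {J : ℕ} {lam : ℂ} (hbig : ∀ n, J ≤ n →
      |w₁| / |a₁| * |b₁ / a₁| ^ n * (|w₂| / |a₂| * |b₂ / a₂| ^ n) < ‖lam‖ ^ 2)
    {r₁ r₂ : ℝ → ℂ} (h₁ : IsBddSupp A₁ r₁) (h₂ : IsBddSupp A₂ r₂)
    (hm₁ : ∀ n < J, lineMoment n r₁ = 0) (hm₂ : ∀ n < J, lineMoment n r₂ = 0)
    (he₁ : ∀ y, transferLine w₁ a₁ b₁ M r₁ y = lam * r₂ y)
    (he₂ : ∀ y, transferLine w₂ a₂ b₂ M r₂ y = lam * r₁ y) :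
    (∀ x, r₁ x = 0) ∧ ∀ x, r₂ x = 0 := by
  have hlam : lam ≠ 0 := by
    rintro rfl
    have := hbig J le_rfl
    simp only [norm_zero, ne_eq, OfNat.ofNat_ne_zero, not_false_eq_true, zero_pow] at this
    exact absurd this (not_lt.2 (by positivity))
  have hT₁ : transferLine w₁ a₁ b₁ M r₁ = fun y => lam * r₂ y := funext he₁
  have hT₂ : transferLine w₂ a₂ b₂ M r₂ = fun y => lam * r₁ y := funext he₂
  have hmul : ∀ n (r : ℝ → ℂ), lineMoment n (fun y => lam * r y) = lam * lineMoment n r := by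
    intro n r
    simp only [lineMoment, mul_left_comm _ lam]
    exact integral_const_mul _ _
  -- By triangularity, once the lower moments vanish the two moments of order `n` are exchanged with
  -- factors `c₁` and `c₂`. A nonzero pair would force `lam ^ 2 = c₁ c₂`, which `hbig` excludes.
  have hmom : ∀ n, lineMoment n r₁ = 0 ∧ lineMoment n r₂ = 0 := by
    intro n
    induction n using Nat.strong_induction_on with
    | _ n ih =>
      by_cases hn : n < J
      · exact ⟨hm₁ n hn, hm₂ n hn⟩
      · have e1 := h₁.lineMoment_transferLine (w := w₁) (b := b₁) (M := M) ha₁ n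
        have e2 := h₂.lineMoment_transferLine (w := w₂) (b := b₂) (M := M) ha₂ n
        rw [Finset.sum_range_succ, Finset.sum_eq_zero (fun k hk => by
          rw [(ih k (Finset.mem_range.1 hk)).1, mul_zero]), zero_add, hT₁, hmul] at e1
        rw [Finset.sum_range_succ, Finset.sum_eq_zero (fun k hk => by
          rw [(ih k (Finset.mem_range.1 hk)).2, mul_zero]), zero_add, hT₂, hmul] at e2
        set c₁ := momentCoeff w₁ a₁ b₁ M n n
        set c₂ := momentCoeff w₂ a₂ b₂ M n n
        have h0 : lineMoment n r₁ = 0 := by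
          by_contra hne
          have e3 : (lam ^ 2 - c₁ * c₂) * lineMoment n r₁ = 0 := by
            linear_combination lam * e2 + c₂ * e1
          rcases mul_eq_zero.1 e3 with e4 | e4
          · have e5 : ‖lam‖ ^ 2 = |c₁| * |c₂| := by
              rw [← norm_pow, sub_eq_zero.1 e4, norm_mul, Complex.norm_real, Complex.norm_real]
              rfl
            have e6 : |c₁| * |c₂| ≤ |w₁| / |a₁| * |b₁ / a₁| ^ n * (|w₂| / |a₂| * |b₂ / a₂| ^ n) :=
              mul_le_mul (abs_momentCoeff_self_le n) (abs_momentCoeff_self_le n) (abs_nonneg _)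
                (by positivity)
            exact absurd (hbig n (not_lt.1 hn)) (not_lt.2 (e5.trans_le e6))
          · exact hne e4
        refine ⟨h0, ?_⟩
        rw [h0, mul_zero] at e1
        exact (mul_eq_zero.1 e1).resolve_left hlam
  have z1 := h₁.ae_eq_zero_of_lineMoment fun n => (hmom n).1
  have z2 := h₂.ae_eq_zero_of_lineMoment fun n => (hmom n).2
  -- The eigenvalue equation expresses each value as an integral, so vanishing almost everywhere
  -- implies vanishing everywhere.
  constructor
  · intro x
    have : transferLine w₂ a₂ b₂ M r₂ x = 0 :=
      integral_eq_zero_of_ae (z2.mono fun y hy => by simp [hy])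
    rw [he₂] at this
    exact (mul_eq_zero.1 this).resolve_left hlam
  · intro x
    have : transferLine w₁ a₁ b₁ M r₁ x = 0 :=
      integral_eq_zero_of_ae (z1.mono fun y hy => by simp [hy])
    rw [he₁] at this
    exact (mul_eq_zero.1 this).resolve_left hlam

end Transfer

/-! ### The corrected transfer operator on the line, diagonal on the cut-off Hermite functions. -/

section Block

theorem exists_abs_hermiteFn_le (n : ℕ) : ∃ C > 0, ∀ x, |hermiteFn n x| ≤ C := by
  obtain ⟨C, hC, h⟩ := exists_abs_eval_mul_gauss_le (hermitePoly n)
  refine ⟨C, hC, fun x => (h x).trans ?_⟩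
  exact mul_le_of_le_one_right hC.le (Real.exp_le_one_iff.2 (by nlinarith [sq_nonneg x]))

/-- The coefficient of `ψ` with respect to the `j`-th scaled Hermite function. -/
noncomputable def hermCoeff (α : ℝ) (j : ℕ) (ψ : ℝ → ℂ) : ℂ :=
  (∫ x : ℝ, (((hermitePoly j).eval (α * x) : ℝ) : ℂ) * ψ x) * ((α / hermiteNorm j : ℝ) : ℂ)

/-- The part of `ψ` that is orthogonal to the first `J` scaled Hermite polynomials. -/
noncomputable def cutRem (J : ℕ) (α : ℝ) (e : ℕ → ℝ → ℝ) (ψ : ℝ → ℂ) (x : ℝ) : ℂ :=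
  ψ x - ∑ j ∈ Finset.range J, hermCoeff α j ψ * (e j x : ℂ)

/-- The deviation of `e j` from being mapped to `ν j • e' j` by the transfer operator. -/
noncomputable def lineDefect (w a b M : ℝ) (ν : ℕ → ℝ) (e e' : ℕ → ℝ → ℝ) (j : ℕ) (y : ℝ) : ℝ :=
  ν j * e' j y - ∫ x, w * cutG M (a * y - b * x) * e j x

/-- The transfer kernel with a finite rank correction that maps `e j` to `ν j • e' j`. -/
noncomputable def blockLine (J : ℕ) (α A w a b M : ℝ) (ν : ℕ → ℝ) (e e' : ℕ → ℝ → ℝ) (x y : ℝ) :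
    ℝ :=
  w * cutG M (a * y - b * x) + ∑ j ∈ Finset.range J,
    (Set.Icc (-A) A).indicator (fun x => (hermitePoly j).eval (α * x)) x * (α / hermiteNorm j)
      * lineDefect w a b M ν e e' j y

/-- The operator on the line with kernel `blockLine`. -/
noncomputable def blockOp (J : ℕ) (α A w a b M : ℝ) (ν : ℕ → ℝ) (e e' : ℕ → ℝ → ℝ) (ψ : ℝ → ℂ)
    (y : ℝ) : ℂ :=
  ∫ x, (blockLine J α A w a b M ν e e' x y : ℂ) * ψ x

variable {J : ℕ} {α α' A A' C C' κ κ' w a b M : ℝ} {e e' : ℕ → ℝ → ℝ} {ν : ℕ → ℝ}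

theorem IsCutHermite.isBddSupp (he : IsCutHermite J α A C κ e) (hC : 0 ≤ C) (hκ : 0 ≤ κ) {j : ℕ}
    (hj : j < J) : IsBddSupp A (fun x => (e j x : ℂ)) := by
  obtain ⟨D, hD, h⟩ := exists_abs_hermiteFn_le j
  refine ⟨Complex.measurable_ofReal.comp (he.measurable j hj), ⟨C + D, fun x => ?_⟩,
    fun x hx => by rw [he.support j hj x hx, Complex.ofReal_zero]⟩
  rw [Complex.norm_real, Real.norm_eq_abs]
  have h1 := he.approx j hj x
  have h2 : C * Real.exp (-κ * A ^ 2) * Real.exp (-κ * x ^ 2) ≤ C := by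
    rw [mul_assoc, ← Real.exp_add]
    refine mul_le_of_le_one_right hC (Real.exp_le_one_iff.2 ?_)
    nlinarith [mul_nonneg hκ (sq_nonneg A), mul_nonneg hκ (sq_nonneg x)]
  have h3 := abs_sub_abs_le_abs_sub (e j x) (hermiteFn j (α * x))
  linarith [h (α * x)]

theorem integrable_eval_mul (p : Polynomial ℝ) (α : ℝ) {ψ : ℝ → ℂ} (hψ : IsBddSupp A ψ) :
    Integrable fun x => ((p.eval (α * x) : ℝ) : ℂ) * ψ x :=
  (hψ.continuous_mul (g := fun x => ((p.eval (α * x) : ℝ) : ℂ)) (by fun_prop)).integrable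

theorem hermCoeff_sub (j : ℕ) {ψ χ : ℝ → ℂ} (hψ : IsBddSupp A ψ) (hχ : IsBddSupp A χ) :
    hermCoeff α j (fun x => ψ x - χ x) = hermCoeff α j ψ - hermCoeff α j χ := by
  simp only [hermCoeff, mul_sub]
  rw [integral_sub (integrable_eval_mul _ _ hψ) (integrable_eval_mul _ _ hχ), sub_mul]

theorem hermCoeff_add (j : ℕ) {ψ χ : ℝ → ℂ} (hψ : IsBddSupp A ψ) (hχ : IsBddSupp A χ) :
    hermCoeff α j (fun x => ψ x + χ x) = hermCoeff α j ψ + hermCoeff α j χ := by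
  simp only [hermCoeff, mul_add]
  rw [integral_add (integrable_eval_mul _ _ hψ) (integrable_eval_mul _ _ hχ), add_mul]

theorem hermCoeff_const_mul (j : ℕ) (c : ℂ) (ψ : ℝ → ℂ) :
    hermCoeff α j (fun x => c * ψ x) = c * hermCoeff α j ψ := by
  simp only [hermCoeff, mul_left_comm _ c]
  rw [integral_const_mul, mul_assoc]

theorem hermCoeff_sum (j : ℕ) {ι : Type*} (s : Finset ι) {ψ : ι → ℝ → ℂ}
    (h : ∀ i ∈ s, IsBddSupp A (ψ i)) :
    hermCoeff α j (fun x => ∑ i ∈ s, ψ i x) = ∑ i ∈ s, hermCoeff α j (ψ i) := by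
  simp only [hermCoeff, Finset.mul_sum]
  rw [integral_finsetSum _ fun i hi => integrable_eval_mul _ _ (h i hi), Finset.sum_mul]

theorem IsCutHermite.hermCoeff_eq (he : IsCutHermite J α A C κ e) (hα : 0 < α) {i j : ℕ}
    (hi : i < J) (hj : j < J) :
    hermCoeff α i (fun x => (e j x : ℂ)) = if i = j then 1 else 0 := by
  have h1 : ∫ x, (((hermitePoly i).eval (α * x) : ℝ) : ℂ) * (e j x : ℂ)
      = ((∫ x, e j x * (hermitePoly i).eval (α * x) : ℝ) : ℂ) := by
    rw [← integral_complex_ofReal]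
    refine integral_congr_ae (ae_of_all _ fun x => ?_)
    simp only
    push_cast
    ring
  rw [hermCoeff, h1, he.biorth j hj i hi]
  have := (hermiteNorm_pos j).ne'
  split_ifs with hij
  · subst hij
    rw [← Complex.ofReal_mul, div_mul_div_cancel₀ hα.ne', div_self this, Complex.ofReal_one]
  · simp

theorem IsCutHermite.isBddSupp_sum (he : IsCutHermite J α A C κ e) (hC : 0 ≤ C) (hκ : 0 ≤ κ)
    (c : ℕ → ℂ) : IsBddSupp A (fun x => ∑ j ∈ Finset.range J, c j * (e j x : ℂ)) :=
  IsBddSupp.sum _ fun _ hj => (he.isBddSupp hC hκ (Finset.mem_range.1 hj)).const_mul _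

theorem IsCutHermite.hermCoeff_sum_eq (he : IsCutHermite J α A C κ e) (hα : 0 < α) (hC : 0 ≤ C)
    (hκ : 0 ≤ κ) (c : ℕ → ℂ) {i : ℕ} (hi : i < J) :
    hermCoeff α i (fun x => ∑ j ∈ Finset.range J, c j * (e j x : ℂ)) = c i := by
  rw [hermCoeff_sum (A := A) _ _ fun j hj =>
    (he.isBddSupp hC hκ (Finset.mem_range.1 hj)).const_mul _]
  rw [Finset.sum_congr rfl fun j hj => by
    rw [hermCoeff_const_mul, he.hermCoeff_eq hα hi (Finset.mem_range.1 hj)]]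
  simp [hi]

theorem IsCutHermite.isBddSupp_cutRem (he : IsCutHermite J α A C κ e) (hC : 0 ≤ C) (hκ : 0 ≤ κ)
    {ψ : ℝ → ℂ} (hψ : IsBddSupp A ψ) : IsBddSupp A (cutRem J α e ψ) :=
  hψ.sub (he.isBddSupp_sum hC hκ _)

theorem IsCutHermite.hermCoeff_cutRem (he : IsCutHermite J α A C κ e) (hα : 0 < α) (hC : 0 ≤ C)
    (hκ : 0 ≤ κ) {ψ : ℝ → ℂ} (hψ : IsBddSupp A ψ) {i : ℕ} (hi : i < J) :
    hermCoeff α i (cutRem J α e ψ) = 0 := by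
  have := hermCoeff_sub (α := α) i hψ (he.isBddSupp_sum hC hκ fun j => hermCoeff α j ψ)
  rw [he.hermCoeff_sum_eq hα hC hκ _ hi, sub_self] at this
  exact this

/-- Vanishing of the first Hermite coefficients means vanishing of the first moments. -/
theorem lineMoment_eq_zero_of_hermCoeff (hα : 0 < α) {r : ℝ → ℂ} (hr : IsBddSupp A r)
    (h : ∀ i < J, hermCoeff α i r = 0) {n : ℕ} (hn : n < J) : lineMoment n r = 0 := by
  obtain ⟨v, hv⟩ := mem_span_hermitePoly J (Polynomial.X ^ n) (by simpa using hn)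
  have h1 : ∀ x : ℝ, (x : ℂ) ^ n * r x = ∑ k ∈ Finset.range J,
      ((v k / α ^ n : ℝ) : ℂ) * ((((hermitePoly k).eval (α * x) : ℝ) : ℂ) * r x) := by
    intro x
    have h2 := congrArg (Polynomial.eval (α * x)) hv
    rw [Polynomial.eval_finsetSum] at h2
    simp only [Polynomial.eval_pow, Polynomial.eval_X, Polynomial.eval_smul, smul_eq_mul] at h2
    have h3 : x ^ n = ∑ k ∈ Finset.range J, v k / α ^ n * (hermitePoly k).eval (α * x) := by
      rw [mul_pow] at h2
      simp_rw [div_mul_eq_mul_div]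
      rw [← Finset.sum_div, ← h2, mul_div_cancel_left₀ _ (by positivity)]
    rw [← Complex.ofReal_pow, h3]
    push_cast
    rw [Finset.sum_mul]
    exact Finset.sum_congr rfl fun k _ => by ring
  rw [lineMoment]
  simp_rw [h1]
  rw [integral_finsetSum _ fun k _ => (integrable_eval_mul _ _ hr).const_mul _]
  refine Finset.sum_eq_zero fun k hk => ?_
  rw [integral_const_mul]
  have h4 := h k (Finset.mem_range.1 hk)
  rw [hermCoeff] at h4
  have h5 : ((α / hermiteNorm k : ℝ) : ℂ) ≠ 0 := by
    exact_mod_cast (div_pos hα (hermiteNorm_pos k)).ne'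
  rw [(mul_eq_zero.1 h4).resolve_right h5, mul_zero]

/-- Vanishing of the first `J` moments does not depend on the scaling. This permits passing from `α`
in the source to `α'` in the target. -/
theorem hermCoeff_eq_zero_of_lineMoment (α : ℝ) {r : ℝ → ℂ} (hr : IsBddSupp A r)
    (h : ∀ n < J, lineMoment n r = 0) {i : ℕ} (hi : i < J) : hermCoeff α i r = 0 := by
  have h1 := hr.lineMoment_eval ((hermitePoly i).comp (Polynomial.C α * Polynomial.X))
  simp only [Polynomial.eval_comp, Polynomial.eval_mul, Polynomial.eval_C, Polynomial.eval_X] at h1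
  rw [hermCoeff, h1, Finset.sum_eq_zero, zero_mul]
  intro k hk
  rw [h k, mul_zero]
  have h2 := Nat.lt_succ_iff.1 (Finset.mem_range.1 hk)
  have h3 : ((hermitePoly i).comp (Polynomial.C α * Polynomial.X)).natDegree ≤ i := by
    refine Polynomial.natDegree_comp_le.trans ?_
    calc _ ≤ i * 1 := Nat.mul_le_mul (degree_hermitePoly i).1 ((Polynomial.natDegree_C_mul_le α _).trans Polynomial.natDegree_X_le)
      _ = i := mul_one i
  omega

/-- Triangularity makes the space of functions without low moments invariant. -/
theorem lineMoment_transferLine_eq_zero {r : ℝ → ℂ} (hr : IsBddSupp A r) (ha : a ≠ 0)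
    (h : ∀ n < J, lineMoment n r = 0) : ∀ n < J, lineMoment n (transferLine w a b M r) = 0 := by
  intro n hn
  rw [hr.lineMoment_transferLine ha]
  refine Finset.sum_eq_zero fun k hk => ?_
  rw [h k (lt_of_le_of_lt (Nat.lt_succ_iff.1 (Finset.mem_range.1 hk)) hn), mul_zero]

theorem transferLine_sub {r s : ℝ → ℂ} (hr : Integrable r) (hs : Integrable s) (y : ℝ) :
    transferLine w a b M (fun x => r x - s x) y
      = transferLine w a b M r y - transferLine w a b M s y := by
  simp only [transferLine, mul_sub]
  exact integral_sub (integrable_transferLine hr y) (integrable_transferLine hs y)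

theorem transferLine_sum {ι : Type*} (s : Finset ι) {ψ : ι → ℝ → ℂ}
    (h : ∀ i ∈ s, Integrable (ψ i)) (c : ι → ℂ) (y : ℝ) :
    transferLine w a b M (fun x => ∑ i ∈ s, c i * ψ i x) y
      = ∑ i ∈ s, c i * transferLine w a b M (ψ i) y := by
  simp only [transferLine, Finset.mul_sum, mul_left_comm _ (c _)]
  rw [integral_finsetSum _ fun i hi => (integrable_transferLine (h i hi) y).const_mul _]
  exact Finset.sum_congr rfl fun i _ => integral_const_mul _ _

theorem transferLine_ofReal (f : ℝ → ℝ) (y : ℝ) :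
    transferLine w a b M (fun x => (f x : ℂ)) y
      = ((∫ x, w * cutG M (a * y - b * x) * f x : ℝ) : ℂ) := by
  rw [← integral_complex_ofReal]
  refine integral_congr_ae (ae_of_all _ fun x => ?_)
  simp

/-- The indicator in `blockLine` only serves to keep the kernel bounded; it is invisible to
functions supported in `[-A, A]`. -/
theorem blockOp_eq_add {ψ : ℝ → ℂ} (hψ : IsBddSupp A ψ) (y : ℝ) :
    blockOp J α A w a b M ν e e' ψ y = transferLine w a b M ψ y
      + ∑ j ∈ Finset.range J, hermCoeff α j ψ * (lineDefect w a b M ν e e' j y : ℂ) := by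
  have h1 : ∀ x, (blockLine J α A w a b M ν e e' x y : ℂ) * ψ x
      = ((w * cutG M (a * y - b * x) : ℝ) : ℂ) * ψ x + ∑ j ∈ Finset.range J,
        (((α / hermiteNorm j : ℝ) : ℂ) * (lineDefect w a b M ν e e' j y : ℂ))
          * ((((hermitePoly j).eval (α * x) : ℝ) : ℂ) * ψ x) := by
    intro x
    rw [blockLine, Complex.ofReal_add, add_mul, Complex.ofReal_sum, Finset.sum_mul]
    congr 1
    refine Finset.sum_congr rfl fun j _ => ?_
    by_cases hx : x ∈ Set.Icc (-A) A
    · rw [Set.indicator_of_mem hx]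
      push_cast
      ring
    · rw [hψ.support x (by by_contra h; exact hx (abs_le.1 (not_lt.1 h)))]
      simp
  rw [blockOp]
  simp_rw [h1]
  rw [integral_add (integrable_transferLine hψ.integrable y)
    (integrable_finsetSum _ fun j _ => (integrable_eval_mul _ _ hψ).const_mul _),
    integral_finsetSum _ fun j _ => (integrable_eval_mul _ _ hψ).const_mul _]
  congr 1
  refine Finset.sum_congr rfl fun j _ => ?_
  rw [integral_const_mul, hermCoeff]
  ring

/-- The correction replaces the image of each `e j` by `ν j • e' j` and leaves the remainder
`cutRem` to the uncorrected transfer operator. -/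
theorem IsCutHermite.blockOp_eq (he : IsCutHermite J α A C κ e) (hC : 0 ≤ C) (hκ : 0 ≤ κ)
    {ψ : ℝ → ℂ} (hψ : IsBddSupp A ψ) (y : ℝ) :
    blockOp J α A w a b M ν e e' ψ y
      = ∑ j ∈ Finset.range J, (ν j * hermCoeff α j ψ) * (e' j y : ℂ)
        + transferLine w a b M (cutRem J α e ψ) y := by
  rw [blockOp_eq_add hψ]
  have h1 : transferLine w a b M (cutRem J α e ψ) y = transferLine w a b M ψ y
      - ∑ j ∈ Finset.range J, hermCoeff α j ψ *
        ((∫ x, w * cutG M (a * y - b * x) * e j x : ℝ) : ℂ) := by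
    have := transferLine_sub (w := w) (a := a) (b := b) (M := M) hψ.integrable
      (he.isBddSupp_sum hC hκ fun j => hermCoeff α j ψ).integrable y
    rw [transferLine_sum _ fun j hj =>
      (he.isBddSupp hC hκ (Finset.mem_range.1 hj)).integrable] at this
    simp_rw [transferLine_ofReal] at this
    exact this
  rw [h1, add_sub, add_comm (∑ j ∈ Finset.range J, _), add_sub_assoc, ← Finset.sum_sub_distrib]
  congr 1
  refine Finset.sum_congr rfl fun j _ => ?_
  rw [lineDefect]
  push_cast
  ring

/-- The corrected operator maps `e j` to `ν j • e' j`. -/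
theorem IsCutHermite.blockOp_self (he : IsCutHermite J α A C κ e) (hα : 0 < α) (hC : 0 ≤ C)
    (hκ : 0 ≤ κ) {j : ℕ} (hj : j < J) (y : ℝ) :
    blockOp J α A w a b M ν e e' (fun x => (e j x : ℂ)) y = (ν j * e' j y : ℝ) := by
  rw [he.blockOp_eq hC hκ (he.isBddSupp hC hκ hj)]
  have h0 : cutRem J α e (fun x => (e j x : ℂ)) = fun _ => 0 := by
    funext x
    rw [cutRem, Finset.sum_congr rfl fun i hi => by
      rw [he.hermCoeff_eq hα (Finset.mem_range.1 hi) hj]]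
    simp [hj]
  have h1 : transferLine w a b M (fun _ => 0) y = 0 := by simp [transferLine]
  rw [h0, h1, add_zero, Finset.sum_congr rfl fun i hi => by
    rw [he.hermCoeff_eq hα (Finset.mem_range.1 hi) hj]]
  simp [hj]

variable (hα : 0 < α) (hα' : 0 < α') (hC : 0 ≤ C) (hκ : 0 ≤ κ) (hC' : 0 ≤ C') (hκ' : 0 ≤ κ')
  (he : IsCutHermite J α A C κ e) (he' : IsCutHermite J α' A' C' κ' e') (ha : a ≠ 0)
  (hA : M + |b| * A ≤ |a| * A')

include hα hC hκ he in
theorem IsCutHermite.lineMoment_cutRem {ψ : ℝ → ℂ} (hψ : IsBddSupp A ψ) :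
    ∀ n < J, lineMoment n (cutRem J α e ψ) = 0 := fun _ hn =>
  lineMoment_eq_zero_of_hermCoeff hα (he.isBddSupp_cutRem hC hκ hψ)
    (fun _ hi => he.hermCoeff_cutRem hα hC hκ hψ hi) hn

-- The remainder keeps vanishing low moments under the transfer operator, so it does not contribute
-- to the Hermite coefficients of the image.
include hα hα' hC hκ hC' hκ' he he' ha hA in
theorem IsCutHermite.hermCoeff_blockOp {ψ : ℝ → ℂ} (hψ : IsBddSupp A ψ) {i : ℕ} (hi : i < J) :
    hermCoeff α' i (blockOp J α A w a b M ν e e' ψ) = ν i * hermCoeff α i ψ := by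
  have hr := he.isBddSupp_cutRem hC hκ hψ
  have h1 : blockOp J α A w a b M ν e e' ψ = fun y =>
      (∑ j ∈ Finset.range J, (ν j * hermCoeff α j ψ) * (e' j y : ℂ))
        + transferLine w a b M (cutRem J α e ψ) y := funext fun y => he.blockOp_eq hC hκ hψ y
  rw [h1, hermCoeff_add i (he'.isBddSupp_sum hC' hκ' _) (hr.transferLine ha hA),
    he'.hermCoeff_sum_eq hα' hC' hκ' _ hi,
    hermCoeff_eq_zero_of_lineMoment α' (hr.transferLine ha hA)
      (lineMoment_transferLine_eq_zero hr ha (he.lineMoment_cutRem hα hC hκ hψ)) hi, add_zero]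

-- Together with `hermCoeff_blockOp` this decouples the operator into a diagonal part and the plain
-- transfer operator on remainders.
include hα hα' hC hκ hC' hκ' he he' ha hA in
theorem IsCutHermite.cutRem_blockOp {ψ : ℝ → ℂ} (hψ : IsBddSupp A ψ) (y : ℝ) :
    cutRem J α' e' (blockOp J α A w a b M ν e e' ψ) y
      = transferLine w a b M (cutRem J α e ψ) y := by
  rw [cutRem, Finset.sum_congr rfl fun i hi => by
    rw [he.hermCoeff_blockOp hα hα' hC hκ hC' hκ' he' ha hA hψ (Finset.mem_range.1 hi)],
    he.blockOp_eq hC hκ hψ]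
  ring

theorem cutRem_const_mul (c : ℂ) (ψ : ℝ → ℂ) (y : ℝ) :
    cutRem J α e (fun x => c * ψ x) y = c * cutRem J α e ψ y := by
  simp only [cutRem, hermCoeff_const_mul, mul_sub, Finset.mul_sum, mul_assoc]

end Block

/-- The eigenvalue problem of a cyclic pair of corrected transfer operators reduces to the span of
the cut-off Hermite functions. -/
theorem blockOp_pair_spectrum {J : ℕ} {M : ℝ} {α₁ A₁ C₁ κ₁ w₁ a₁ b₁ α₂ A₂ C₂ κ₂ w₂ a₂ b₂ : ℝ}
    {ν₁ ν₂ : ℕ → ℝ} {e₁ e₂ : ℕ → ℝ → ℝ} (hα₁ : 0 < α₁) (hα₂ : 0 < α₂) (hC₁ : 0 ≤ C₁)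
    (hκ₁ : 0 ≤ κ₁) (hC₂ : 0 ≤ C₂) (hκ₂ : 0 ≤ κ₂) (he₁ : IsCutHermite J α₁ A₁ C₁ κ₁ e₁)
    (he₂ : IsCutHermite J α₂ A₂ C₂ κ₂ e₂) (ha₁ : a₁ ≠ 0) (ha₂ : a₂ ≠ 0)
    (hA₁ : M + |b₁| * A₁ ≤ |a₁| * A₂) (hA₂ : M + |b₂| * A₂ ≤ |a₂| * A₁) {lam : ℂ}
    (hbig : ∀ n, J ≤ n →
      |w₁| / |a₁| * |b₁ / a₁| ^ n * (|w₂| / |a₂| * |b₂ / a₂| ^ n) < ‖lam‖ ^ 2)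
    {ψ₁ ψ₂ : ℝ → ℂ} (h₁ : IsBddSupp A₁ ψ₁) (h₂ : IsBddSupp A₂ ψ₂)
    (hψ₁ : ∀ y, blockOp J α₁ A₁ w₁ a₁ b₁ M ν₁ e₁ e₂ ψ₁ y = lam * ψ₂ y)
    (hψ₂ : ∀ y, blockOp J α₂ A₂ w₂ a₂ b₂ M ν₂ e₂ e₁ ψ₂ y = lam * ψ₁ y) :
    (∀ x, ψ₁ x = ∑ j ∈ Finset.range J, hermCoeff α₁ j ψ₁ * (e₁ j x : ℂ)) ∧
    (∀ x, ψ₂ x = ∑ j ∈ Finset.range J, hermCoeff α₂ j ψ₂ * (e₂ j x : ℂ)) ∧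
    (∀ j < J, ν₁ j * hermCoeff α₁ j ψ₁ = lam * hermCoeff α₂ j ψ₂) ∧
    ∀ j < J, ν₂ j * hermCoeff α₂ j ψ₂ = lam * hermCoeff α₁ j ψ₁ := by
  have f₁ : blockOp J α₁ A₁ w₁ a₁ b₁ M ν₁ e₁ e₂ ψ₁ = fun y => lam * ψ₂ y := funext hψ₁
  have f₂ : blockOp J α₂ A₂ w₂ a₂ b₂ M ν₂ e₂ e₁ ψ₂ = fun y => lam * ψ₁ y := funext hψ₂
  -- The remainders solve the uncorrected cyclic eigenvalue problem and have no moments below `J`,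
  -- hence vanish.
  have hz := eq_zero_of_transferLine_pair (M := M) ha₁ ha₂ hbig
    (he₁.isBddSupp_cutRem hC₁ hκ₁ h₁) (he₂.isBddSupp_cutRem hC₂ hκ₂ h₂)
    (he₁.lineMoment_cutRem hα₁ hC₁ hκ₁ h₁) (he₂.lineMoment_cutRem hα₂ hC₂ hκ₂ h₂)
    (fun y => by
      rw [← he₁.cutRem_blockOp hα₁ hα₂ hC₁ hκ₁ hC₂ hκ₂ he₂ ha₁ hA₁ (ν := ν₁) h₁, f₁,
        cutRem_const_mul])
    (fun y => by
      rw [← he₂.cutRem_blockOp hα₂ hα₁ hC₂ hκ₂ hC₁ hκ₁ he₁ ha₂ hA₂ (ν := ν₂) h₂, f₂,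
        cutRem_const_mul])
  refine ⟨fun x => sub_eq_zero.1 (hz.1 x), fun x => sub_eq_zero.1 (hz.2 x), fun j hj => ?_,
    fun j hj => ?_⟩
  · rw [← he₁.hermCoeff_blockOp hα₁ hα₂ hC₁ hκ₁ hC₂ hκ₂ he₂ ha₁ hA₁ (ν := ν₁) h₁ hj, f₁,
      hermCoeff_const_mul]
  · rw [← he₂.hermCoeff_blockOp hα₂ hα₁ hC₂ hκ₂ hC₁ hκ₁ he₁ ha₂ hA₂ (ν := ν₂) h₂ hj, f₂,
      hermCoeff_const_mul]

/-! ### The finite rank correction is exponentially small. -/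

section DefectBound

variable {J : ℕ} {α α' a b w R R' C κ C' κ' : ℝ}

/-- The factor by which a Gaussian transfer operator multiplies the `j`-th Hermite function. -/
noncomputable def hermMult (α α' w a b : ℝ) (j : ℕ) : ℝ :=
  w * (α' / (|a| * α) * (b * α' / (a * α)) ^ j)

/-- With exact multiplier, exact Hermite functions and untruncated noise the defect is zero by
`integral_hermiteFn_mul_stdG`. The four terms are the costs of changing `ν j`, `e' j`, the Gaussian,
and `e j`. -/
theorem abs_lineDefect_le (hα : 0 < α) (hα' : 0 < α') (ha : a ≠ 0)
    (hrel : a ^ 2 * α ^ 2 = α' ^ 2 * (b ^ 2 + 2 * α ^ 2)) (hw : 0 ≤ w) (hC : 0 < C) (hκ : 0 < κ)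
    (hC' : 0 < C') (hκ' : 0 < κ') {M A A' : ℝ} (hM : 0 ≤ M) {e e' : ℕ → ℝ → ℝ} {ν : ℕ → ℝ}
    (he : IsCutHermite J α A C κ e) (he' : IsCutHermite J α' A' C' κ' e') {D : ℝ} {j : ℕ}
    (hD : ∀ x, |hermiteFn j x| ≤ D) (hj : j < J) (y : ℝ) :
    |lineDefect w a b M ν e e' j y| ≤ |ν j - hermMult α α' w a b j| * (C' + D)
      + |hermMult α α' w a b j| * (C' * Real.exp (-κ' * A' ^ 2))
      + w * (Real.exp (-M ^ 2 / 2) * ∫ x, |hermiteFn j (α * x)|)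
      + w * (C * Real.exp (-κ * A ^ 2) * ∫ x : ℝ, Real.exp (-κ * x ^ 2)) := by
  have hh := integrable_hermiteFn_comp_mul j hα.ne'
  have hec : Integrable (e j) := by
    have := (he.isBddSupp hC.le hκ.le hj).integrable.re
    simpa using this
  have hcm : ∀ M, Measurable fun x => cutG M (a * y - b * x) := fun M =>
    (measurable_cutG M).comp (by fun_prop)
  have hi1 : ∀ f : ℝ → ℝ, Integrable f → Integrable fun x => cutG M (a * y - b * x) * f x := by
    intro f hf
    refine hf.bdd_mul (c := 1) (hcm M).aestronglyMeasurable (ae_of_all _ fun x => ?_)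
    rw [Real.norm_eq_abs, abs_of_nonneg (cutG_nonneg _ _)]
    exact cutG_le_one _ _
  have hi2 : Integrable fun x => hermiteFn j (α * x) * stdG (a * y - b * x) := by
    have := continuous_stdG
    refine hh.mul_bdd (c := 1) ?_ (ae_of_all _ fun x => ?_)
    · exact (by fun_prop : Continuous fun x => stdG (a * y - b * x)).aestronglyMeasurable
    · rw [Real.norm_eq_abs, abs_of_nonneg (stdG_nonneg _)]
      exact stdG_le_one _
  have key : lineDefect w a b M ν e e' j y = (ν j - hermMult α α' w a b j) * e' j y
      + hermMult α α' w a b j * (e' j y - hermiteFn j (α' * y))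
      + w * (∫ x, (hermiteFn j (α * x) * stdG (a * y - b * x)
        - cutG M (a * y - b * x) * hermiteFn j (α * x)))
      + w * ∫ x, (cutG M (a * y - b * x) * hermiteFn j (α * x)
        - cutG M (a * y - b * x) * e j x) := by
    rw [integral_sub hi2 (hi1 _ hh), integral_sub (hi1 _ hh) (hi1 _ hec),
      integral_hermiteFn_mul_stdG hα hα' ha hrel, lineDefect]
    simp_rw [mul_assoc w]
    rw [integral_const_mul, hermMult]
    ring
  have b1 : |e' j y| ≤ C' + D := by
    have h1 := he'.approx j hj y
    have h2 : C' * Real.exp (-κ' * A' ^ 2) * Real.exp (-κ' * y ^ 2) ≤ C' := by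
      rw [mul_assoc, ← Real.exp_add]
      refine mul_le_of_le_one_right hC'.le (Real.exp_le_one_iff.2 ?_)
      nlinarith [mul_nonneg hκ'.le (sq_nonneg A'), mul_nonneg hκ'.le (sq_nonneg y)]
    have h3 := abs_sub_abs_le_abs_sub (e' j y) (hermiteFn j (α' * y))
    linarith [hD (α' * y)]
  have b2 : |e' j y - hermiteFn j (α' * y)| ≤ C' * Real.exp (-κ' * A' ^ 2) := by
    refine (he'.approx j hj y).trans (mul_le_of_le_one_right (by positivity) ?_)
    exact Real.exp_le_one_iff.2 (by nlinarith [mul_nonneg hκ'.le (sq_nonneg y)])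
  have b3 : |∫ x, (hermiteFn j (α * x) * stdG (a * y - b * x)
        - cutG M (a * y - b * x) * hermiteFn j (α * x))|
      ≤ Real.exp (-M ^ 2 / 2) * ∫ x, |hermiteFn j (α * x)| := by
    rw [← integral_const_mul, ← Real.norm_eq_abs]
    refine norm_integral_le_of_norm_le (hh.abs.const_mul _) (ae_of_all _ fun x => ?_)
    rw [mul_comm, ← sub_mul, norm_mul, Real.norm_eq_abs, Real.norm_eq_abs]
    refine mul_le_mul_of_nonneg_right ?_ (abs_nonneg _)
    rw [abs_of_nonneg (sub_nonneg.2 (cutG_le_stdG _ _))]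
    exact stdG_sub_cutG_le _ _ hM
  have b4 : |∫ x, (cutG M (a * y - b * x) * hermiteFn j (α * x)
        - cutG M (a * y - b * x) * e j x)|
      ≤ C * Real.exp (-κ * A ^ 2) * ∫ x : ℝ, Real.exp (-κ * x ^ 2) := by
    rw [← integral_const_mul, ← Real.norm_eq_abs]
    refine norm_integral_le_of_norm_le ((integrable_exp_neg_mul_sq hκ).const_mul _)
      (ae_of_all _ fun x => ?_)
    rw [← mul_sub, norm_mul, Real.norm_eq_abs, Real.norm_eq_abs, abs_of_nonneg (cutG_nonneg _ _),
      abs_sub_comm]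
    exact (mul_le_of_le_one_left (abs_nonneg _) (cutG_le_one _ _)).trans (he.approx j hj x)
  rw [key]
  refine (abs_add_le _ _).trans (add_le_add ((abs_add_le _ _).trans
    (add_le_add ((abs_add_le _ _).trans (add_le_add ?_ ?_)) ?_)) ?_)
  · rw [abs_mul]; exact mul_le_mul_of_nonneg_left b1 (abs_nonneg _)
  · rw [abs_mul]; exact mul_le_mul_of_nonneg_left b2 (abs_nonneg _)
  · rw [abs_mul, abs_of_nonneg hw]; exact mul_le_mul_of_nonneg_left b3 hw
  · rw [abs_mul, abs_of_nonneg hw]; exact mul_le_mul_of_nonneg_left b4 hw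

/-- The finite rank correction is exponentially small. -/
theorem exists_blockLine_sub_le (J : ℕ) (hα : 0 < α) (hα' : 0 < α') (ha : a ≠ 0)
    (hrel : a ^ 2 * α ^ 2 = α' ^ 2 * (b ^ 2 + 2 * α ^ 2)) (hw : 0 ≤ w) (hR : 0 < R) (hR' : 0 < R')
    (hC : 0 < C) (hκ : 0 < κ) (hC' : 0 < C') (hκ' : 0 < κ') {t : ℝ} (ht : 0 ≤ t) :
    ∃ B > 0, ∃ M₀ ≥ 1, ∀ M ≥ M₀, ∀ (e e' : ℕ → ℝ → ℝ) (ν : ℕ → ℝ),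
      IsCutHermite J α (R * M) C κ e → IsCutHermite J α' (R' * M) C' κ' e' →
      (∀ j < J, |ν j - hermMult α α' w a b j| ≤ t * Real.exp (-M)) → ∀ x y,
      |blockLine J α (R * M) w a b M ν e e' x y - w * cutG M (a * y - b * x)|
        ≤ B * M ^ J * Real.exp (-M) := by
  choose D hD0 hD using exists_abs_hermiteFn_le
  choose G hG0 hG using exists_abs_eval_le_pow
  set E : ℕ → ℝ := fun j => t * (C' + D j) + |hermMult α α' w a b j| * C'
    + w * (∫ x, |hermiteFn j (α * x)|) + w * (C * ∫ x : ℝ, Real.exp (-κ * x ^ 2)) with hE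
  have hE0 : ∀ j, 0 ≤ E j := by
    intro j
    have h1 : 0 ≤ ∫ x, |hermiteFn j (α * x)| := integral_nonneg fun _ => abs_nonneg _
    have h2 : 0 ≤ ∫ x : ℝ, Real.exp (-κ * x ^ 2) := integral_nonneg fun _ => (Real.exp_pos _).le
    have := (hD0 j).le
    positivity
  -- The threshold for `M` makes `κ (R M) ^ 2`, `κ' (R' M) ^ 2` and `M ^ 2 / 2` all at least `M`.
  -- The factor `M ^ J` will bound the Hermite polynomials on `[-R M, R M]`.
  refine ⟨∑ j ∈ Finset.range J, G (hermitePoly j) * (α * R + 1) ^ J * (α / hermiteNorm j) * E j + 1,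
    ?_, max 2 (max (1 / (κ * R ^ 2)) (1 / (κ' * R' ^ 2))), ?_, ?_⟩
  · have : ∀ j ∈ Finset.range J,
        0 ≤ G (hermitePoly j) * (α * R + 1) ^ J * (α / hermiteNorm j) * E j := fun j _ => by
      have := (hG0 (hermitePoly j)).le
      have := (hermiteNorm_pos j).le
      have := hE0 j
      positivity
    linarith [Finset.sum_nonneg this]
  · exact le_trans (by norm_num) (le_max_left _ _)
  intro M hM e e' ν he he' hν x y
  have hM2 : 2 ≤ M := (le_max_left _ _).trans hM
  have hM1 : 1 ≤ M := by linarith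
  have hx1 : ∀ κ R : ℝ, 0 < κ → 0 < R → 1 / (κ * R ^ 2) ≤ M →
      Real.exp (-κ * (R * M) ^ 2) ≤ Real.exp (-M) := by
    intro κ R hκ hR h
    rw [div_le_iff₀ (by positivity)] at h
    refine Real.exp_le_exp.2 ?_
    nlinarith
  have k1 := hx1 κ R hκ hR (((le_max_left _ _).trans (le_max_right _ _)).trans hM)
  have k2 := hx1 κ' R' hκ' hR' (((le_max_right _ _).trans (le_max_right _ _)).trans hM)
  have k3 : Real.exp (-M ^ 2 / 2) ≤ Real.exp (-M) := Real.exp_le_exp.2 (by nlinarith)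
  have hdef : ∀ j < J, |lineDefect w a b M ν e e' j y| ≤ E j * Real.exp (-M) := by
    intro j hj
    refine (abs_lineDefect_le hα hα' ha hrel hw hC hκ hC' hκ' (by linarith) he he' (hD j) hj
      y).trans ?_
    have h1 : 0 ≤ ∫ x, |hermiteFn j (α * x)| := integral_nonneg fun _ => abs_nonneg _
    have h2 : 0 ≤ ∫ x : ℝ, Real.exp (-κ * x ^ 2) := integral_nonneg fun _ => (Real.exp_pos _).le
    have h3 := (hD0 j).le
    calc _ ≤ t * Real.exp (-M) * (C' + D j) + |hermMult α α' w a b j| * (C' * Real.exp (-M))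
          + w * (Real.exp (-M) * ∫ x, |hermiteFn j (α * x)|)
          + w * (C * Real.exp (-M) * ∫ x : ℝ, Real.exp (-κ * x ^ 2)) := by
          gcongr
          exact hν j hj
      _ = _ := by rw [hE]; ring
  rw [blockLine, add_sub_cancel_left]
  refine (Finset.abs_sum_le_sum_abs _ _).trans ?_
  calc _ ≤ ∑ j ∈ Finset.range J, G (hermitePoly j) * (α * R + 1) ^ J * (α / hermiteNorm j) * E j
        * (M ^ J * Real.exp (-M)) := by
        refine Finset.sum_le_sum fun j hj => ?_
        have hj' := Finset.mem_range.1 hj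
        have hn := hermiteNorm_pos j
        have p1 : |(Set.Icc (-(R * M)) (R * M)).indicator
            (fun x => (hermitePoly j).eval (α * x)) x|
            ≤ G (hermitePoly j) * ((α * R + 1) ^ J * M ^ J) := by
          have hb : 1 ≤ (α * R + 1) * M := by nlinarith [mul_pos hα hR]
          by_cases hx : x ∈ Set.Icc (-(R * M)) (R * M)
          · rw [Set.indicator_of_mem hx]
            have hx' : |α * x| ≤ (α * R + 1) * M := by
              rw [abs_mul, abs_of_pos hα]
              have := abs_le.2 hx
              nlinarith
            refine (hG (hermitePoly j) (α * x) _ hx' hb).trans ?_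
            refine mul_le_mul_of_nonneg_left ?_ (hG0 _).le
            rw [← mul_pow]
            exact pow_le_pow_right₀ hb ((degree_hermitePoly j).1.trans hj'.le)
          · rw [Set.indicator_of_notMem hx, abs_zero]
            have := (hG0 (hermitePoly j)).le
            positivity
        rw [abs_mul, abs_mul, abs_of_pos (div_pos hα hn)]
        calc _ ≤ G (hermitePoly j) * ((α * R + 1) ^ J * M ^ J) * (α / hermiteNorm j)
              * (E j * Real.exp (-M)) := by
              refine mul_le_mul (mul_le_mul_of_nonneg_right p1 (div_pos hα hn).le) (hdef j hj')
                (abs_nonneg _) ?_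
              have := (hG0 (hermitePoly j)).le
              positivity
          _ = _ := by ring
    _ ≤ _ := by
        rw [← Finset.sum_mul, add_mul, add_mul, ← mul_assoc]
        have : 0 ≤ 1 * M ^ J * Real.exp (-M) := by positivity
        linarith

/-- The finite rank correction is supported in the product of the two intervals. -/
theorem blockLine_eq {M A A' : ℝ} {e e' : ℕ → ℝ → ℝ} {ν : ℕ → ℝ}
    (he : IsCutHermite J α A C κ e) (he' : IsCutHermite J α' A' C' κ' e') (ha : a ≠ 0)
    (hA : M + |b| * A ≤ |a| * A') {x y : ℝ} (hxy : A < |x| ∨ A' < |y|) :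
    blockLine J α A w a b M ν e e' x y = w * cutG M (a * y - b * x) := by
  rw [blockLine, add_eq_left]
  refine Finset.sum_eq_zero fun j hj => ?_
  have hj' := Finset.mem_range.1 hj
  rcases hxy with h | h
  · rw [Set.indicator_of_notMem (fun hx : x ∈ Set.Icc (-A) A => absurd (abs_le.2 hx) (not_le.2 h)), zero_mul, zero_mul]
  · have : lineDefect w a b M ν e e' j y = 0 := by
      rw [lineDefect, he'.support j hj' y h, mul_zero, zero_sub, neg_eq_zero]
      refine integral_eq_zero_of_ae (ae_of_all _ fun x => ?_)
      by_cases hx : A < |x|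
      · simp [he.support j hj' x hx]
      · have h2 := abs_sub_abs_le_abs_sub (a * y) (b * x)
        rw [abs_mul, abs_mul] at h2
        have h3 : |b| * |x| ≤ |b| * A := mul_le_mul_of_nonneg_left (not_lt.1 hx) (abs_nonneg b)
        have h4 : |a| * A' < |a| * |y| := mul_lt_mul_of_pos_left h (abs_pos.2 ha)
        simp [cutG_eq_zero (show M < |a * y - b * x| by linarith)]
    rw [this, mul_zero]

theorem measurable_blockLine {M A A' : ℝ} {e e' : ℕ → ℝ → ℝ} {ν : ℕ → ℝ}
    (he : IsCutHermite J α A C κ e) (he' : IsCutHermite J α' A' C' κ' e') :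
    Measurable (Function.uncurry (blockLine J α A w a b M ν e e')) := by
  unfold Function.uncurry blockLine
  refine Measurable.add measurable_transferLine_kernel ?_
  refine Finset.measurable_fun_sum _ fun j hj => ?_
  have hj' := Finset.mem_range.1 hj
  refine Measurable.mul (Measurable.mul_const ?_ _) ?_
  · have : Measurable ((Set.Icc (-A) A).indicator fun x => (hermitePoly j).eval (α * x)) :=
      (by fun_prop : Continuous fun x => (hermitePoly j).eval (α * x)).measurable.indicator
        measurableSet_Icc
    exact this.comp measurable_fst
  · refine Measurable.comp (g := lineDefect w a b M ν e e' j) ?_ measurable_snd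
    unfold lineDefect
    refine ((he'.measurable j hj').const_mul _).sub ?_
    have h : StronglyMeasurable (Function.uncurry fun y x =>
        w * cutG M (a * y - b * x) * e j x) :=
      ((measurable_transferLine_kernel.comp measurable_swap).mul
        ((he.measurable j hj').comp measurable_snd)).stronglyMeasurable
    exact (h.integral_prod_right (ν := volume)).measurable

end DefectBound

/-! ### Pseudo-orbits: no return to repellers, escape, capture by the two-cycle. -/

section Dynamics

variable {X : Type*} [MetricSpace X] {f : X → X}

/-- Pseudo-orbits with small errors follow orbits into open sets. -/
theorem exists_shadow (hf : Continuous f) {O : Set X} (hO : IsOpen O) (n : ℕ) (x : X)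
    (hx : f^[n] x ∈ O) : ∃ U ∈ 𝓝 x, ∃ δ > 0, ∀ c : ℕ → X, c 0 ∈ U →
      (∀ i < n, dist (c (i + 1)) (f (c i)) ≤ δ) → c n ∈ O := by
  induction n generalizing x with
  | zero => exact ⟨O, hO.mem_nhds hx, 1, one_pos, fun c hc _ => hc⟩
  | succ n ih =>
    obtain ⟨U', hU', δ', hδ', h⟩ := ih (f x) hx
    obtain ⟨s, hs, hsU⟩ := Metric.mem_nhds_iff.1 hU'
    refine ⟨f ⁻¹' Metric.ball (f x) (s / 2), hf.continuousAt (Metric.ball_mem_nhds _ (half_pos hs)),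
      min δ' (s / 2), lt_min hδ' (half_pos hs), fun c hc hstep => ?_⟩
    refine h (fun i => c (i + 1)) (hsU ?_) fun i hi =>
      (hstep (i + 1) (Nat.succ_lt_succ hi)).trans (min_le_left _ _)
    have h1 := (hstep 0 (Nat.succ_pos n)).trans (min_le_right _ _)
    have h2 : dist (f (c 0)) (f x) < s / 2 := hc
    rw [Metric.mem_ball]
    calc dist (c (0 + 1)) (f x) ≤ dist (c (0 + 1)) (f (c 0)) + dist (f (c 0)) (f x) :=
          dist_triangle _ _ _
      _ < s := by linarith

/-- Uniform time for pseudo-orbits from a compact set to enter an open set. -/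
theorem exists_uniform_shadow (hf : Continuous f) {O K : Set X} (hO : IsOpen O) (hK : IsCompact K)
    (h : ∀ x ∈ K, ∃ n, f^[n] x ∈ O) : ∃ N : ℕ, ∃ δ > 0, ∀ c : ℕ → X, c 0 ∈ K →
      (∀ i < N, dist (c (i + 1)) (f (c i)) ≤ δ) → ∃ m ≤ N, c m ∈ O := by
  -- The property passes to subsets and finite unions and holds locally by `exists_shadow`, so
  -- compactness suffices.
  refine hK.induction_on (p := fun K => ∃ N : ℕ, ∃ δ > 0, ∀ c : ℕ → X, c 0 ∈ K →
      (∀ i < N, dist (c (i + 1)) (f (c i)) ≤ δ) → ∃ m ≤ N, c m ∈ O) ?_ ?_ ?_ ?_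
  · exact ⟨0, 1, one_pos, fun c hc => absurd hc (Set.notMem_empty _)⟩
  · rintro s t hst ⟨N, δ, hδ, h⟩
    exact ⟨N, δ, hδ, fun c hc => h c (hst hc)⟩
  · rintro s t ⟨N, δ, hδ, h⟩ ⟨N', δ', hδ', h'⟩
    refine ⟨max N N', min δ δ', lt_min hδ hδ', fun c hc hstep => ?_⟩
    rcases hc with hc | hc
    · obtain ⟨m, hm, hmO⟩ := h c hc fun i hi =>
        (hstep i (lt_max_of_lt_left hi)).trans (min_le_left _ _)
      exact ⟨m, hm.trans (le_max_left _ _), hmO⟩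
    · obtain ⟨m, hm, hmO⟩ := h' c hc fun i hi =>
        (hstep i (lt_max_of_lt_right hi)).trans (min_le_right _ _)
      exact ⟨m, hm.trans (le_max_right _ _), hmO⟩
  · intro x hx
    obtain ⟨n, hn⟩ := h x hx
    obtain ⟨U, hU, δ, hδ, hc⟩ := exists_shadow hf hO n x hn
    exact ⟨U, mem_nhdsWithin_of_mem_nhds hU, n, δ, hδ, fun c h0 hs => ⟨n, le_rfl, hc c h0 hs⟩⟩

/-- Small noise does not lead back to a repelling fixed point. -/
theorem exists_no_return [CompactSpace X] (hf : Continuous f) {p : X} (hp : ∀ x, f x = p → x = p)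
    {δ ℓ R S : ℝ} (hδ : 0 < δ) (hℓ : 0 < ℓ) (hE : ∀ x, dist x p ≤ δ → ℓ * dist x p ≤ dist (f x) p)
    (hR : 0 < R) (hS : 0 < S) (hRS : S < (ℓ - 1) * R) :
    ∃ η₀ > 0, ∀ η, 0 < η → η < η₀ → ∀ x y, R * η < dist x p → dist y (f x) ≤ S * η →
      R * η < dist y p := by
  have hK : IsCompact {x | δ ≤ dist x p} :=
    (isClosed_le continuous_const (continuous_id.dist continuous_const)).isCompact
  -- Away from `p` the image stays at a positive distance from `p`, since `p` has no preimage but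
  -- possibly itself.
  obtain ⟨m, hm, hmK⟩ : ∃ m > 0, ∀ x, δ ≤ dist x p → m ≤ dist (f x) p := by
    rcases Set.eq_empty_or_nonempty {x | δ ≤ dist x p} with h | h
    · exact ⟨1, one_pos, fun x hx => absurd (show x ∈ {x | δ ≤ dist x p} from hx) (by simp [h])⟩
    · obtain ⟨z, hz, hmin⟩ := hK.exists_isMinOn h
        (hf.dist continuous_const : Continuous fun x => dist (f x) p).continuousOn
      refine ⟨dist (f z) p, dist_pos.2 fun h => ?_, fun x hx => hmin hx⟩
      have hz' : δ ≤ dist z p := hz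
      rw [hp z h, dist_self] at hz'
      linarith
  refine ⟨m / (R + S), by positivity, fun η hη hη0 x y hx hy => ?_⟩
  rw [lt_div_iff₀ (by positivity)] at hη0
  have h1 : dist (f x) p ≤ dist y (f x) + dist y p := by
    rw [dist_comm y (f x)]
    exact dist_triangle _ _ _
  rcases le_total (dist x p) δ with h | h
  · have h2 := hE x h
    nlinarith
  · have h2 := hmK x h
    nlinarith

/-- Chains outside a neighbourhood of a repelling fixed point leave a larger neighbourhood. -/
theorem exists_escape {p : X} {δ ℓ R S η : ℝ} (hE : ∀ x, dist x p ≤ δ → ℓ * dist x p ≤ dist (f x) p)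
    (hR : 0 < R) (hS : 0 ≤ S) (hRS : S < (ℓ - 1) * R) (hη : 0 < η) : ∃ n : ℕ, ∀ c : ℕ → X,
      (∀ i ≤ n, R * η < dist (c i) p) → (∀ i < n, dist (c (i + 1)) (f (c i)) ≤ S * η) →
      ∃ i ≤ n, δ < dist (c i) p := by
  -- Outside radius `R η` an error `S η` is at most `S / R` times the distance to `p`, so distances
  -- still grow at the rate `ℓ' > 1`.
  set ℓ' := ℓ - S / R with hℓ'
  have h1 : 1 < ℓ' := by
    rw [hℓ', lt_sub_iff_add_lt, add_comm, ← lt_sub_iff_add_lt, div_lt_iff₀ hR]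
    exact hRS
  obtain ⟨n, hn⟩ := pow_unbounded_of_one_lt (δ / (R * η)) h1
  rw [div_lt_iff₀ (by positivity)] at hn
  refine ⟨n, fun c hc hstep => ?_⟩
  by_contra! hcon
  have key : ∀ i ≤ n, ℓ' ^ i * (R * η) ≤ dist (c i) p := by
    intro i
    induction i with
    | zero => intro h; simpa using (hc 0 h).le
    | succ i ih =>
      intro hi
      have h2 := ih (Nat.le_of_succ_le hi)
      have h3 := hE (c i) (hcon i (Nat.le_of_succ_le hi))
      have h4 := hstep i hi
      have h5 : dist (f (c i)) p ≤ dist (c (i + 1)) (f (c i)) + dist (c (i + 1)) p := by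
        rw [dist_comm (c (i + 1)) (f (c i))]
        exact dist_triangle _ _ _
      have h6 : S * η ≤ S / R * dist (c i) p := by
        have h7 := (hc i (Nat.le_of_succ_le hi)).le
        calc S * η = S / R * (R * η) := by field_simp
          _ ≤ _ := mul_le_mul_of_nonneg_left h7 (by positivity)
      have h7 : ℓ' ^ (i + 1) * (R * η) = ℓ' * (ℓ' ^ i * (R * η)) := by ring
      rw [h7]
      calc ℓ' * (ℓ' ^ i * (R * η)) ≤ ℓ' * dist (c i) p :=
            mul_le_mul_of_nonneg_left h2 (by linarith)
        _ = ℓ * dist (c i) p - S / R * dist (c i) p := by rw [hℓ']; ring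
        _ ≤ _ := by linarith
  exact absurd (key n le_rfl) (not_le.2 (lt_of_le_of_lt (hcon n le_rfl) hn))

/-- Chains near an attracting two-cycle enter a small neighbourhood of the cycle. -/
theorem exists_capture {q₁ q₂ : X} {t₀ c₁ c₂ R₁ R₂ S : ℝ} (hc₁ : 0 ≤ c₁) (hc₂ : 0 ≤ c₂)
    (hC₁ : ∀ x, dist x q₁ ≤ R₁ * t₀ → dist (f x) q₂ ≤ c₁ * dist x q₁)
    (hC₂ : ∀ x, dist x q₂ ≤ R₂ * t₀ → dist (f x) q₁ ≤ c₂ * dist x q₂)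
    (hR₁ : 0 < R₁) (hR₂ : 0 < R₂) (hS : 0 ≤ S) (h₁ : c₁ * R₁ + S < R₂) (h₂ : c₂ * R₂ + S < R₁)
    {η : ℝ} (hη : 0 < η) (hηt : η ≤ t₀) : ∃ n : ℕ, ∀ c : ℕ → X,
      (dist (c 0) q₁ ≤ R₁ * t₀ ∨ dist (c 0) q₂ ≤ R₂ * t₀) →
      (∀ i < n, dist (c (i + 1)) (f (c i)) ≤ S * η) →
      dist (c n) q₁ ≤ R₁ * η ∨ dist (c n) q₂ ≤ R₂ * η := by
  -- Measured in units of `R₁` and `R₂`, both steps of the cycle contract by a common factor `q <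
  -- 1`, error included.
  obtain ⟨q, hq0, hq1, hqa, hqb⟩ : ∃ q : ℝ, 0 < q ∧ q < 1 ∧ c₁ * R₁ + S ≤ q * R₂ ∧
      c₂ * R₂ + S ≤ q * R₁ := by
    refine ⟨max (1 / 2) (max ((c₁ * R₁ + S) / R₂) ((c₂ * R₂ + S) / R₁)),
      lt_max_of_lt_left (by norm_num), max_lt (by norm_num) (max_lt ?_ ?_), ?_, ?_⟩
    · rwa [div_lt_one hR₂]
    · rwa [div_lt_one hR₁]
    · rw [← div_le_iff₀ hR₂]; exact (le_max_left _ _).trans (le_max_right _ _)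
    · rw [← div_le_iff₀ hR₁]; exact (le_max_right _ _).trans (le_max_right _ _)
  have ht0 : 0 < t₀ := hη.trans_le hηt
  obtain ⟨n, hn⟩ := exists_pow_lt_of_lt_one (div_pos hη ht0) hq1
  rw [lt_div_iff₀ ht0] at hn
  refine ⟨n, fun c h0 hstep => ?_⟩
  -- As long as the current scale is at least `η`, the error `S η` is at most `S` times that scale;
  -- it therefore shrinks geometrically until it reaches `η`.
  have key : ∀ i ≤ n, dist (c i) q₁ ≤ R₁ * max (q ^ i * t₀) η ∨
      dist (c i) q₂ ≤ R₂ * max (q ^ i * t₀) η := by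
    intro i
    induction i with
    | zero => intro _; simpa [max_eq_left hηt] using h0
    | succ i ih =>
      intro hi
      set t := max (q ^ i * t₀) η with ht
      have htη : η ≤ t := le_max_right _ _
      have htt : t ≤ t₀ := max_le (mul_le_of_le_one_left ht0.le (pow_le_one₀ hq0.le hq1.le)) hηt
      have hqt : q * t ≤ max (q ^ (i + 1) * t₀) η := by
        rcases le_total (q ^ i * t₀) η with h | h
        · rw [ht, max_eq_right h]
          exact (mul_le_of_le_one_left hη.le hq1.le).trans (le_max_right _ _)
        · rw [ht, max_eq_left h]
          refine le_trans (le_of_eq ?_) (le_max_left _ _)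
          ring
      have hs := hstep i hi
      rcases ih (Nat.le_of_succ_le hi) with h | h
      · right
        have h3 := hC₁ (c i) (h.trans (mul_le_mul_of_nonneg_left htt hR₁.le))
        calc dist (c (i + 1)) q₂ ≤ dist (c (i + 1)) (f (c i)) + dist (f (c i)) q₂ :=
              dist_triangle _ _ _
          _ ≤ S * t + c₁ * (R₁ * t) := add_le_add
              (hs.trans (mul_le_mul_of_nonneg_left htη hS))
              (h3.trans (mul_le_mul_of_nonneg_left h hc₁))
          _ = (c₁ * R₁ + S) * t := by ring
          _ ≤ q * R₂ * t := mul_le_mul_of_nonneg_right hqa (hη.le.trans htη)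
          _ = R₂ * (q * t) := by ring
          _ ≤ _ := mul_le_mul_of_nonneg_left hqt hR₂.le
      · left
        have h3 := hC₂ (c i) (h.trans (mul_le_mul_of_nonneg_left htt hR₂.le))
        calc dist (c (i + 1)) q₁ ≤ dist (c (i + 1)) (f (c i)) + dist (f (c i)) q₁ :=
              dist_triangle _ _ _
          _ ≤ S * t + c₂ * (R₂ * t) := add_le_add
              (hs.trans (mul_le_mul_of_nonneg_left htη hS))
              (h3.trans (mul_le_mul_of_nonneg_left h hc₂))
          _ = (c₂ * R₂ + S) * t := by ring
          _ ≤ q * R₁ * t := mul_le_mul_of_nonneg_right hqb (hη.le.trans htη)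
          _ = R₁ * (q * t) := by ring
          _ ≤ _ := mul_le_mul_of_nonneg_left hqt hR₁.le
  simpa [max_eq_right hn.le] using key n le_rfl

/-- For small noise there are no long chains away from two repelling fixed points and an
attracting two-cycle. -/
theorem exists_chain_bound [CompactSpace X] (hf : Continuous f) {p₁ p₂ q₁ q₂ : X} (hp : p₁ ≠ p₂) (hfp₁ : f p₁ = p₁)
    (hfp₂ : f p₂ = p₂) {δ ℓ₁ ℓ₂ P₁ P₂ c₁ c₂ R₁ R₂ S : ℝ} (hδ : 0 < δ)
    (hE₁ : ∀ x, dist x p₁ ≤ δ → ℓ₁ * dist x p₁ ≤ dist (f x) p₁)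
    (hE₂ : ∀ x, dist x p₂ ≤ δ → ℓ₂ * dist x p₂ ≤ dist (f x) p₂)
    (hP₁ : 0 < P₁) (hP₂ : 0 < P₂) (hS : 0 < S) (hPS₁ : S < (ℓ₁ - 1) * P₁)
    (hPS₂ : S < (ℓ₂ - 1) * P₂) (hc₁ : 0 ≤ c₁) (hc₂ : 0 ≤ c₂)
    (hC₁ : ∀ x, dist x q₁ ≤ δ → dist (f x) q₂ ≤ c₁ * dist x q₁)
    (hC₂ : ∀ x, dist x q₂ ≤ δ → dist (f x) q₁ ≤ c₂ * dist x q₂)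
    (hR₁ : 0 < R₁) (hR₂ : 0 < R₂) (h₁ : c₁ * R₁ + S < R₂) (h₂ : c₂ * R₂ + S < R₁)
    (hattr : ∀ x, x ≠ p₁ → x ≠ p₂ →
      Tendsto (fun n : ℕ => Metric.infDist (f^[n] x) {q₁, q₂}) atTop (𝓝 0)) :
    ∃ η₀ > 0, ∀ η, 0 < η → η < η₀ → ∃ n : ℕ, ∀ c : ℕ → X,
      (∀ i ≤ n, P₁ * η < dist (c i) p₁ ∧ P₂ * η < dist (c i) p₂ ∧ R₁ * η < dist (c i) q₁ ∧
        R₂ * η < dist (c i) q₂) → ∃ i < n, S * η < dist (c (i + 1)) (f (c i)) := by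
  set D := dist p₁ p₂ with hD
  have hD0 : 0 < D := dist_pos.2 hp
  obtain ⟨δ₁, hδ₁, hn₁⟩ := Metric.continuous_iff.1 hf p₁ (D / 3) (by positivity)
  obtain ⟨δ₂, hδ₂, hn₂⟩ := Metric.continuous_iff.1 hf p₂ (D / 3) (by positivity)
  rw [hfp₁] at hn₁
  rw [hfp₂] at hn₂
  -- `d` is so small that one step from the `d`-ball of either fixed point stays within `D / 3` of
  -- it and hence cannot land in the `d`-ball of the other.
  set d := min δ (min (D / 3) (min (δ₁ / 2) (δ₂ / 2))) with hd
  have hd0 : 0 < d := by positivity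
  have hdδ : d ≤ δ := min_le_left _ _
  have hdD : d ≤ D / 3 := (min_le_right _ _).trans (min_le_left _ _)
  have hd1 : d ≤ δ₁ / 2 := (min_le_right _ _).trans ((min_le_right _ _).trans (min_le_left _ _))
  have hd2 : d ≤ δ₂ / 2 := (min_le_right _ _).trans ((min_le_right _ _).trans (min_le_right _ _))
  set t₀ := min (δ / R₁) (δ / R₂) with ht₀
  have ht₀0 : 0 < t₀ := by positivity
  have ht1 : R₁ * t₀ ≤ δ := by
    rw [mul_comm, ← le_div_iff₀ hR₁]; exact min_le_left _ _
  have ht2 : R₂ * t₀ ≤ δ := by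
    rw [mul_comm, ← le_div_iff₀ hR₂]; exact min_le_right _ _
  set K : Set X := {x | d ≤ dist x p₁ ∧ d ≤ dist x p₂} with hK
  have hKc : IsCompact K :=
    ((isClosed_le continuous_const (continuous_id.dist continuous_const)).inter
      (isClosed_le continuous_const (continuous_id.dist continuous_const))).isCompact
  set O : Set X := {x | dist x q₁ < R₁ * t₀ ∨ dist x q₂ < R₂ * t₀} with hO
  have hOo : IsOpen O :=
    (isOpen_lt (continuous_id.dist continuous_const) continuous_const).union
      (isOpen_lt (continuous_id.dist continuous_const) continuous_const)
  obtain ⟨N, δs, hδs, hN⟩ := exists_uniform_shadow hf hOo hKc (by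
    rintro x ⟨hx1, hx2⟩
    have hx1' : x ≠ p₁ := by rintro rfl; rw [dist_self] at hx1; linarith
    have hx2' : x ≠ p₂ := by rintro rfl; rw [dist_self] at hx2; linarith
    have h3 := (hattr x hx1' hx2').eventually
      (gt_mem_nhds (show 0 < min (R₁ * t₀) (R₂ * t₀) by positivity))
    obtain ⟨n, hn⟩ := h3.exists
    refine ⟨n, ?_⟩
    rw [Metric.infDist_lt_iff ⟨q₁, by simp⟩] at hn
    obtain ⟨y, hy, hlt⟩ := hn
    rcases hy with rfl | rfl
    · exact Or.inl (hlt.trans_le (min_le_left _ _))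
    · exact Or.inr (hlt.trans_le (min_le_right _ _)))
  -- The three bounds allow, in turn, capture from scale `t₀`, shadowing in `exists_uniform_shadow`,
  -- and an error below `D / 3` when leaving a fixed point.
  refine ⟨min t₀ (min (δs / S) (D / 3 / S)), by positivity, fun η hη hη0 => ?_⟩
  have e1 : η ≤ t₀ := hη0.le.trans (min_le_left _ _)
  have e2 : S * η ≤ δs := by
    rw [mul_comm, ← le_div_iff₀ hS]
    exact hη0.le.trans ((min_le_right _ _).trans (min_le_left _ _))
  have e3 : S * η < D / 3 := by
    rw [mul_comm, ← lt_div_iff₀ hS]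
    exact hη0.trans_le ((min_le_right _ _).trans (min_le_right _ _))
  obtain ⟨m₁, hm₁⟩ := exists_escape (fun x hx => hE₁ x (hx.trans hdδ)) hP₁ hS.le hPS₁ hη
  obtain ⟨m₂, hm₂⟩ := exists_escape (fun x hx => hE₂ x (hx.trans hdδ)) hP₂ hS.le hPS₂ hη
  obtain ⟨n₃, hn₃⟩ := exists_capture hc₁ hc₂ (fun x hx => hC₁ x (hx.trans ht1))
    (fun x hx => hC₂ x (hx.trans ht2)) hR₁ hR₂ hS.le h₁ h₂ hη e1
  -- Time to escape from a fixed point, to travel through the compact set `K`, and to be captured at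
  -- scale `η`.
  refine ⟨m₁ + m₂ + N + n₃, fun c hW => ?_⟩
  by_contra! hstep
  have far : ∀ {p p' x y : X}, dist p p' = D → dist (f x) p < D / 3 → dist y (f x) ≤ S * η →
      d ≤ dist y p' := by
    intro p p' x y hpp h4 h5
    have h6 : dist p p' ≤ dist p (f x) + dist (f x) y + dist y p' := dist_triangle4 _ _ _ _
    rw [dist_comm p (f x), dist_comm (f x) y] at h6
    linarith
  -- At its first exit from the `d`-ball of one fixed point the chain is also far from the other
  -- one.
  have exit : ∀ {p p' : X} {m : ℕ}, dist p p' = D → m ≤ m₁ + m₂ →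
      (∀ x, dist x p ≤ d → dist (f x) p < D / 3) → (∃ i ≤ m, d < dist (c i) p) →
      dist (c 0) p ≤ d → ∃ i ≤ m₁ + m₂, d ≤ dist (c i) p ∧ d ≤ dist (c i) p' := by
    intro p p' m hpp hm hnear hex h0
    classical
    set i := Nat.find hex with hi
    obtain ⟨h5, h6⟩ := Nat.find_spec hex
    rw [← hi] at h5 h6
    have hi0 : i ≠ 0 := by
      intro h
      rw [h] at h6
      linarith
    obtain ⟨k, hk⟩ := Nat.exists_eq_succ_of_ne_zero hi0
    have h7 : dist (c k) p ≤ d := by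
      by_contra! hcon
      exact Nat.find_min hex (m := k) (by omega) ⟨by omega, hcon⟩
    refine ⟨i, h5.trans hm, h6.le, ?_⟩
    rw [hk]
    exact far hpp (hnear _ h7) (hstep k (by omega))
  have hentry : ∃ i ≤ m₁ + m₂, c i ∈ K := by
    rcases le_or_gt (dist (c 0) p₁) d with h0 | h0
    · obtain ⟨i, hi, h3, h4⟩ := exit (p := p₁) (p' := p₂) rfl (Nat.le_add_right m₁ m₂)
        (fun x hx => hn₁ x (by linarith))
        (hm₁ c (fun i hi => (hW i (by omega)).1) fun i hi => hstep i (by omega)) h0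
      exact ⟨i, hi, h3, h4⟩
    · rcases le_or_gt (dist (c 0) p₂) d with h0' | h0'
      · obtain ⟨i, hi, h3, h4⟩ := exit (p := p₂) (p' := p₁) (dist_comm _ _) (Nat.le_add_left m₂ m₁)
          (fun x hx => hn₂ x (by linarith))
          (hm₂ c (fun i hi => (hW i (by omega)).2.1) fun i hi => hstep i (by omega)) h0'
        exact ⟨i, hi, h4, h3⟩
      · exact ⟨0, Nat.zero_le _, h0.le, h0'.le⟩
  obtain ⟨i, hi, hiK⟩ := hentry
  obtain ⟨m, hm, hmO⟩ := hN (fun k => c (i + k)) hiK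
    fun k hk => (hstep (i + k) (by omega)).trans e2
  have h5 := hn₃ (fun k => c (i + m + k))
    (by rcases hmO with h | h
        exacts [Or.inl h.le, Or.inr h.le])
    fun k hk => hstep (i + m + k) (by omega)
  have h6 := hW (i + m + n₃) (by omega)
  rcases h5 with h5 | h5
  · exact absurd h5 (not_le.2 h6.2.2.1)
  · exact absurd h5 (not_le.2 h6.2.2.2)

end Dynamics

/-! ### Integration on the circle in a centred coordinate. -/

section Circle

theorem rep_mem (x : S1) : rep x ∈ Set.Ioc (-Real.pi) Real.pi := by
  have h := (AddCircle.equivIoc (2 * Real.pi) (-Real.pi) x).2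
  exact ⟨h.1, h.2.trans_eq (by ring)⟩

theorem coe_rep (x : S1) : ((rep x : ℝ) : S1) = x :=
  (AddCircle.equivIoc (2 * Real.pi) (-Real.pi)).symm_apply_apply x

theorem rep_coe {t : ℝ} (ht : t ∈ Set.Ioc (-Real.pi) Real.pi) : rep (t : S1) = t := by
  have h : t ∈ Set.Ioc (-Real.pi) (-Real.pi + 2 * Real.pi) := by
    rwa [show -Real.pi + 2 * Real.pi = Real.pi by ring]
  exact congrArg Subtype.val ((AddCircle.equivIoc (2 * Real.pi) (-Real.pi)).apply_symm_apply ⟨t, h⟩)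

theorem measurable_rep : Measurable rep :=
  measurable_subtype_coe.comp (AddCircle.measurableEquivIoc (2 * Real.pi) (-Real.pi)).measurable

theorem norm_coe_circle {t : ℝ} (ht : |t| ≤ Real.pi) : ‖(t : S1)‖ = |t| := by
  rw [AddCircle.norm_coe_eq_abs_iff _ Real.two_pi_pos.ne', abs_of_pos Real.two_pi_pos]
  linarith

theorem abs_rep (x : S1) : |rep x| = ‖x‖ := by
  have h := rep_mem x
  conv_rhs => rw [← coe_rep x]
  rw [norm_coe_circle (abs_le.2 ⟨h.1.le, h.2⟩)]

theorem dist_eq_abs_rep (x y : S1) : dist x y = |rep (x - y)| := by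
  rw [abs_rep, dist_eq_norm]

theorem integral_circle_shift (q : S1) (G : S1 → ℂ) :
    ∫ y, G y = ∫ t in Set.Ioc (-Real.pi) Real.pi, G (q + (t : S1)) := by
  have h := AddCircle.integral_preimage (2 * Real.pi) (-Real.pi) (fun y => G (q + y))
  rw [show -Real.pi + 2 * Real.pi = Real.pi by ring] at h
  rw [h]
  exact (integral_add_left_eq_self G q).symm

/-- A profile supported in `|t| < π` does not wrap around, so the circle may be replaced by the
line. -/
theorem integral_rep_mul (q : S1) {Φ : ℝ → ℂ} (hΦ : ∀ t, Real.pi ≤ |t| → Φ t = 0) (φ : S1 → ℂ) :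
    ∫ y, Φ (rep (y - q)) * φ y = ∫ t : ℝ, Φ t * φ (q + (t : S1)) := by
  rw [integral_circle_shift q, ← integral_indicator measurableSet_Ioc]
  refine integral_congr_ae (ae_of_all _ fun t => ?_)
  by_cases ht : t ∈ Set.Ioc (-Real.pi) Real.pi
  · simp only [Set.indicator_of_mem ht, add_sub_cancel_left, rep_coe ht]
  · simp only [Set.indicator_of_notMem ht]
    rw [hΦ t, zero_mul]
    by_contra hcon
    have := abs_lt.1 (not_le.1 hcon)
    exact ht ⟨this.1, this.2.le⟩

/-- Integration against a truncated Gaussian on the circle. -/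
theorem integral_cutG_rep (q : S1) {m h M : ℝ} (hh : 0 < h) (hm : |m| + h * M < Real.pi)
    (φ : S1 → ℂ) :
    ∫ y, ((h⁻¹ * cutG M ((rep (y - q) - m) / h) : ℝ) : ℂ) * φ y
      = ∫ z : ℝ, (cutG M z : ℂ) * φ (q + ((m + h * z : ℝ) : S1)) := by
  rw [integral_rep_mul q (Φ := fun t => ((h⁻¹ * cutG M ((t - m) / h) : ℝ) : ℂ))]
  · have h1 : ∀ t : ℝ, ((h⁻¹ * cutG M ((t - m) / h) : ℝ) : ℂ) * φ (q + (t : S1))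
        = (fun s => (fun z => (h⁻¹ : ℂ) * ((cutG M z : ℂ) * φ (q + ((m + h * z : ℝ) : S1))))
          (h⁻¹ * s)) (t - m) := by
      intro t
      simp only
      have h2 : m + h * (h⁻¹ * (t - m)) = t := by field_simp; ring
      rw [h2, div_eq_inv_mul]
      push_cast
      ring
    rw [integral_congr_ae (ae_of_all _ h1), integral_sub_right_eq_self
      (fun s => (fun z => (h⁻¹ : ℂ) * ((cutG M z : ℂ) * φ (q + ((m + h * z : ℝ) : S1)))) (h⁻¹ * s)),
      Measure.integral_comp_mul_left
        (fun z => (h⁻¹ : ℂ) * ((cutG M z : ℂ) * φ (q + ((m + h * z : ℝ) : S1)))),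
      integral_const_mul, inv_inv, abs_of_pos hh, Complex.real_smul, ← mul_assoc,
      mul_inv_cancel₀ (by exact_mod_cast hh.ne'), one_mul]
  · intro t ht
    have : M < |(t - m) / h| := by
      rw [abs_div, abs_of_pos hh, lt_div_iff₀ hh]
      have := abs_sub_abs_le_abs_sub t m
      linarith [mul_comm h M]
    simp [cutG_eq_zero this]

theorem stepMean_eq (f : S1 → S1) (σ : S1 → ℝ) (ε : ℝ) (φ : S1 → ℂ) (x : S1) :
    stepMean f σ ε φ x = ∫ z : ℝ, (stdG z : ℂ) * φ (f x + ((ε * σ x * z : ℝ) : S1)) := by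
  unfold stepMean noisyStep
  rw [integral_gaussianReal_eq_integral_smul one_ne_zero]
  refine integral_congr_ae (ae_of_all _ fun z => ?_)
  simp only [Complex.real_smul]
  congr 2
  simp [gaussianPDFReal, stdG, div_eq_inv_mul]

end Circle

/-! ### First order expansion of the circle map with quadratic error. -/

section LocalExpansion

/-- Second order Taylor bound for a smooth function at the origin. -/
theorem exists_taylor_two {G : ℝ → ℝ} (hG : ContDiff ℝ ∞ G) (h0 : G 0 = 0) :
    ∃ C > 0, ∀ t, |t| ≤ 1 → |G t - deriv G 0 * t| ≤ C * t ^ 2 := by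
  have h1 : ContDiff ℝ ∞ (deriv G) := (contDiff_infty_iff_deriv.1 hG).2
  have h2 : Continuous (deriv (deriv G)) := (contDiff_infty_iff_deriv.1 h1).2.continuous
  obtain ⟨C, hC⟩ := (isCompact_Icc (a := (-1 : ℝ)) (b := 1)).exists_bound_of_continuousOn
    h2.continuousOn
  have hC' : ∀ x ∈ Set.Icc (-1 : ℝ) 1, ‖deriv (deriv G) x‖ ≤ |C| + 1 := fun x hx =>
    (hC x hx).trans (by linarith [le_abs_self C])
  have hd1 : Differentiable ℝ (deriv G) := (contDiff_infty_iff_deriv.1 h1).1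
  have hd0 : Differentiable ℝ G := (contDiff_infty_iff_deriv.1 hG).1
  have hlip : ∀ s ∈ Set.Icc (-1 : ℝ) 1, ‖deriv G s - deriv G 0‖ ≤ (|C| + 1) * ‖s - 0‖ :=
    fun s hs => (convex_Icc (-1 : ℝ) 1).norm_image_sub_le_of_norm_deriv_le
      (fun x _ => hd1 x) hC' (by norm_num) hs
  refine ⟨|C| + 1, by positivity, fun t ht => ?_⟩
  have ht' := abs_le.1 ht
  have hsub : Set.uIcc 0 t ⊆ Set.Icc (-1) 1 :=
    Set.uIcc_subset_Icc (by norm_num) ⟨by linarith, by linarith⟩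
  have habs : ∀ s ∈ Set.uIcc 0 t, |s| ≤ |t| := by
    intro s hs
    have := Set.abs_sub_left_of_mem_uIcc hs
    simpa using this
  have hd : ∀ s, HasDerivAt (fun s => G s - deriv G 0 * s) (deriv G s - deriv G 0) s := by
    intro s
    have h3 : HasDerivAt (fun s => deriv G 0 * s) (deriv G 0) s := by
      simpa using (hasDerivAt_id s).const_mul (deriv G 0)
    exact (hd0 s).hasDerivAt.sub h3
  have h4 := (convex_uIcc (0 : ℝ) t).norm_image_sub_le_of_norm_hasDerivWithin_le
    (f := fun s => G s - deriv G 0 * s) (C := (|C| + 1) * |t|)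
    (fun s _ => (hd s).hasDerivWithinAt) (fun s hs => by
      refine (hlip s (hsub hs)).trans ?_
      rw [sub_zero, Real.norm_eq_abs]
      exact mul_le_mul_of_nonneg_left (habs s hs) (by positivity)) Set.left_mem_uIcc
      Set.right_mem_uIcc
  simp only [h0, mul_zero, sub_zero, Real.norm_eq_abs] at h4
  refine h4.trans (le_of_eq ?_)
  rw [mul_assoc, ← sq, sq_abs]

/-- Local expansion of a smooth circle map. -/
theorem exists_local_expansion {f : S1 → S1} (hf : IsSmoothCircleMap f) (p : S1) :
    ∃ G : ℝ → ℝ, ∃ C > 0, (∀ t : ℝ, f (p + (t : S1)) = f p + ((G t : ℝ) : S1)) ∧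
      ∀ t, |t| ≤ 1 → |G t - circleDeriv f p * t| ≤ C * t ^ 2 := by
  obtain ⟨F, hF, hfF⟩ := hf
  set t₀ := rep p with ht₀
  have hp : ((t₀ : ℝ) : S1) = p := coe_rep p
  set G : ℝ → ℝ := fun t => F (t₀ + t) - F t₀ with hG
  have hGs : ContDiff ℝ ∞ G := (hF.comp (contDiff_const.add contDiff_id)).sub contDiff_const
  have hG0 : G 0 = 0 := by simp [hG]
  have hinc : ∀ t : ℝ, f (p + (t : S1)) = f p + ((G t : ℝ) : S1) := by
    intro t
    have h1 : p + (t : S1) = ((t₀ + t : ℝ) : S1) := by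
      rw [AddCircle.coe_add, hp]
    have h2 : f p = ((F t₀ : ℝ) : S1) := by rw [← hfF, hp]
    rw [h1, hfF, h2, ← AddCircle.coe_add, hG]
    simp
  -- Near zero `rep` inverts the projection to the circle, so `circleDeriv` is the derivative of the
  -- lift.
  have hderiv : circleDeriv f p = deriv G 0 := by
    unfold circleDeriv
    refine Filter.EventuallyEq.deriv_eq ?_
    have hc : Tendsto G (𝓝 0) (𝓝 0) := by
      have := hGs.continuous.tendsto 0
      rwa [hG0] at this
    have hm : Set.Ioc (-Real.pi) Real.pi ∈ 𝓝 (0 : ℝ) :=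
      Ioc_mem_nhds (by linarith [Real.pi_pos]) Real.pi_pos
    filter_upwards [hc hm] with t ht
    rw [hinc, add_sub_cancel_left, rep_coe ht]
  obtain ⟨C, hC, h⟩ := exists_taylor_two hGs hG0
  exact ⟨G, C, hC, hinc, fun t ht => by rw [hderiv]; exact h t ht⟩

/-- For `|t| ≤ τ / C` the quadratic error is at most `τ |t|`. The last bound in the choice of `δ`
keeps the displacement of the image below `π`, where it equals the distance. -/
theorem exists_dist_expansion {f : S1 → S1} (hf : IsSmoothCircleMap f) (p : S1) {τ : ℝ}
    (hτ : 0 < τ) : ∃ δ > 0, ∀ x, dist x p ≤ δ →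
      (|circleDeriv f p| - τ) * dist x p ≤ dist (f x) (f p) ∧
      dist (f x) (f p) ≤ (|circleDeriv f p| + τ) * dist x p := by
  obtain ⟨G, C, hC, hinc, hG⟩ := exists_local_expansion hf p
  set c := circleDeriv f p with hc
  refine ⟨min 1 (min (τ / C) (1 / (|c| + τ))), by positivity, fun x hx => ?_⟩
  set t := rep (x - p) with ht
  have hxt : x = p + (t : S1) := by rw [ht, coe_rep]; abel
  have hdt : dist x p = |t| := dist_eq_abs_rep x p
  rw [hdt] at hx ⊢
  have h1 : |t| ≤ 1 := hx.trans (min_le_left _ _)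
  have h2 : C * |t| ≤ τ := by
    rw [mul_comm, ← le_div_iff₀ hC]
    exact hx.trans ((min_le_right _ _).trans (min_le_left _ _))
  have h3 : (|c| + τ) * |t| ≤ 1 := by
    rw [mul_comm, ← le_div_iff₀ (by positivity)]
    exact hx.trans ((min_le_right _ _).trans (min_le_right _ _))
  have h4 : |G t - c * t| ≤ τ * |t| := by
    refine (hG t h1).trans ?_
    rw [← sq_abs, sq, ← mul_assoc]
    exact mul_le_mul_of_nonneg_right h2 (abs_nonneg t)
  have h5 : |G t| ≤ (|c| + τ) * |t| := by
    have := abs_sub_abs_le_abs_sub (G t) (c * t)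
    rw [abs_mul] at this
    linarith
  have h6 : (|c| - τ) * |t| ≤ |G t| := by
    have := abs_sub_abs_le_abs_sub (c * t) (G t)
    rw [abs_mul, abs_sub_comm] at this
    linarith
  have h7 : dist (f x) (f p) = |G t| := by
    rw [hxt, hinc, dist_eq_norm, add_sub_cancel_left,
      norm_coe_circle (by linarith [Real.pi_gt_three])]
  rw [h7]
  exact ⟨h6, h5⟩

end LocalExpansion

/-! ### Continuity of Gaussian laws in total variation. -/

section TotalVariation

/-- Dominated convergence: for mean in `(-1, 1)` and standard deviation in `(1 / 2, 2)` the
densities lie below one wide Gaussian, by `(z - u) ^ 2 ≥ z ^ 2 / 2 - u ^ 2`. -/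
theorem tendsto_integral_abs_stdG_sub :
    Tendsto (fun q : ℝ × ℝ => ∫ z, |stdG z - stdG ((z - q.1) / q.2) / q.2|) (𝓝 (0, 1)) (𝓝 0) := by
  have hg := continuous_stdG
  suffices h0 : Tendsto (fun q : ℝ × ℝ => ∫ z, |stdG z - stdG ((z - q.1) / q.2) / q.2|)
      (𝓝 (0, 1)) (𝓝 (∫ _ : ℝ, (0 : ℝ))) by simpa using h0
  refine tendsto_integral_filter_of_dominated_convergence
    (fun z => stdG z + 2 * Real.exp (1 / 8) * Real.exp (-(1 / 16) * z ^ 2)) ?_ ?_ ?_ ?_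
  · refine Eventually.of_forall fun q => ?_
    exact (by fun_prop : Continuous fun z => |stdG z - stdG ((z - q.1) / q.2) / q.2|)
      |>.aestronglyMeasurable
  · have h1 : ∀ᶠ q : ℝ × ℝ in 𝓝 (0, 1), |q.1| < 1 ∧ 1 / 2 < q.2 ∧ q.2 < 2 := by
      have a1 : ∀ᶠ q : ℝ × ℝ in 𝓝 (0, 1), |q.1| < 1 :=
        (continuous_abs.comp continuous_fst).continuousAt.eventually (gt_mem_nhds (by simp))
      have a2 : ∀ᶠ q : ℝ × ℝ in 𝓝 (0, 1), 1 / 2 < q.2 :=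
        continuous_snd.continuousAt.eventually (lt_mem_nhds (by norm_num))
      have a3 : ∀ᶠ q : ℝ × ℝ in 𝓝 (0, 1), q.2 < 2 :=
        continuous_snd.continuousAt.eventually (gt_mem_nhds (by norm_num))
      filter_upwards [a1, a2, a3] with q b1 b2 b3 using ⟨b1, b2, b3⟩
    filter_upwards [h1] with q ⟨hu, hv1, hv2⟩
    refine ae_of_all _ fun z => ?_
    have hv : 0 < q.2 := by linarith
    rw [Real.norm_eq_abs, abs_abs]
    refine (abs_sub _ _).trans ?_
    rw [abs_of_nonneg (stdG_nonneg z), abs_of_nonneg (div_nonneg (stdG_nonneg _) hv.le)]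
    gcongr
    have b1 : stdG ((z - q.1) / q.2) ≤ Real.exp (-((z - q.1) / q.2) ^ 2 / 2) := by
      refine div_le_self (Real.exp_pos _).le (Real.one_le_sqrt.2 ?_)
      nlinarith [Real.pi_gt_three]
    have b2 : Real.exp (-((z - q.1) / q.2) ^ 2 / 2)
        ≤ Real.exp (1 / 8) * Real.exp (-(1 / 16) * z ^ 2) := by
      rw [← Real.exp_add]
      refine Real.exp_le_exp.2 ?_
      have b3 : (z - q.1) ^ 2 / 4 ≤ ((z - q.1) / q.2) ^ 2 := by
        rw [div_pow]
        exact div_le_div_of_nonneg_left (sq_nonneg _) (by positivity) (by nlinarith)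
      have b4 : q.1 ^ 2 ≤ 1 := by rw [← sq_abs]; exact pow_le_one₀ (abs_nonneg _) hu.le
      nlinarith [sq_nonneg (z - 2 * q.1)]
    rw [div_le_iff₀ hv]
    have b5 := b1.trans b2
    have b6 : 0 < Real.exp (1 / 8) * Real.exp (-(1 / 16) * z ^ 2) := by positivity
    nlinarith
  · exact integrable_stdG.add ((integrable_exp_neg_mul_sq (by norm_num)).const_mul _)
  · refine ae_of_all _ fun z => ?_
    have h1 : ContinuousAt (fun q : ℝ × ℝ => |stdG z - stdG ((z - q.1) / q.2) / q.2|) (0, 1) := by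
      have h2 : ContinuousAt (fun q : ℝ × ℝ => (z - q.1) / q.2) (0, 1) :=
        (continuousAt_const.sub continuousAt_fst).div continuousAt_snd (by norm_num)
      have h3 : ContinuousAt (fun q : ℝ × ℝ => stdG ((z - q.1) / q.2)) (0, 1) :=
        hg.continuousAt.comp h2
      exact (continuousAt_const.sub (h3.div continuousAt_snd (by norm_num))).abs
    have h2 := h1.tendsto
    simpa using h2

/-- Gaussian means with nearby parameters are close, uniformly over bounded functions. -/
theorem exists_gaussian_close {η : ℝ} (hη : 0 < η) : ∃ δ > 0, ∀ m h m₀ h₀ : ℝ, 0 < h →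
    |m₀ - m| ≤ δ * h → |h₀ - h| ≤ δ * h → ∀ (ψ : ℝ → ℂ) (D : ℝ), Measurable ψ → (∀ x, ‖ψ x‖ ≤ D) →
    ‖(∫ z, (stdG z : ℂ) * ψ (m₀ + h₀ * z)) - ∫ z, (stdG z : ℂ) * ψ (m + h * z)‖ ≤ η * D := by
  have h1 := tendsto_integral_abs_stdG_sub.eventually (gt_mem_nhds hη)
  obtain ⟨δ, hδ, hball⟩ := Metric.eventually_nhds_iff.1 h1
  refine ⟨min (δ / 2) (1 / 2), by positivity, fun m h m₀ h₀ hh hm hh₀ ψ D hψ hD => ?_⟩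
  -- Standardising by `m` and `h` reduces the comparison to a standard Gaussian against one with
  -- mean `u` and deviation `v`; only errors relative to `h` matter.
  set u := (m₀ - m) / h with hu
  set v := h₀ / h with hv
  have hu' : |u| ≤ min (δ / 2) (1 / 2) := by
    rw [hu, abs_div, abs_of_pos hh, div_le_iff₀ hh]; exact hm
  have hv' : |v - 1| ≤ min (δ / 2) (1 / 2) := by
    rw [hv, div_sub_one hh.ne', abs_div, abs_of_pos hh, div_le_iff₀ hh]; exact hh₀
  have hv0 : 0 < v := by
    have := (abs_le.1 (hv'.trans (min_le_right _ _))).1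
    linarith
  have hclose : ∫ z, |stdG z - stdG ((z - u) / v) / v| < η := by
    refine hball (y := (u, v)) ?_
    rw [Prod.dist_eq, max_lt_iff, Real.dist_eq, Real.dist_eq, sub_zero]
    exact ⟨(hu'.trans (min_le_left _ _)).trans_lt (half_lt_self hδ),
      (hv'.trans (min_le_left _ _)).trans_lt (half_lt_self hδ)⟩
  set χ : ℝ → ℂ := fun z => ψ (m + h * z) with hχ
  have hχm : Measurable χ := hψ.comp (by fun_prop)
  have hχD : ∀ z, ‖χ z‖ ≤ D := fun z => hD _
  have hg := continuous_stdG
  have e1 : ∫ z, (stdG z : ℂ) * ψ (m₀ + h₀ * z)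
      = ∫ z, ((stdG ((z - u) / v) / v : ℝ) : ℂ) * χ z := by
    have h2 : ∀ z : ℝ, (stdG z : ℂ) * ψ (m₀ + h₀ * z) = (fun s =>
        (fun z => (stdG ((z - u) / v) : ℂ) * χ z) (s + u)) (v * z) := by
      intro z
      simp only [hχ, add_sub_cancel_right]
      rw [mul_div_cancel_left₀ _ hv0.ne']
      congr 2
      rw [hu, hv]
      field_simp
      ring
    rw [integral_congr_ae (ae_of_all _ h2), Measure.integral_comp_mul_left (fun s =>
        (fun z => (stdG ((z - u) / v) : ℂ) * χ z) (s + u)), integral_add_right_eq_self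
        (fun z => (stdG ((z - u) / v) : ℂ) * χ z), abs_of_pos (inv_pos.2 hv0), Complex.real_smul,
        ← integral_const_mul]
    refine integral_congr_ae (ae_of_all _ fun z => ?_)
    simp only
    push_cast
    ring
  have i1 : Integrable fun z => stdG ((z - u) / v) / v :=
    ((integrable_stdG.comp_div hv0.ne').comp_sub_right u).div_const v
  have i2 : Integrable fun z => (stdG z : ℂ) * χ z :=
    integrable_stdG.ofReal.mul_bdd (c := D) hχm.aestronglyMeasurable (ae_of_all _ hχD)
  have i3 : Integrable fun z => ((stdG ((z - u) / v) / v : ℝ) : ℂ) * χ z :=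
    i1.ofReal.mul_bdd (c := D) hχm.aestronglyMeasurable (ae_of_all _ hχD)
  rw [e1, ← integral_sub i3 i2]
  have hD0 : 0 ≤ D := (norm_nonneg _).trans (hD 0)
  calc _ ≤ ∫ z, |stdG z - stdG ((z - u) / v) / v| * D := by
        refine norm_integral_le_of_norm_le ((integrable_stdG.sub i1).abs.mul_const D)
          (ae_of_all _ fun z => ?_)
        rw [← sub_mul, norm_mul, ← Complex.ofReal_sub, Complex.norm_real, Real.norm_eq_abs,
          abs_sub_comm]
        exact mul_le_mul_of_nonneg_left (hχD z) (abs_nonneg _)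
    _ = (∫ z, |stdG z - stdG ((z - u) / v) / v|) * D := integral_mul_const _ _
    _ ≤ η * D := mul_le_mul_of_nonneg_right hclose.le hD0

theorem tendsto_integral_cutG : Tendsto (fun M => ∫ u, cutG M u) atTop (𝓝 1) := by
  rw [← integral_stdG]
  refine tendsto_integral_filter_of_dominated_convergence stdG ?_ ?_ integrable_stdG ?_
  · exact Eventually.of_forall fun M => (measurable_cutG M).aestronglyMeasurable
  · refine Eventually.of_forall fun M => ae_of_all _ fun u => ?_
    rw [Real.norm_eq_abs, abs_of_nonneg (cutG_nonneg _ _)]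
    exact cutG_le_stdG _ _
  · refine ae_of_all _ fun u => tendsto_const_nhds.congr' ?_
    filter_upwards [eventually_ge_atTop |u|] with M hM
    rw [cutG, Set.indicator_of_mem (Set.mem_Icc.2 (abs_le.1 hM))]

theorem norm_integral_stdG_sub_cutG_le {ψ : ℝ → ℂ} {D : ℝ} (hψ : Measurable ψ)
    (hD : ∀ x, ‖ψ x‖ ≤ D) (M : ℝ) :
    ‖(∫ z, (stdG z : ℂ) * ψ z) - ∫ z, (cutG M z : ℂ) * ψ z‖ ≤ (1 - ∫ u, cutG M u) * D := by
  have i2 : Integrable fun z => (stdG z : ℂ) * ψ z :=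
    integrable_stdG.ofReal.mul_bdd (c := D) hψ.aestronglyMeasurable (ae_of_all _ hD)
  have i3 : Integrable fun z => (cutG M z : ℂ) * ψ z :=
    (integrable_cutG M).ofReal.mul_bdd (c := D) hψ.aestronglyMeasurable (ae_of_all _ hD)
  rw [← integral_sub i2 i3, ← integral_stdG, ← integral_sub integrable_stdG (integrable_cutG M),
    ← integral_mul_const]
  refine norm_integral_le_of_norm_le ((integrable_stdG.sub (integrable_cutG M)).mul_const D)
    (ae_of_all _ fun z => ?_)
  rw [← sub_mul, norm_mul, ← Complex.ofReal_sub, Complex.norm_real, Real.norm_eq_abs,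
    abs_of_nonneg (sub_nonneg.2 (cutG_le_stdG _ _))]
  exact mul_le_mul_of_nonneg_left (hD z) (sub_nonneg.2 (cutG_le_stdG _ _))

end TotalVariation

/-! ### Small arcs and their rescaled coordinate. -/

section Disk

/-- The displacement from `p` in units of `ε`. -/
noncomputable def coord (ε : ℝ) (p x : S1) : ℝ := rep (x - p) / ε

/-- The arc of radius `ε A` around `p`. -/
def disk (ε A : ℝ) (p : S1) : Set S1 := {x | |coord ε p x| ≤ A}

/-- A function on the arc of radius `ε A` around `p`, read in the coordinate `coord ε p`. -/
noncomputable def pull (ε A : ℝ) (p : S1) (φ : S1 → ℂ) : ℝ → ℂ :=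
  (Set.Icc (-A) A).indicator fun t => φ (p + ((ε * t : ℝ) : S1))

variable {ε A : ℝ} {p : S1}

theorem measurable_coord (ε : ℝ) (p : S1) : Measurable (coord ε p) :=
  (measurable_rep.comp (measurable_id.sub_const p)).div_const ε

theorem measurableSet_disk (ε A : ℝ) (p : S1) : MeasurableSet (disk ε A p) :=
  measurableSet_le (measurable_coord ε p).abs measurable_const

theorem mem_disk_iff (hε : 0 < ε) {x : S1} : x ∈ disk ε A p ↔ dist x p ≤ ε * A := by
  rw [disk, Set.mem_ofPred_eq, coord, abs_div, abs_of_pos hε, div_le_iff₀ hε, dist_eq_abs_rep,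
    mul_comm A ε]

theorem add_coord (hε : 0 < ε) (p x : S1) : p + ((ε * coord ε p x : ℝ) : S1) = x := by
  rw [coord, mul_div_cancel₀ _ hε.ne', coe_rep, add_sub_cancel]

theorem coord_add (hε : 0 < ε) (hA : ε * A < Real.pi) {t : ℝ} (ht : |t| ≤ A) :
    coord ε p (p + ((ε * t : ℝ) : S1)) = t := by
  have h : |ε * t| < Real.pi := by
    rw [abs_mul, abs_of_pos hε]
    exact (mul_le_mul_of_nonneg_left ht hε.le).trans_lt hA
  rw [coord, add_sub_cancel_left, rep_coe ⟨(abs_lt.1 h).1, (abs_lt.1 h).2.le⟩,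
    mul_div_cancel_left₀ _ hε.ne']

theorem pull_apply (φ : S1 → ℂ) {t : ℝ} (ht : |t| ≤ A) :
    pull ε A p φ t = φ (p + ((ε * t : ℝ) : S1)) :=
  Set.indicator_of_mem (Set.mem_Icc.2 (abs_le.1 ht)) _

theorem pull_eq_zero (φ : S1 → ℂ) {t : ℝ} (ht : A < |t|) : pull ε A p φ t = 0 :=
  Set.indicator_of_notMem (fun h => not_le.2 ht (abs_le.2 (Set.mem_Icc.1 h))) _

theorem pull_coord (hε : 0 < ε) (φ : S1 → ℂ) {x : S1} (hx : x ∈ disk ε A p) :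
    pull ε A p φ (coord ε p x) = φ x := by
  rw [pull_apply φ hx, add_coord hε]

theorem isBddSupp_pull {φ : S1 → ℂ} (hφ : Measurable φ) (hb : ∃ C, ∀ x, ‖φ x‖ ≤ C) :
    IsBddSupp A (pull ε A p φ) where
  measurable := by
    refine Measurable.indicator (hφ.comp ?_) measurableSet_Icc
    exact (continuous_const.add ((AddCircle.continuous_mk' (2 * Real.pi)).comp
      (by fun_prop : Continuous fun t : ℝ => ε * t))).measurable
  bdd := by
    obtain ⟨C, hC⟩ := hb
    exact ⟨C, fun t => (norm_indicator_le_norm_self _ _).trans (hC _)⟩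
  support := fun t ht => pull_eq_zero φ ht

/-- Integration over an arc, in the rescaled coordinate. -/
theorem integral_disk (hε : 0 < ε) (hA : ε * A < Real.pi) (k : ℝ → ℝ) (φ : S1 → ℂ) :
    ∫ y, (((disk ε A p).indicator 1 y * (ε⁻¹ * k (coord ε p y)) : ℝ) : ℂ) * φ y
      = ∫ t, (k t : ℂ) * pull ε A p φ t := by
  set Φ : ℝ → ℂ := fun s => (((Set.Icc (-A) A).indicator 1 (s / ε) * (ε⁻¹ * k (s / ε)) : ℝ) : ℂ)
    with hΦ
  have h1 : ∀ y, (((disk ε A p).indicator 1 y * (ε⁻¹ * k (coord ε p y)) : ℝ) : ℂ) * φ y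
      = Φ (rep (y - p)) * φ y := by
    intro y
    simp only [hΦ, Set.indicator_apply, disk, Set.mem_ofPred_eq, coord, Set.mem_Icc, abs_le,
      Pi.one_apply]
  rw [integral_congr_ae (ae_of_all _ h1), integral_rep_mul p]
  · have h2 : ∀ t : ℝ, Φ t * φ (p + (t : S1))
        = (fun u => (ε⁻¹ : ℂ) * ((k u : ℂ) * pull ε A p φ u)) (ε⁻¹ * t) := by
      intro t
      simp only [hΦ, pull, Set.indicator_apply, ← div_eq_inv_mul]
      split_ifs with h
      · rw [mul_div_cancel₀ _ hε.ne']
        simp only [Pi.one_apply]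
        push_cast
        ring
      · simp
    rw [integral_congr_ae (ae_of_all _ h2), Measure.integral_comp_mul_left
        (fun u => (ε⁻¹ : ℂ) * ((k u : ℂ) * pull ε A p φ u)),
      integral_const_mul, inv_inv, abs_of_pos hε, Complex.real_smul, ← mul_assoc,
      mul_inv_cancel₀ (by exact_mod_cast hε.ne'), one_mul]
  · intro t ht
    have : t / ε ∉ Set.Icc (-A) A := by
      intro h
      have h3 := abs_le.2 (Set.mem_Icc.1 h)
      rw [abs_div, abs_of_pos hε, div_le_iff₀ hε] at h3
      linarith [mul_comm A ε]
    simp [hΦ, this]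

end Disk

/-! ### Blocks on arcs as blocks on the line. -/

section DiskBlock

variable {J : ℕ} {ε M : ℝ}

/-- If a kernel acts on an arc as a block on the line, then so do its eigenfunctions. -/
theorem integral_block {A α w a b : ℝ} {p : S1} {ν : ℕ → ℝ} {e e' : ℕ → ℝ → ℝ}
    (hε : 0 < ε) (hA : ε * A < Real.pi) (u : ℝ) {k : S1 → ℝ}
    (hk : ∀ y, k y = (disk ε A p).indicator 1 y *
      (ε⁻¹ * blockLine J α A w a b M ν e e' (coord ε p y) u)) (φ : S1 → ℂ) :
    ∫ y, (k y : ℂ) * φ y = blockOp J α A w a b M ν e e' (pull ε A p φ) u := by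
  simp_rw [hk]
  exact integral_disk hε hA (fun t => blockLine J α A w a b M ν e e' t u) φ

theorem blockOp_eq_zero {A A' α α' C κ C' κ' w a b : ℝ} {ν : ℕ → ℝ} {e e' : ℕ → ℝ → ℝ}
    (he : IsCutHermite J α A C κ e) (he' : IsCutHermite J α' A' C' κ' e') (ha : a ≠ 0)
    (hA : M + |b| * A ≤ |a| * A') {ψ : ℝ → ℂ} (hψ : IsBddSupp A ψ) {y : ℝ} (hy : A' < |y|) :
    blockOp J α A w a b M ν e e' ψ y = 0 := by
  unfold blockOp
  rw [integral_eq_zero_of_ae]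
  refine ae_of_all _ fun x => ?_
  simp only [Pi.zero_apply]
  by_cases hx : A < |x|
  · rw [hψ.support x hx, mul_zero]
  · rw [blockLine_eq he he' ha hA (Or.inr hy), cutG_eq_zero]
    · simp
    · have h1 : |a| * A' < |a| * |y| := mul_lt_mul_of_pos_left hy (abs_pos.2 ha)
      have h2 : |b| * |x| ≤ |b| * A := mul_le_mul_of_nonneg_left (not_lt.1 hx) (abs_nonneg _)
      have h3 := abs_sub_abs_le_abs_sub (a * y) (b * x)
      rw [abs_mul, abs_mul] at h3
      linarith

end DiskBlock

/-! ### Spectra of the blocks of one arc and of a pair of arcs. -/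

section DiskSpectrum

theorem IsCutHermite.bounded_coord {J : ℕ} {α A C κ : ℝ} {e : ℕ → ℝ → ℝ}
    (he : IsCutHermite J α A C κ e) (hC : 0 ≤ C) (hκ : 0 ≤ κ) {j : ℕ} (hj : j < J) (ε : ℝ) (p : S1) :
    Measurable (fun x => (e j (coord ε p x) : ℂ)) ∧ ∃ D, ∀ x, ‖(e j (coord ε p x) : ℂ)‖ ≤ D := by
  have h := he.isBddSupp hC hκ hj
  refine ⟨h.measurable.comp (measurable_coord ε p), ?_⟩
  obtain ⟨D, hD⟩ := h.bdd
  exact ⟨D, fun x => hD _⟩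

theorem IsCutHermite.pull_eq {J : ℕ} {α A C κ : ℝ} {e : ℕ → ℝ → ℝ} (he : IsCutHermite J α A C κ e)
    {j : ℕ} (hj : j < J) {ε : ℝ} (hε : 0 < ε) (hA : ε * A < Real.pi) (p : S1) :
    pull ε A p (fun x => (e j (coord ε p x) : ℂ)) = fun t => (e j t : ℂ) := by
  funext t
  by_cases ht : |t| ≤ A
  · rw [pull_apply _ ht, coord_add hε hA ht]
  · rw [pull_eq_zero _ (not_le.1 ht), he.support j hj t (not_le.1 ht), Complex.ofReal_zero]

variable {J : ℕ} {ε M : ℝ} (hε : 0 < ε)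

section Single

variable {α A C κ w a b : ℝ} {p : S1} {ν : ℕ → ℝ} {e : ℕ → ℝ → ℝ} {K : S1 → S1 → ℝ}
  (hα : 0 < α) (hC : 0 ≤ C) (hκ : 0 ≤ κ) (he : IsCutHermite J α A C κ e) (ha : a ≠ 0)
  (hA : M + |b| * A ≤ |a| * A) (hεA : ε * A < Real.pi)
  (hK : ∀ x ∈ disk ε A p, ∀ y ∈ disk ε A p,
    K x y = ε⁻¹ * blockLine J α A w a b M ν e e (coord ε p y) (coord ε p x))

include hε hεA hK in
theorem kerInt_disk {x : S1} (hx : x ∈ disk ε A p) (φ : S1 → ℂ) :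
    kerInt volume (blockKernel (disk ε A p) K) φ x
      = blockOp J α A w a b M ν e e (pull ε A p φ) (coord ε p x) := by
  refine integral_block hε hεA _ (fun y => ?_) φ
  by_cases hy : y ∈ disk ε A p
  · simp [blockKernel, hx, hy, hK x hx y hy]
  · simp [blockKernel, hy]

include hε hα hC hκ he ha hA hεA hK in
theorem disk_eigen_expansion {lam : ℂ} (hl : lam ≠ 0)
    (hbig : ∀ n, J ≤ n → |w| / |a| * |b / a| ^ n * (|w| / |a| * |b / a| ^ n) < ‖lam‖ ^ 2)
    {φ : S1 → ℂ} (hφ : IsKernelEigen volume (blockKernel (disk ε A p) K) lam φ) :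
    ∃ c : ℕ → ℂ, (∀ x, φ x = ∑ j ∈ Finset.range J, c j * (e j (coord ε p x) : ℂ)) ∧
      ∀ j < J, ν j * c j = lam * c j := by
  have hb : IsBddSupp A (pull ε A p φ) := isBddSupp_pull hφ.measurable hφ.bdd
  have hop : ∀ y, blockOp J α A w a b M ν e e (pull ε A p φ) y = lam * pull ε A p φ y := by
    intro y
    by_cases hy : |y| ≤ A
    · have hx : p + ((ε * y : ℝ) : S1) ∈ disk ε A p := by
        rw [disk, Set.mem_ofPred_eq, coord_add hε hεA hy]; exact hy
      have h1 := hφ.eigen (p + ((ε * y : ℝ) : S1))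
      rw [kerInt_disk hε hεA hK hx, coord_add hε hεA hy] at h1
      rw [h1, pull_apply φ hy]
    · rw [blockOp_eq_zero he he ha hA hb (not_le.1 hy), hb.support y (not_le.1 hy), mul_zero]
  -- A single arc is treated as a two-cycle both of whose points coincide.
  obtain ⟨h1, -, h2, -⟩ := blockOp_pair_spectrum hα hα hC hκ hC hκ he he ha ha hA hA hbig hb hb
    hop hop
  refine ⟨fun j => hermCoeff α j (pull ε A p φ), fun x => ?_, h2⟩
  by_cases hx : x ∈ disk ε A p
  · rw [← h1, pull_coord hε φ hx]
  · rw [hφ.eq_zero_of_notMem hl hx]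
    refine (Finset.sum_eq_zero fun j hj => ?_).symm
    rw [he.support j (Finset.mem_range.1 hj) _ (not_le.1 hx), Complex.ofReal_zero, mul_zero]

include hε hα hC hκ he hεA hK in
theorem disk_eigen_of_mult {j : ℕ} (hj : j < J) :
    IsKernelEigen volume (blockKernel (disk ε A p) K) (ν j) (fun x => (e j (coord ε p x) : ℂ)) := by
  obtain ⟨h1, h2⟩ := he.bounded_coord hC hκ hj ε p
  refine ⟨h1, h2, fun x => ?_⟩
  by_cases hx : x ∈ disk ε A p
  · rw [kerInt_disk hε hεA hK hx, he.pull_eq hj hε hεA, he.blockOp_self hα hC hκ hj]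
    push_cast; rfl
  · rw [he.support j hj _ (not_le.1 hx)]
    simp [kerInt, blockKernel, hx]

end Single

section Pair

variable {α₁ A₁ C₁ κ₁ w₁ a₁ b₁ α₂ A₂ C₂ κ₂ w₂ a₂ b₂ : ℝ} {p₁ p₂ : S1} {ν₁ ν₂ : ℕ → ℝ}
  {e₁ e₂ : ℕ → ℝ → ℝ} {K : S1 → S1 → ℝ}
  (hα₁ : 0 < α₁) (hα₂ : 0 < α₂) (hC₁ : 0 ≤ C₁) (hκ₁ : 0 ≤ κ₁) (hC₂ : 0 ≤ C₂) (hκ₂ : 0 ≤ κ₂)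
  (he₁ : IsCutHermite J α₁ A₁ C₁ κ₁ e₁) (he₂ : IsCutHermite J α₂ A₂ C₂ κ₂ e₂)
  (ha₁ : a₁ ≠ 0) (ha₂ : a₂ ≠ 0)
  (hA₁ : M + |b₁| * A₁ ≤ |a₁| * A₂) (hA₂ : M + |b₂| * A₂ ≤ |a₂| * A₁)
  (hεA₁ : ε * A₁ < Real.pi) (hεA₂ : ε * A₂ < Real.pi)
  (hdisj : Disjoint (disk ε A₁ p₁) (disk ε A₂ p₂))
  (hK₁ : ∀ x ∈ disk ε A₁ p₁, ∀ y ∈ disk ε A₂ p₂,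
    K x y = ε⁻¹ * blockLine J α₁ A₁ w₁ a₁ b₁ M ν₁ e₁ e₂ (coord ε p₁ x) (coord ε p₂ y))
  (hK₂ : ∀ x ∈ disk ε A₂ p₂, ∀ y ∈ disk ε A₁ p₁,
    K x y = ε⁻¹ * blockLine J α₂ A₂ w₂ a₂ b₂ M ν₂ e₂ e₁ (coord ε p₂ x) (coord ε p₁ y))
  (hK₁₁ : ∀ x ∈ disk ε A₁ p₁, ∀ y ∈ disk ε A₁ p₁, K x y = 0)
  (hK₂₂ : ∀ x ∈ disk ε A₂ p₂, ∀ y ∈ disk ε A₂ p₂, K x y = 0)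

include hε hεA₁ hK₁ hK₂₂ in
theorem kerInt_pair_right {y : S1} (hy : y ∈ disk ε A₂ p₂) (g : S1 → ℂ) :
    kerInt volume (blockKernel (disk ε A₁ p₁ ∪ disk ε A₂ p₂) fun y x => K x y) g y
      = blockOp J α₁ A₁ w₁ a₁ b₁ M ν₁ e₁ e₂ (pull ε A₁ p₁ g) (coord ε p₂ y) := by
  refine integral_block hε hεA₁ _ (fun x => ?_) g
  by_cases hx : x ∈ disk ε A₁ p₁
  · simp [blockKernel, hx, hy, hK₁ x hx y hy]
  · by_cases hx' : x ∈ disk ε A₂ p₂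
    · simp [blockKernel, hx, hx', hy, hK₂₂ x hx' y hy]
    · simp [blockKernel, hx, hx']

include hε hεA₂ hK₂ hK₁₁ in
theorem kerInt_pair_left {y : S1} (hy : y ∈ disk ε A₁ p₁) (g : S1 → ℂ) :
    kerInt volume (blockKernel (disk ε A₁ p₁ ∪ disk ε A₂ p₂) fun y x => K x y) g y
      = blockOp J α₂ A₂ w₂ a₂ b₂ M ν₂ e₂ e₁ (pull ε A₂ p₂ g) (coord ε p₁ y) := by
  rw [Set.union_comm]
  exact kerInt_pair_right hε hεA₂ hK₂ hK₁₁ hy g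

-- The transposed kernel only exchanges the two arcs, so the restrictions of an eigendensity to them
-- satisfy the cyclic system of `blockOp_pair_spectrum`.
include hε hα₁ hα₂ hC₁ hκ₁ hC₂ hκ₂ he₁ he₂ ha₁ ha₂ hA₁ hA₂ hεA₁ hεA₂ hdisj hK₁ hK₂ hK₁₁ hK₂₂ in
theorem pair_eigen_expansion {lam : ℂ} (hl : lam ≠ 0)
    (hbig : ∀ n, J ≤ n →
      |w₁| / |a₁| * |b₁ / a₁| ^ n * (|w₂| / |a₂| * |b₂ / a₂| ^ n) < ‖lam‖ ^ 2) {g : S1 → ℂ}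
    (hg : IsKernelEigen volume
      (blockKernel (disk ε A₁ p₁ ∪ disk ε A₂ p₂) fun y x => K x y) lam g) :
    ∃ c d : ℕ → ℂ, (∀ x, g x = ∑ j ∈ Finset.range J,
        (c j * (e₁ j (coord ε p₁ x) : ℂ) + d j * (e₂ j (coord ε p₂ x) : ℂ))) ∧
      (∀ j < J, ν₁ j * c j = lam * d j) ∧ ∀ j < J, ν₂ j * d j = lam * c j := by
  have hb₁ : IsBddSupp A₁ (pull ε A₁ p₁ g) := isBddSupp_pull hg.measurable hg.bdd
  have hb₂ : IsBddSupp A₂ (pull ε A₂ p₂ g) := isBddSupp_pull hg.measurable hg.bdd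
  have hop₁ : ∀ y, blockOp J α₁ A₁ w₁ a₁ b₁ M ν₁ e₁ e₂ (pull ε A₁ p₁ g) y
      = lam * pull ε A₂ p₂ g y := by
    intro y
    by_cases hy : |y| ≤ A₂
    · have hx : p₂ + ((ε * y : ℝ) : S1) ∈ disk ε A₂ p₂ := by
        rw [disk, Set.mem_ofPred_eq, coord_add hε hεA₂ hy]; exact hy
      have h1 := hg.eigen (p₂ + ((ε * y : ℝ) : S1))
      rw [kerInt_pair_right hε hεA₁ hK₁ hK₂₂ hx, coord_add hε hεA₂ hy] at h1
      rw [h1, pull_apply g hy]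
    · rw [blockOp_eq_zero he₁ he₂ ha₁ hA₁ hb₁ (not_le.1 hy), hb₂.support y (not_le.1 hy), mul_zero]
  have hop₂ : ∀ y, blockOp J α₂ A₂ w₂ a₂ b₂ M ν₂ e₂ e₁ (pull ε A₂ p₂ g) y
      = lam * pull ε A₁ p₁ g y := by
    intro y
    by_cases hy : |y| ≤ A₁
    · have hx : p₁ + ((ε * y : ℝ) : S1) ∈ disk ε A₁ p₁ := by
        rw [disk, Set.mem_ofPred_eq, coord_add hε hεA₁ hy]; exact hy
      have h1 := hg.eigen (p₁ + ((ε * y : ℝ) : S1))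
      rw [kerInt_pair_left hε hεA₂ hK₂ hK₁₁ hx, coord_add hε hεA₁ hy] at h1
      rw [h1, pull_apply g hy]
    · rw [blockOp_eq_zero he₂ he₁ ha₂ hA₂ hb₂ (not_le.1 hy), hb₁.support y (not_le.1 hy), mul_zero]
  obtain ⟨h1, h2, h3, h4⟩ := blockOp_pair_spectrum hα₁ hα₂ hC₁ hκ₁ hC₂ hκ₂ he₁ he₂ ha₁ ha₂ hA₁ hA₂
    hbig hb₁ hb₂ hop₁ hop₂
  refine ⟨fun j => hermCoeff α₁ j (pull ε A₁ p₁ g), fun j => hermCoeff α₂ j (pull ε A₂ p₂ g),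
    fun x => ?_, h3, h4⟩
  have z₁ : x ∉ disk ε A₁ p₁ → ∑ j ∈ Finset.range J,
      hermCoeff α₁ j (pull ε A₁ p₁ g) * (e₁ j (coord ε p₁ x) : ℂ) = 0 := fun hx =>
    Finset.sum_eq_zero fun j hj => by
      rw [he₁.support j (Finset.mem_range.1 hj) _ (not_le.1 hx), Complex.ofReal_zero, mul_zero]
  have z₂ : x ∉ disk ε A₂ p₂ → ∑ j ∈ Finset.range J,
      hermCoeff α₂ j (pull ε A₂ p₂ g) * (e₂ j (coord ε p₂ x) : ℂ) = 0 := fun hx =>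
    Finset.sum_eq_zero fun j hj => by
      rw [he₂.support j (Finset.mem_range.1 hj) _ (not_le.1 hx), Complex.ofReal_zero, mul_zero]
  rw [Finset.sum_add_distrib]
  by_cases hx : x ∈ disk ε A₁ p₁
  · rw [z₂ (Set.disjoint_left.1 hdisj hx), ← h1, pull_coord hε g hx, add_zero]
  · rw [z₁ hx]
    by_cases hx' : x ∈ disk ε A₂ p₂
    · rw [← h2, pull_coord hε g hx', zero_add]
    · rw [z₂ hx', hg.eq_zero_of_notMem hl (by simp [hx, hx']), add_zero]

include hε hα₁ hα₂ hC₁ hκ₁ hC₂ hκ₂ he₁ he₂ hεA₁ hεA₂ hdisj hK₁ hK₂ hK₁₁ hK₂₂ in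
theorem pair_eigen_of_mult {j : ℕ} (hj : j < J) {lam c d : ℂ} (hcd : ν₁ j * c = lam * d)
    (hdc : ν₂ j * d = lam * c) :
    IsKernelEigen volume (blockKernel (disk ε A₁ p₁ ∪ disk ε A₂ p₂) fun y x => K x y) lam
      (fun x => c * (e₁ j (coord ε p₁ x) : ℂ) + d * (e₂ j (coord ε p₂ x) : ℂ)) := by
  obtain ⟨m₁, D₁, hD₁⟩ := he₁.bounded_coord hC₁ hκ₁ hj ε p₁
  obtain ⟨m₂, D₂, hD₂⟩ := he₂.bounded_coord hC₂ hκ₂ hj ε p₂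
  have z₁ : ∀ x ∉ disk ε A₁ p₁, e₁ j (coord ε p₁ x) = 0 := fun x hx =>
    he₁.support j hj _ (not_le.1 hx)
  have z₂ : ∀ x ∉ disk ε A₂ p₂, e₂ j (coord ε p₂ x) = 0 := fun x hx =>
    he₂.support j hj _ (not_le.1 hx)
  refine ⟨(m₁.const_mul c).add (m₂.const_mul d), ⟨‖c‖ * D₁ + ‖d‖ * D₂, fun x => ?_⟩, fun y => ?_⟩
  · refine (norm_add_le _ _).trans ?_
    rw [norm_mul, norm_mul]
    gcongr
    exacts [hD₁ x, hD₂ x]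
  have q : ∀ (ε A α w a b : ℝ) (p : S1) (ν : ℕ → ℝ) (e e' : ℕ → ℝ → ℝ) (c u : ℂ)
      (g : S1 → ℂ) (t : ℝ), pull ε A p g = (fun t => c * (e j t : ℂ)) →
      blockOp J α A w a b M ν e e' (fun t => (e j t : ℂ)) t = u →
      blockOp J α A w a b M ν e e' (pull ε A p g) t = c * u := by
    intro ε A α w a b p ν e e' c u g t h1 h2
    rw [h1, ← h2, blockOp, blockOp, ← integral_const_mul]
    exact integral_congr_ae (ae_of_all _ fun x => mul_left_comm _ _ _)
  have r₁ : pull ε A₁ p₁ (fun x => c * (e₁ j (coord ε p₁ x) : ℂ) + d * (e₂ j (coord ε p₂ x) : ℂ))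
      = fun t => c * (e₁ j t : ℂ) := by
    funext t
    by_cases ht : |t| ≤ A₁
    · have hx : p₁ + ((ε * t : ℝ) : S1) ∈ disk ε A₁ p₁ := by
        rw [disk, Set.mem_ofPred_eq, coord_add hε hεA₁ ht]; exact ht
      rw [pull_apply _ ht, coord_add hε hεA₁ ht, z₂ _ (Set.disjoint_left.1 hdisj hx)]
      simp
    · rw [pull_eq_zero _ (not_le.1 ht), he₁.support j hj t (not_le.1 ht)]; simp
  have r₂ : pull ε A₂ p₂ (fun x => c * (e₁ j (coord ε p₁ x) : ℂ) + d * (e₂ j (coord ε p₂ x) : ℂ))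
      = fun t => d * (e₂ j t : ℂ) := by
    funext t
    by_cases ht : |t| ≤ A₂
    · have hx : p₂ + ((ε * t : ℝ) : S1) ∈ disk ε A₂ p₂ := by
        rw [disk, Set.mem_ofPred_eq, coord_add hε hεA₂ ht]; exact ht
      rw [pull_apply _ ht, coord_add hε hεA₂ ht, z₁ _ (Set.disjoint_right.1 hdisj hx)]
      simp
    · rw [pull_eq_zero _ (not_le.1 ht), he₂.support j hj t (not_le.1 ht)]; simp
  by_cases hy : y ∈ disk ε A₁ p₁
  · rw [kerInt_pair_left hε hεA₂ hK₂ hK₁₁ hy, q _ _ _ _ _ _ _ _ _ _ _ _ _ _ r₂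
      (he₂.blockOp_self hα₂ hC₂ hκ₂ hj _), z₂ y (Set.disjoint_left.1 hdisj hy)]
    push_cast
    linear_combination (e₁ j (coord ε p₁ y) : ℂ) * hdc
  · rw [z₁ y hy]
    by_cases hy' : y ∈ disk ε A₂ p₂
    · rw [kerInt_pair_right hε hεA₁ hK₁ hK₂₂ hy', q _ _ _ _ _ _ _ _ _ _ _ _ _ _ r₁
        (he₁.blockOp_self hα₁ hC₁ hκ₁ hj _)]
      push_cast
      linear_combination (e₂ j (coord ε p₂ y) : ℂ) * hcd
    · rw [z₂ y hy']
      simp [kerInt, blockKernel, hy, hy']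

end Pair

end DiskSpectrum

/-! ### Block triangular kernels: localisation of eigenfunctions and eigendensities. -/

section Decomposition

theorem blockKernel_swap {X : Type*} (A : Set X) (K : X → X → ℝ) :
    (fun x y => blockKernel A K y x) = blockKernel A fun x y => K y x := by
  funext x y
  simp only [blockKernel]
  ring

variable {X : Type*} [MeasurableSpace X] {μ : Measure X}

/-- A kernel that only leaves, and never enters, the sets `U₁` and `U₂`, never leaves the set `V`,
and has no long chains outside of the three sets. -/
structure IsRepellerAttractor (K : X → X → ℝ) (U₁ U₂ V : Set X) : Prop where
  kernel : IsBddKernel K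
  meas₁ : MeasurableSet U₁
  meas₂ : MeasurableSet U₂
  measV : MeasurableSet V
  disj : Disjoint U₁ U₂
  disj₁ : Disjoint U₁ V
  disj₂ : Disjoint U₂ V
  into₁ : ∀ x ∉ U₁, ∀ y ∈ U₁, K x y = 0
  into₂ : ∀ x ∉ U₂, ∀ y ∈ U₂, K x y = 0
  outV : ∀ x ∈ V, ∀ y ∉ V, K x y = 0
  chain : ∃ n : ℕ, ∀ c : ℕ → X, (∀ i ≤ n, c i ∉ U₁ ∧ c i ∉ U₂ ∧ c i ∉ V) →
    ∃ i < n, K (c i) (c (i + 1)) = 0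

/-- `ν` lists the eigenvalues of modulus greater than `r`, with eigenfunctions `e`. -/
structure HasEigenSystem (μ : Measure X) (K : X → X → ℝ) (r : ℝ) (J : ℕ) (ν : ℕ → ℝ)
    (e : ℕ → X → ℝ) : Prop where
  expansion : ∀ (lam : ℂ) (φ : X → ℂ), r < ‖lam‖ → IsKernelEigen μ K lam φ →
    ∃ c : ℕ → ℂ, (∀ x, φ x = ∑ j ∈ Finset.range J, c j * (e j x : ℂ)) ∧
      ∀ j < J, ν j * c j = lam * c j
  eigen : ∀ j < J, IsKernelEigen μ K (ν j) fun x => (e j x : ℂ)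
  ne_zero : ∀ j < J, ∃ x, e j x ≠ 0

/-- The kernel acts by the matrices with zero diagonal and off-diagonal entries `ν₁ j`, `ν₂ j` on
the span of `e₁ j` and `e₂ j`, and has no other eigenvalues of modulus greater than `r`. -/
structure HasPairSystem (μ : Measure X) (K : X → X → ℝ) (r : ℝ) (J : ℕ) (ν₁ ν₂ : ℕ → ℝ)
    (e₁ e₂ : ℕ → X → ℝ) : Prop where
  expansion : ∀ (lam : ℂ) (g : X → ℂ), r < ‖lam‖ → IsKernelEigen μ K lam g →
    ∃ c d : ℕ → ℂ, (∀ x, g x = ∑ j ∈ Finset.range J, (c j * (e₁ j x : ℂ) + d j * (e₂ j x : ℂ))) ∧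
      (∀ j < J, ν₁ j * c j = lam * d j) ∧ ∀ j < J, ν₂ j * d j = lam * c j
  eigen : ∀ j < J, ∀ lam c d : ℂ, ν₁ j * c = lam * d → ν₂ j * d = lam * c →
    IsKernelEigen μ K lam fun x => c * (e₁ j x : ℂ) + d * (e₂ j x : ℂ)
  ne_zero : ∀ j < J, ∃ x, e₁ j x ≠ 0 ∧ e₂ j x = 0

/-- Composing the two relations shows that nonzero coefficients of index `j` require `lam ^ 2 = ν₁ j
* ν₂ j`. -/
theorem HasPairSystem.eq_zero {K : X → X → ℝ} {r : ℝ} {J : ℕ} {ν₁ ν₂ : ℕ → ℝ} {e₁ e₂ : ℕ → X → ℝ}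
    (h : HasPairSystem μ K r J ν₁ ν₂ e₁ e₂) {lam : ℂ} (hl : r < ‖lam‖) (hl0 : lam ≠ 0)
    (hne : ∀ j < J, lam ^ 2 ≠ ν₁ j * ν₂ j) {g : X → ℂ} (hg : IsKernelEigen μ K lam g) : g = 0 := by
  obtain ⟨c, d, h1, h2, h3⟩ := h.expansion lam g hl hg
  funext x
  rw [h1]
  refine Finset.sum_eq_zero fun j hj => ?_
  have hj := Finset.mem_range.1 hj
  have hc : c j = 0 := by
    have : (lam ^ 2 - ν₁ j * ν₂ j) * c j = 0 := by
      linear_combination (-(lam : ℂ)) * h3 j hj - (ν₂ j : ℂ) * h2 j hj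
    exact (mul_eq_zero.1 this).resolve_left (sub_ne_zero.2 (hne j hj))
  have hd : d j = 0 := by
    have := h2 j hj
    rw [hc, mul_zero] at this
    exact (mul_eq_zero.1 this.symm).resolve_left hl0
  rw [hc, hd]; simp

theorem HasEigenSystem.eq_single {K : X → X → ℝ} {r : ℝ} {J : ℕ} {ν : ℕ → ℝ} {e : ℕ → X → ℝ}
    (h : HasEigenSystem μ K r J ν e) {j : ℕ} (hj : j < J) (hr : r < |ν j|)
    (hinj : ∀ i < J, i ≠ j → ν i ≠ ν j) {φ : X → ℂ} (hφ : IsKernelEigen μ K (ν j) φ) :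
    ∃ a : ℂ, ∀ x, φ x = a * (e j x : ℂ) := by
  obtain ⟨c, h1, h2⟩ := h.expansion _ φ (by rwa [Complex.norm_real]) hφ
  refine ⟨c j, fun x => ?_⟩
  rw [h1]
  refine Finset.sum_eq_single_of_mem j (Finset.mem_range.2 hj) fun i hi hij => ?_
  have hi := Finset.mem_range.1 hi
  have : ((ν i : ℂ) - ν j) * c i = 0 := by linear_combination h2 i hi
  rw [(mul_eq_zero.1 this).resolve_left (sub_ne_zero.2 (by exact_mod_cast hinj i hi hij)), zero_mul]

theorem HasEigenSystem.eq_zero {K : X → X → ℝ} {r : ℝ} {J : ℕ} {ν : ℕ → ℝ} {e : ℕ → X → ℝ}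
    (h : HasEigenSystem μ K r J ν e) {lam : ℂ} (hl : r < ‖lam‖)
    (hne : ∀ j < J, lam ≠ ν j) {φ : X → ℂ} (hφ : IsKernelEigen μ K lam φ) : φ = 0 := by
  obtain ⟨c, h1, h2⟩ := h.expansion lam φ hl hφ
  funext x
  rw [h1]
  refine Finset.sum_eq_zero fun i hi => ?_
  have hi := Finset.mem_range.1 hi
  have : (lam - ν i) * c i = 0 := by linear_combination -h2 i hi
  rw [(mul_eq_zero.1 this).resolve_left (sub_ne_zero.2 (hne i hi)), zero_mul]

/-- The spectral data of a kernel of repeller-attractor type. -/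
structure HasSplitSpectrum (μ : Measure X) (K : X → X → ℝ) (U₁ U₂ V : Set X) (r : ℝ) (J : ℕ)
    (νs νu ν₁ ν₂ : ℕ → ℝ) (es eu e₁ e₂ : ℕ → X → ℝ) : Prop where
  split : IsRepellerAttractor K U₁ U₂ V
  pos : 0 < r
  sys_s : HasEigenSystem μ (blockKernel U₁ K) r J νs es
  sys_u : HasEigenSystem μ (blockKernel U₂ K) r J νu eu
  sys_V : HasPairSystem μ (blockKernel V fun y x => K x y) r J ν₁ ν₂ e₁ e₂
  inj_s : ∀ i < J, ∀ j < J, i ≠ j → νs i ≠ νs j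
  inj_u : ∀ i < J, ∀ j < J, i ≠ j → νu i ≠ νu j
  inj_V : ∀ i < J, ∀ j < J, i ≠ j → ν₁ i * ν₂ i ≠ 0 → ν₁ i * ν₂ i ≠ ν₁ j * ν₂ j
  ne_su : ∀ i < J, ∀ j < J, νs i ≠ νu j
  ne_sV : ∀ i < J, ∀ j < J, νs i ^ 2 ≠ ν₁ j * ν₂ j
  ne_uV : ∀ i < J, ∀ j < J, νu i ^ 2 ≠ ν₁ j * ν₂ j

variable {K : X → X → ℝ} {U₁ U₂ V : Set X}
  {r : ℝ} {J : ℕ} {νs νu ν₁ ν₂ : ℕ → ℝ} {es eu e₁ e₂ : ℕ → X → ℝ}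

theorem HasSplitSpectrum.swap (h : HasSplitSpectrum μ K U₁ U₂ V r J νs νu ν₁ ν₂ es eu e₁ e₂) :
    HasSplitSpectrum μ K U₂ U₁ V r J νu νs ν₁ ν₂ eu es e₁ e₂ where
  split := ⟨h.split.kernel, h.split.meas₂, h.split.meas₁, h.split.measV, h.split.disj.symm,
    h.split.disj₂, h.split.disj₁, h.split.into₂, h.split.into₁, h.split.outV, by
      obtain ⟨n, hn⟩ := h.split.chain
      exact ⟨n, fun c hc => hn c fun i hi => ⟨(hc i hi).2.1, (hc i hi).1, (hc i hi).2.2⟩⟩⟩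
  pos := h.pos
  sys_s := h.sys_u
  sys_u := h.sys_s
  sys_V := h.sys_V
  inj_s := h.inj_u
  inj_u := h.inj_s
  inj_V := h.inj_V
  ne_su := fun i hi j hj => (h.ne_su j hj i hi).symm
  ne_sV := h.ne_uV
  ne_uV := h.ne_sV

theorem HasSplitSpectrum.exists_right
    (h : HasSplitSpectrum μ K U₁ U₂ V r J νs νu ν₁ ν₂ es eu e₁ e₂) {j : ℕ} (hj : j < J)
    (hl : νs j ≠ 0) : ∃ φ ≠ 0, IsKernelEigen μ K (νs j) φ := by
  refine ⟨fun x => (es j x : ℂ), fun h0 => ?_,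
    (h.sys_s.eigen j hj).of_block (by exact_mod_cast hl) h.split.into₁⟩
  obtain ⟨x, hx⟩ := h.sys_s.ne_zero j hj
  exact hx (by simpa using congrFun h0 x)

theorem HasSplitSpectrum.exists_left
    (h : HasSplitSpectrum μ K U₁ U₂ V r J νs νu ν₁ ν₂ es eu e₁ e₂) {j : ℕ} (hj : j < J) {lam : ℂ}
    (hl0 : lam ≠ 0) (hlam : lam ^ 2 = ν₁ j * ν₂ j) :
    ∃ g ≠ 0, IsKernelEigen μ (fun y x => K x y) lam g := by
  -- The vector `(lam, ν₁ j)` solves both coefficient relations. It gives a nonzero density since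
  -- `lam ≠ 0` and `e₁ j` is nonzero somewhere off the support of `e₂ j`.
  refine ⟨fun x => lam * (e₁ j x : ℂ) + (ν₁ j : ℂ) * (e₂ j x : ℂ), fun h0 => ?_,
    (h.sys_V.eigen j hj lam lam (ν₁ j) (mul_comm _ _) (by rw [← sq, hlam, mul_comm])).of_block hl0
      fun x hx y hy => h.split.outV y hy x hx⟩
  obtain ⟨x, hx, hx'⟩ := h.sys_V.ne_zero j hj
  have := congrFun h0 x
  simp [hx', hl0, hx] at this

variable [IsFiniteMeasure μ]

/-- The kernel never leaves `V`, so the restriction of `φ` to `V` is an eigenfunction of that block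
and vanishes. From outside the three sets the kernel leads only to `V` or stays outside, without
long chains, so `φ` vanishes there too. What remains splits because neither repelling set is entered
from the other. -/
theorem IsRepellerAttractor.right_support (h : IsRepellerAttractor K U₁ U₂ V) {lam : ℂ}
    (hl : lam ≠ 0)
    (hV : ∀ ψ, IsKernelEigen μ (blockKernel V fun y x => K x y) lam ψ → ψ = 0) {φ : X → ℂ}
    (hφ : IsKernelEigen μ K lam φ) :
    (∀ x, φ x = U₁.indicator φ x + U₂.indicator φ x) ∧
    IsKernelEigen μ (blockKernel U₁ K) lam (U₁.indicator φ) ∧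
    IsKernelEigen μ (blockKernel U₂ K) lam (U₂.indicator φ) := by
  -- The attractor block is understood through its densities; the Fredholm alternative transfers the
  -- absence of `lam` to functions.
  have hVr : ∀ ψ, IsKernelEigen μ (blockKernel V K) lam ψ → ψ = 0 := by
    intro ψ hψ
    by_contra hne
    have h1 : IsBddKernel (blockKernel V fun y x => K x y) := h.kernel.swap.block h.measV
    obtain ⟨χ, hχ, h2⟩ := exists_eigen_of_transpose h1 hl (g := ψ)
      (by rw [blockKernel_swap]; exact hψ) hne
    exact hχ (hV χ h2)
  obtain ⟨n, hn⟩ := h.chain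
  have hz : ∀ x, x ∉ U₁ ∪ U₂ → φ x = 0 := by
    refine hφ.eq_zero_of_triangular hl (S := V) (W := (U₁ ∪ U₂ ∪ V)ᶜ) h.measV ?_ h.outV hVr ?_
      (n := n) ?_
    · intro x
      by_cases h1 : x ∈ U₁ ∪ U₂
      · exact Or.inr (Or.inr h1)
      · by_cases h2 : x ∈ V
        · exact Or.inl h2
        · exact Or.inr (Or.inl fun h3 => h3.elim h1 h2)
    · intro x hx y hxy
      by_cases h2 : y ∈ V
      · exact Or.inl h2
      · refine Or.inr fun h3 => h3.elim (fun h4 => h4.elim (fun h5 => ?_) fun h5 => ?_) h2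
        · exact hxy (h.into₁ x (fun h6 => hx (Or.inl (Or.inl h6))) y h5)
        · exact hxy (h.into₂ x (fun h6 => hx (Or.inl (Or.inr h6))) y h5)
    · intro c hc
      exact hn c fun i hi => ⟨fun h1 => hc i hi (Or.inl (Or.inl h1)),
        fun h1 => hc i hi (Or.inl (Or.inr h1)), fun h1 => hc i hi (Or.inr h1)⟩
  refine ⟨fun x => ?_, hφ.indicator h.meas₁ ?_, hφ.indicator h.meas₂ ?_⟩
  · by_cases h1 : x ∈ U₁
    · simp [h1, Set.disjoint_left.1 h.disj h1]
    · by_cases h2 : x ∈ U₂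
      · simp [h1, h2]
      · simp [h1, h2, hz x (fun h3 => h3.elim h1 h2)]
  · intro x hx y hy hy0
    by_cases h2 : y ∈ U₂
    · exact h.into₂ x (Set.disjoint_left.1 h.disj hx) y h2
    · exact absurd (hz y fun h3 => h3.elim hy h2) hy0
  · intro x hx y hy hy0
    by_cases h2 : y ∈ U₁
    · exact h.into₁ x (Set.disjoint_right.1 h.disj hx) y h2
    · exact absurd (hz y fun h3 => h3.elim h2 hy) hy0

/-- The mirror image of `right_support`: for the transposed kernel the repelling sets are the closed
ones, and a density is pushed into `V`. -/
theorem IsRepellerAttractor.left_support (h : IsRepellerAttractor K U₁ U₂ V) {lam : ℂ}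
    (hl : lam ≠ 0) (hU₁ : ∀ ψ, IsKernelEigen μ (blockKernel U₁ K) lam ψ → ψ = 0)
    (hU₂ : ∀ ψ, IsKernelEigen μ (blockKernel U₂ K) lam ψ → ψ = 0) {g : X → ℂ}
    (hg : IsKernelEigen μ (fun y x => K x y) lam g) :
    IsKernelEigen μ (blockKernel V fun y x => K x y) lam g := by
  have hUm : MeasurableSet (U₁ ∪ U₂) := h.meas₁.union h.meas₂
  have hU : ∀ ψ, IsKernelEigen μ (blockKernel (U₁ ∪ U₂) K) lam ψ → ψ = 0 := by
    intro ψ hψ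
    have hsub : ∀ A ⊆ U₁ ∪ U₂, blockKernel A (blockKernel (U₁ ∪ U₂) K) = blockKernel A K := by
      intro A hA
      funext x y
      by_cases hx : x ∈ A
      · by_cases hy : y ∈ A
        · simp [blockKernel, hx, hy, -Set.mem_union, hA hx, hA hy]
        · simp [blockKernel, hy]
      · simp [blockKernel, hx]
    have h1 := hψ.indicator h.meas₁ (by
      intro x hx y hy _
      by_cases h2 : y ∈ U₂
      · simp [blockKernel, h.into₂ x (Set.disjoint_left.1 h.disj hx) y h2]
      · simp [blockKernel, hy, h2])
    have h2 := hψ.indicator h.meas₂ (by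
      intro x hx y hy _
      by_cases h2 : y ∈ U₁
      · simp [blockKernel, h.into₁ x (Set.disjoint_right.1 h.disj hx) y h2]
      · simp [blockKernel, hy, h2])
    rw [hsub _ Set.subset_union_left] at h1
    rw [hsub _ Set.subset_union_right] at h2
    have h3 := congrFun (hU₁ _ h1)
    have h4 := congrFun (hU₂ _ h2)
    funext x
    by_cases hx : x ∈ U₁
    · simpa [hx] using h3 x
    · by_cases hx' : x ∈ U₂
      · simpa [hx'] using h4 x
      · exact hψ.eq_zero_of_notMem hl (by simp [hx, hx'])
  have hUl : ∀ ψ, IsKernelEigen μ (blockKernel (U₁ ∪ U₂) fun y x => K x y) lam ψ → ψ = 0 := by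
    intro ψ hψ
    by_contra hne
    obtain ⟨χ, hχ, h2⟩ := exists_eigen_of_transpose (h.kernel.block hUm) hl (g := ψ)
      (by rw [blockKernel_swap]; exact hψ) hne
    exact hχ (hU χ h2)
  obtain ⟨n, hn⟩ := h.chain
  have hz : ∀ x, x ∉ V → g x = 0 := by
    refine hg.eq_zero_of_triangular hl (S := U₁ ∪ U₂) (W := (U₁ ∪ U₂ ∪ V)ᶜ) hUm ?_ ?_ hUl ?_
      (n := n) ?_
    · intro x
      by_cases h1 : x ∈ U₁ ∪ U₂
      · exact Or.inl h1
      · by_cases h2 : x ∈ V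
        · exact Or.inr (Or.inr h2)
        · exact Or.inr (Or.inl fun h3 => h3.elim h1 h2)
    · rintro x (hx | hx) y hy
      · exact h.into₁ y (fun h1 => hy (Or.inl h1)) x hx
      · exact h.into₂ y (fun h1 => hy (Or.inr h1)) x hx
    · intro x hx y hxy
      by_cases h1 : y ∈ U₁ ∪ U₂
      · exact Or.inl h1
      · exact Or.inr fun h3 => h3.elim h1 fun h4 => hxy (h.outV y h4 x fun h5 => hx (Or.inr h5))
    · intro c hc
      -- Chains of the transposed kernel are chains of the kernel run backwards.
      obtain ⟨i, hi, h1⟩ := hn (fun i => c (n - i)) fun i hi => by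
        have := hc (n - i) (Nat.sub_le n i)
        exact ⟨fun h1 => this (Or.inl (Or.inl h1)), fun h1 => this (Or.inl (Or.inr h1)),
          fun h1 => this (Or.inr h1)⟩
      refine ⟨n - (i + 1), by omega, ?_⟩
      have h2 : n - (i + 1) + 1 = n - i := by omega
      rw [h2]
      exact h1
  have h1 := hg.indicator h.measV fun x hx y hy hy0 => absurd (hz y hy) hy0
  rwa [Set.indicator_eq_self.2 fun x hx => by_contra fun h2 => hx (hz x h2)] at h1

theorem HasSplitSpectrum.exists_of_ne
    (h : HasSplitSpectrum μ K U₁ U₂ V r J νs νu ν₁ ν₂ es eu e₁ e₂) {lam : ℂ} (hl : r < ‖lam‖)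
    (hne : ∀ j < J, lam ^ 2 ≠ ν₁ j * ν₂ j) {φ : X → ℂ} (hφ : IsKernelEigen μ K lam φ)
    (hφ0 : φ ≠ 0) : (∃ j < J, lam = νs j) ∨ ∃ j < J, lam = νu j := by
  have hl0 : lam ≠ 0 := norm_pos_iff.1 (h.pos.trans hl)
  obtain ⟨h1, h2, h3⟩ := h.split.right_support hl0 (fun ψ hψ => h.sys_V.eq_zero hl hl0 hne hψ) hφ
  by_contra! hcon
  refine hφ0 (funext fun x => ?_)
  rw [h1, h.sys_s.eq_zero hl hcon.1 h2, h.sys_u.eq_zero hl hcon.2 h3]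
  simp

/-- The three kinds of separation act here: `ne_sV` removes the attractor, `ne_su` the other
repeller, and `inj_s` the remaining modes of the same repeller. -/
theorem HasSplitSpectrum.right_eq
    (h : HasSplitSpectrum μ K U₁ U₂ V r J νs νu ν₁ ν₂ es eu e₁ e₂) {j : ℕ} (hj : j < J)
    (hl : r < |νs j|) {φ : X → ℂ} (hφ : IsKernelEigen μ K (νs j) φ) :
    ∃ a : ℂ, ∀ x, φ x = a * (es j x : ℂ) := by
  have hl' : r < ‖((νs j : ℝ) : ℂ)‖ := by rwa [Complex.norm_real]
  have hl0 : ((νs j : ℝ) : ℂ) ≠ 0 := norm_pos_iff.1 (h.pos.trans hl')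
  obtain ⟨h1, h2, h3⟩ := h.split.right_support hl0 (fun ψ hψ => h.sys_V.eq_zero hl' hl0
    (fun i hi => by exact_mod_cast h.ne_sV j hj i hi) hψ) hφ
  obtain ⟨a, ha⟩ := h.sys_s.eq_single hj hl (fun i hi hij => h.inj_s i hi j hj hij) h2
  refine ⟨a, fun x => ?_⟩
  rw [h1, ha, h.sys_u.eq_zero hl' (fun i hi => by exact_mod_cast h.ne_su j hj i hi) h3]
  simp

theorem HasSplitSpectrum.left_eq
    (h : HasSplitSpectrum μ K U₁ U₂ V r J νs νu ν₁ ν₂ es eu e₁ e₂) {j : ℕ} (hj : j < J) {lam : ℂ}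
    (hl : r < ‖lam‖) (hlam : lam ^ 2 = ν₁ j * ν₂ j) {g : X → ℂ}
    (hg : IsKernelEigen μ (fun y x => K x y) lam g) :
    ∃ c d : ℂ, ∀ x, g x = c * (e₁ j x : ℂ) + d * (e₂ j x : ℂ) := by
  have hl0 : lam ≠ 0 := norm_pos_iff.1 (h.pos.trans hl)
  have h1 := h.split.left_support hl0
    (fun ψ hψ => h.sys_s.eq_zero hl (fun i hi h2 => h.ne_sV i hi j hj (by
      rw [h2] at hlam; exact_mod_cast hlam)) hψ)
    (fun ψ hψ => h.sys_u.eq_zero hl (fun i hi h2 => h.ne_uV i hi j hj (by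
      rw [h2] at hlam; exact_mod_cast hlam)) hψ) hg
  obtain ⟨c, d, h2, h3, h4⟩ := h.sys_V.expansion lam g hl h1
  refine ⟨c j, d j, fun x => ?_⟩
  rw [h2]
  refine Finset.sum_eq_single_of_mem j (Finset.mem_range.2 hj) fun i hi hij => ?_
  have hi := Finset.mem_range.1 hi
  have hne : lam ^ 2 ≠ ν₁ i * ν₂ i := by
    rw [hlam]
    -- Products may coincide at zero when an orbit derivative vanishes; this is harmless because
    -- `lam ≠ 0`.
    have h5 : ν₁ j * ν₂ j ≠ 0 := by
      intro h6
      have h7 : lam ^ 2 = 0 := by rw [hlam]; exact_mod_cast h6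
      exact hl0 (pow_eq_zero_iff two_ne_zero |>.1 h7)
    exact_mod_cast h.inj_V j hj i hi hij.symm h5
  have hc : c i = 0 := by
    have : (lam ^ 2 - ν₁ i * ν₂ i) * c i = 0 := by
      linear_combination (-(lam : ℂ)) * h4 i hi - (ν₂ i : ℂ) * h3 i hi
    exact (mul_eq_zero.1 this).resolve_left (sub_ne_zero.2 hne)
  have hd : d i = 0 := by
    have := h3 i hi
    rw [hc, mul_zero] at this
    exact (mul_eq_zero.1 this.symm).resolve_left hl0
  rw [hc, hd]; simp

end Decomposition

/-! ### Kernel operators on bounded measurable functions. -/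

section KernelOperator

variable {K : S1 → S1 → ℝ}

theorem BddMeas.integrable (φ : BddMeas) : Integrable (fun x => φ x) (volume : Measure S1) :=
  Integrable.of_bound (BddMeas.measurable φ).aestronglyMeasurable ‖φ‖ (ae_of_all _ (BddMeas.norm_apply_le φ))

theorem IsBddKernel.norm_kerInt_bddMeas_le {C : ℝ} (hC : ∀ x y, |K x y| ≤ C) (φ : BddMeas)
    (x : S1) : ‖kerInt volume K φ x‖ ≤ C * (volume : Measure S1).real Set.univ * ‖φ‖ := by
  have hC0 : 0 ≤ C := (abs_nonneg _).trans (hC x x)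
  refine (IsBddKernel.norm_kerInt_le hC (BddMeas.integrable φ) x).trans ?_
  rw [mul_assoc]
  refine mul_le_mul_of_nonneg_left ?_ hC0
  refine (integral_mono (BddMeas.integrable φ).norm (integrable_const ‖φ‖) (BddMeas.norm_apply_le φ)).trans ?_
  rw [integral_const, smul_eq_mul]

/-- The operator on `B(S¹)` with a bounded kernel. -/
noncomputable def kernelOp (hK : IsBddKernel K) : BddMeas →L[ℂ] BddMeas :=
  LinearMap.mkContinuous
    { toFun := fun φ => BddMeas.mk (kerInt volume K φ) (hK.measurable_kerInt (BddMeas.measurable φ))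
        (hK.bdd.choose * (volume : Measure S1).real Set.univ * ‖φ‖)
        (IsBddKernel.norm_kerInt_bddMeas_le hK.bdd.choose_spec φ)
      map_add' := by
        intro φ ψ
        apply Subtype.ext
        apply Subtype.ext
        funext x
        refine Eq.trans (integral_congr_ae (ae_of_all _ fun y => mul_add _ _ _)) ?_
        exact integral_add (hK.integrable_mul (BddMeas.integrable φ) x) (hK.integrable_mul (BddMeas.integrable ψ) x)
      map_smul' := by
        intro c φ
        apply Subtype.ext
        apply Subtype.ext
        funext x
        refine Eq.trans (integral_congr_ae (ae_of_all _ fun y => mul_left_comm _ _ _)) ?_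
        exact integral_const_mul c _ }
    (hK.bdd.choose * (volume : Measure S1).real Set.univ) (by
      intro φ
      have h := IsBddKernel.norm_kerInt_bddMeas_le hK.bdd.choose_spec φ
      exact lp.norm_le_of_forall_le ((norm_nonneg _).trans (h 0)) h)

theorem kernelOp_apply (hK : IsBddKernel K) (φ : BddMeas) (x : S1) :
    kernelOp hK φ x = kerInt volume K φ x := rfl

theorem transitionOp_apply (f : C(S1, S1)) (σ : C(S1, ℝ)) (ε : ℝ) (φ : BddMeas) (x : S1) :
    transitionOp f σ ε φ x = stepMean f σ ε φ x := rfl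

theorem isKernelEigen_of_hasEigenvector (hK : IsBddKernel K) {lam : ℂ} {φ : BddMeas}
    (h : Module.End.HasEigenvector (kernelOp hK : BddMeas →ₗ[ℂ] BddMeas) lam φ) :
    IsKernelEigen volume K lam φ ∧ (fun x => φ x) ≠ 0 := by
  refine ⟨⟨(BddMeas.measurable φ), ⟨‖φ‖, (BddMeas.norm_apply_le φ)⟩, fun x => ?_⟩, fun h0 => ?_⟩
  · have := h.apply_eq_smul
    exact congrFun (congrArg (fun ψ : BddMeas => (fun x => ψ x)) this) x
  · exact h.2 (Subtype.ext (Subtype.ext h0))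

theorem hasEigenvalue_of_isKernelEigen (hK : IsBddKernel K) {lam : ℂ} {φ : S1 → ℂ}
    (h : IsKernelEigen volume K lam φ) (h0 : φ ≠ 0) :
    Module.End.HasEigenvalue (kernelOp hK : BddMeas →ₗ[ℂ] BddMeas) lam := by
  obtain ⟨C, hC⟩ := h.bdd
  refine Module.End.hasEigenvalue_of_hasEigenvector (x := BddMeas.mk φ h.measurable C hC) ⟨?_, ?_⟩
  · rw [Module.End.mem_eigenspace_iff]
    apply Subtype.ext
    apply Subtype.ext
    funext x
    exact h.eigen x
  · intro h1
    exact h0 (congrArg (fun ψ : BddMeas => (fun x => ψ x)) h1)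

theorem exists_isKernelEigen_of_hasEigenvalue (hK : IsBddKernel K) {lam : ℂ}
    (h : Module.End.HasEigenvalue (kernelOp hK : BddMeas →ₗ[ℂ] BddMeas) lam) :
    ∃ φ ≠ 0, IsKernelEigen volume K lam φ := by
  obtain ⟨φ, hφ⟩ := h.exists_hasEigenvector
  obtain ⟨h1, h2⟩ := isKernelEigen_of_hasEigenvector hK hφ
  exact ⟨_, h2, h1⟩

theorem isEigendensity_of_isKernelEigen (hK : IsBddKernel K) {lam : ℂ} (hl : lam ≠ 0) {g : S1 → ℂ}
    (h : IsKernelEigen volume (fun y x => K x y) lam g) (h0 : g ≠ 0) :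
    IsEigendensity (kernelOp hK) lam g where
  integrable := h.integrable
  ne_zero := fun h1 => h0 (h.eq_zero_of_ae hl h1)
  eigen := by
    intro φ
    refine (integral_kerInt_mul_comm hK (BddMeas.integrable φ) h.integrable).trans ?_
    rw [← integral_const_mul]
    refine integral_congr_ae (ae_of_all _ fun y => ?_)
    simp only
    rw [h.eigen y]
    ring

/-- Testing the weak equation on indicators of measurable sets turns it into an equation almost
everywhere for the transposed kernel. -/
theorem exists_isKernelEigen_of_isEigendensity (hK : IsBddKernel K) {lam : ℂ} (hl : lam ≠ 0)
    {g : S1 → ℂ} (h : IsEigendensity (kernelOp hK) lam g) :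
    ∃ ψ, IsKernelEigen volume (fun y x => K x y) lam ψ ∧ ψ =ᵐ[volume] g := by
  refine exists_isKernelEigen_of_ae hK.swap hl h.integrable ?_
  have hint : Integrable (kerInt volume (fun y x => K x y) g) volume := by
    exact (hK.swap.memLp_kerInt h.integrable).integrable one_le_two
  refine (hint.ae_eq_of_forall_setIntegral_eq _ _ (h.integrable.const_mul lam) ?_)
  intro s hs _
  have h1 := h.eigen (BddMeas.mk (s.indicator 1) (measurable_one.indicator hs) 1 fun x =>
    (norm_indicator_le_norm_self _ _).trans (by simp))
  have h2 := integral_kerInt_mul_comm hK (φ := s.indicator 1) (μ := volume)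
    ((integrable_const (1 : ℂ)).indicator hs) h.integrable
  have h3 : ∀ G : S1 → ℂ, ∫ x, s.indicator (1 : S1 → ℂ) x * G x = ∫ x in s, G x := by
    intro G
    rw [← integral_indicator hs]
    refine integral_congr_ae (ae_of_all _ fun x => ?_)
    by_cases hx : x ∈ s <;> simp [hx]
  rw [h3] at h2
  rw [← h2, integral_const_mul, ← h3 g]
  exact h1

theorem isRealOp_kernelOp (hK : IsBddKernel K) : IsRealOp (kernelOp hK) := by
  intro φ hφ x
  have h1 : ∀ y, ((φ y).re : ℂ) = φ y := fun y => Complex.ext rfl (by simp [hφ y])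
  have h2 : kernelOp hK φ x = ((∫ y, K x y * (φ y).re : ℝ) : ℂ) := by
    rw [kernelOp_apply, kerInt, ← integral_complex_ofReal]
    refine integral_congr_ae (ae_of_all _ fun y => ?_)
    simp only
    rw [Complex.ofReal_mul, h1]
  rw [h2, Complex.ofReal_im]

theorem isRealOp_transitionOp (f : C(S1, S1)) (σ : C(S1, ℝ)) (ε : ℝ) :
    IsRealOp (transitionOp f σ ε) := by
  intro φ hφ x
  have h1 : ∀ y, ((φ y).re : ℂ) = φ y := fun y => Complex.ext rfl (by simp [hφ y])
  have h2 : transitionOp f σ ε φ x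
      = ((∫ z, (φ (noisyStep f σ ε x z)).re ∂(gaussianReal 0 1) : ℝ) : ℂ) := by
    rw [transitionOp_apply, stepMean, ← integral_complex_ofReal]
    refine integral_congr_ae (ae_of_all _ fun y => ?_)
    simp only
    rw [h1]
  rw [h2, Complex.ofReal_im]

theorem IsRealOp.sub {S T : BddMeas →L[ℂ] BddMeas} (hS : IsRealOp S) (hT : IsRealOp T) :
    IsRealOp (S - T) := by
  intro φ hφ x
  have : (S - T) φ x = S φ x - T φ x := rfl
  rw [this, Complex.sub_im, hS φ hφ x, hT φ hφ x, sub_zero]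

theorem norm_transitionOp_sub_le {f : C(S1, S1)} {σ : C(S1, ℝ)} {ε : ℝ} (hK : IsBddKernel K)
    {C : ℝ} (hC : 0 ≤ C)
    (h : ∀ (φ : BddMeas) x, ‖stepMean f σ ε φ x - kerInt volume K φ x‖ ≤ C * ‖φ‖) :
    ‖transitionOp f σ ε - kernelOp hK‖ ≤ C := by
  refine ContinuousLinearMap.opNorm_le_bound _ hC fun φ => ?_
  exact lp.norm_le_of_forall_le (mul_nonneg hC (norm_nonneg _)) (h φ)

end KernelOperator

/-! ### The coupling of noise level and truncation. -/

section Asymptotics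

/-- The noise level at which Gaussians are truncated at `M` standard deviations. -/
noncomputable def noiseLevel (M : ℝ) : ℝ := (M ^ 4)⁻¹

theorem noiseLevel_pos {M : ℝ} (hM : 0 < M) : 0 < noiseLevel M := by
  unfold noiseLevel; positivity

theorem eventually_pow_mul_exp_le (B : ℝ) (n : ℕ) {τ : ℝ} (hτ : 0 < τ) :
    ∀ᶠ M : ℝ in atTop, B * M ^ n * Real.exp (-M) ≤ τ := by
  have h := (Real.tendsto_pow_mul_exp_neg_atTop_nhds_zero n).const_mul B
  rw [mul_zero] at h
  filter_upwards [h.eventually (gt_mem_nhds hτ)] with M hM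
  rw [mul_assoc]; exact hM.le

/-- The arcs have radius `R M⁻³`: large compared with the noise but shrinking to points. -/
theorem eventually_noiseLevel_mul_le (R : ℝ) {δ : ℝ} (hδ : 0 < δ) :
    ∀ᶠ M : ℝ in atTop, noiseLevel M * (R * M) ≤ δ := by
  have h1 : Tendsto (fun M : ℝ => R * (M ^ 3)⁻¹) atTop (𝓝 0) := by
    have := ((tendsto_pow_atTop (α := ℝ) (n := 3) (by norm_num)).inv_tendsto_atTop).const_mul R
    rwa [mul_zero] at this
  filter_upwards [h1.eventually (gt_mem_nhds hδ), eventually_gt_atTop 0] with M h2 hM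
  refine le_trans (le_of_eq ?_) h2.le
  unfold noiseLevel
  field_simp

theorem disjoint_disk {ε A A' : ℝ} {p q : S1} (hε : 0 < ε) (h : ε * A + ε * A' < dist p q) :
    Disjoint (disk ε A p) (disk ε A' q) := by
  refine Set.disjoint_left.2 fun x hx hx' => ?_
  rw [mem_disk_iff hε] at hx hx'
  have := dist_triangle_left p q x
  linarith

theorem eventually_disjoint_disk {p q : S1} (h : p ≠ q) (R R' : ℝ) : ∀ᶠ M : ℝ in atTop,
    Disjoint (disk (noiseLevel M) (R * M) p) (disk (noiseLevel M) (R' * M) q) := by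
  have hd : 0 < dist p q := dist_pos.2 h
  filter_upwards [eventually_noiseLevel_mul_le R (δ := dist p q / 3) (by positivity),
    eventually_noiseLevel_mul_le R' (δ := dist p q / 3) (by positivity),
    eventually_gt_atTop 0] with M h1 h2 hM
  exact disjoint_disk (noiseLevel_pos hM) (by linarith)

end Asymptotics

/-! ### Total variation distance between rows of the kernels. -/

section Rows

variable {f : C(S1, S1)} {σ : C(S1, ℝ)}

/-- The transition density with truncated noise. -/
noncomputable def noiseKernel (f : S1 → S1) (σ : S1 → ℝ) (ε M : ℝ) (x y : S1) : ℝ :=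
  (ε * σ x)⁻¹ * cutG M (rep (y - f x) / (ε * σ x))

theorem exists_forall_le_and_pos (hσ : ∀ x, 0 < σ x) :
    ∃ s₀ > 0, ∃ s₁ > 0, ∀ x, s₀ ≤ σ x ∧ σ x ≤ s₁ := by
  obtain ⟨a, -, ha⟩ := isCompact_univ.exists_isMinOn (Set.univ_nonempty (α := S1))
    σ.continuous.continuousOn
  obtain ⟨b, -, hb⟩ := isCompact_univ.exists_isMaxOn (Set.univ_nonempty (α := S1))
    σ.continuous.continuousOn
  exact ⟨σ a, hσ a, σ b, hσ b, fun x => ⟨ha (Set.mem_univ x), hb (Set.mem_univ x)⟩⟩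

theorem measurable_translate {φ : S1 → ℂ} (hφ : Measurable φ) (q : S1) :
    Measurable fun t : ℝ => φ (q + (t : S1)) :=
  hφ.comp (continuous_const.add (AddCircle.continuous_mk' (2 * Real.pi))).measurable

theorem eventually_integral_cutG {τ : ℝ} (hτ : 0 < τ) :
    ∀ᶠ M : ℝ in atTop, 1 - ∫ u, cutG M u ≤ τ := by
  filter_upwards [tendsto_integral_cutG.eventually (lt_mem_nhds (by linarith : 1 - τ < 1))] with M h
  linarith

/-- The only loss is the Gaussian mass beyond `M` deviations, because the truncated noise reaches
less than half way around the circle. -/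
theorem eventually_noiseKernel_row (hσ : ∀ x, 0 < σ x) {τ : ℝ} (hτ : 0 < τ) :
    ∀ᶠ M : ℝ in atTop, ∀ (φ : BddMeas) (x : S1),
      ‖stepMean f σ (noiseLevel M) φ x
        - ∫ y, (noiseKernel f σ (noiseLevel M) M x y : ℂ) * φ y‖ ≤ τ * ‖φ‖ := by
  obtain ⟨s₀, -, s₁, hs₁, hs⟩ := exists_forall_le_and_pos hσ
  filter_upwards [eventually_integral_cutG hτ, eventually_gt_atTop 0,
    eventually_noiseLevel_mul_le s₁ (δ := 1) one_pos] with M h1 hM h2 φ x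
  have hε := noiseLevel_pos hM
  set ε := noiseLevel M
  have hh : 0 < ε * σ x := mul_pos hε (hσ x)
  have h3 := integral_cutG_rep (f x) (m := 0) (M := M) hh (by
    have : ε * σ x * M ≤ ε * (s₁ * M) := by
      rw [mul_assoc]; gcongr; exact (hs x).2
    rw [abs_zero]; linarith [Real.pi_gt_three]) φ
  simp only [sub_zero, zero_add] at h3
  unfold noiseKernel
  rw [h3, stepMean_eq]
  refine (norm_integral_stdG_sub_cutG_le (ψ := fun z => φ (f x + ((ε * σ x * z : ℝ) : S1)))
    ?_ (fun z => BddMeas.norm_apply_le φ _) M).trans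
    (mul_le_mul_of_nonneg_right h1 (norm_nonneg _))
  exact (measurable_translate (BddMeas.measurable φ) (f x)).comp (measurable_const_mul _)

/-- Near a point, a row of the transition kernel is close to that of the linearized kernel. -/
theorem eventually_local_row (hf : IsSmoothCircleMap f) (hσ : ∀ x, 0 < σ x) (p : S1)
    (R B : ℝ) (J : ℕ) {τ : ℝ} (hτ : 0 < τ) :
    ∀ᶠ M : ℝ in atTop, ∀ x ∈ disk (noiseLevel M) (R * M) p, ∀ k : S1 → ℝ, Measurable k →
      (∀ y, |k y - (noiseLevel M)⁻¹ * ((σ p)⁻¹ * cutG M ((coord (noiseLevel M) (f p) y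
        - circleDeriv f p * coord (noiseLevel M) p x) / σ p))|
        ≤ (noiseLevel M)⁻¹ * (B * M ^ J * Real.exp (-M))) →
      ∀ φ : BddMeas, ‖stepMean f σ (noiseLevel M) φ x - ∫ y, (k y : ℂ) * φ y‖ ≤ τ * ‖φ‖ := by
  obtain ⟨δ, hδ, hclose⟩ := exists_gaussian_close (η := τ / 3) (by positivity)
  obtain ⟨G, C, hC, hG, hGC⟩ := exists_local_expansion hf p
  set c := circleDeriv f p with hc
  set s := σ p with hs
  have hsp : 0 < s := hσ p
  obtain ⟨d, hd, hσd⟩ := Metric.continuousAt_iff.1 σ.continuous.continuousAt (δ * s)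
    (by positivity : 0 < δ * s)
  -- On the arc the quadratic Taylor error is of order `(ε M) ^ 2`. Relative to the noise size `ε`
  -- this is `ε M ^ 2 = M⁻²`, which tends to zero.
  have hsq : ∀ᶠ M : ℝ in atTop, C * R ^ 2 ≤ δ * s * M ^ 2 := by
    have : Tendsto (fun M : ℝ => δ * s * M ^ 2) atTop atTop :=
      (tendsto_pow_atTop (by norm_num)).const_mul_atTop (by positivity)
    exact this.eventually_ge_atTop _
  filter_upwards [eventually_integral_cutG (τ := τ / 3) (by positivity), eventually_gt_atTop 0,
    eventually_noiseLevel_mul_le R (δ := d / 2) (by positivity),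
    eventually_noiseLevel_mul_le R (δ := 1) one_pos,
    eventually_noiseLevel_mul_le (|c| * R) (δ := 1) one_pos,
    eventually_noiseLevel_mul_le s (δ := 1) one_pos,
    eventually_pow_mul_exp_le (B * (volume : Measure S1).real Set.univ) (J + 4) (τ := τ / 3)
      (by positivity), hsq] with M h1 hM h2 h3 h4 h5 h6 h7 x hx k hk hkB φ
  have hε := noiseLevel_pos hM
  have hεM : (noiseLevel M)⁻¹ = M ^ 4 := inv_inv _
  set ε := noiseLevel M with hεdef
  set t := rep (x - p) with ht
  have hxd : dist x p ≤ ε * (R * M) := (mem_disk_iff hε).1 hx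
  have htd : |t| ≤ ε * (R * M) := by rw [ht, ← dist_eq_abs_rep]; exact hxd
  have hxt : p + (t : S1) = x := by rw [ht, coe_rep, add_sub_cancel]
  have hD := BddMeas.norm_apply_le φ
  have hD0 : 0 ≤ ‖φ‖ := norm_nonneg _
  have hh : 0 < ε * s := mul_pos hε hsp
  set ψ : ℝ → ℂ := fun u => φ (f p + (u : S1)) with hψ
  have hψm : Measurable ψ := measurable_translate (BddMeas.measurable φ) (f p)
  have hct : |c * t| ≤ ε * (|c| * R * M) := by
    rw [abs_mul]
    calc |c| * |t| ≤ |c| * (ε * (R * M)) := by gcongr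
      _ = _ := by ring
  have e1 : stepMean f σ ε φ x = ∫ z, (stdG z : ℂ) * ψ (G t + ε * σ x * z) := by
    rw [stepMean_eq]
    refine integral_congr_ae (ae_of_all _ fun z => ?_)
    simp only [hψ]
    rw [← hxt, hG t, add_assoc, ← QuotientAddGroup.mk_add]
  have e2 := hclose (c * t) (ε * s) (G t) (ε * σ x) hh
    (by
      have ht1 : |t| ≤ 1 := htd.trans h3
      refine (hGC t ht1).trans ?_
      have ht2 : t ^ 2 ≤ (ε * (R * M)) ^ 2 := by
        rw [← sq_abs]; exact pow_le_pow_left₀ (abs_nonneg _) htd 2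
      have h8 : C * (ε * (R * M)) ^ 2 = ε * (C * R ^ 2) * (ε * M ^ 2) := by ring
      have h9 : δ * (ε * s) = ε * (δ * s * M ^ 2) * (ε * M ^ 2) := by
        have : ε * M ^ 4 = 1 := by rw [← hεM]; exact mul_inv_cancel₀ hε.ne'
        calc δ * (ε * s) = δ * (ε * s) * (ε * M ^ 4) := by rw [this, mul_one]
          _ = _ := by ring
      refine (mul_le_mul_of_nonneg_left ht2 hC.le).trans ?_
      rw [h8, h9]
      gcongr)
    (by
      have h8 : dist (σ x) s < δ * s := hσd (lt_of_le_of_lt (hxd.trans h2) (by linarith))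
      rw [Real.dist_eq] at h8
      rw [← mul_sub, abs_mul, abs_of_pos hε]
      calc ε * |σ x - s| ≤ ε * (δ * s) := by gcongr
        _ = _ := by ring) ψ ‖φ‖ hψm (fun u => hD _)
  have e3 := norm_integral_stdG_sub_cutG_le (ψ := fun z => ψ (c * t + ε * s * z)) (D := ‖φ‖)
    (hψm.comp ((measurable_const_mul _).const_add _)) (fun u => hD _) M
  set k₀ : S1 → ℝ := fun y => (ε * s)⁻¹ * cutG M ((rep (y - f p) - c * t) / (ε * s)) with hk₀
  have e4 : ∫ y, (k₀ y : ℂ) * φ y = ∫ z, (cutG M z : ℂ) * ψ (c * t + ε * s * z) := by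
    refine integral_cutG_rep (f p) hh ?_ φ
    have : ε * s * M = ε * (s * M) := by ring
    linarith [Real.pi_gt_three]
  have hk₀B : ∀ y, |k y - k₀ y| ≤ ε⁻¹ * (B * M ^ J * Real.exp (-M)) := by
    intro y
    refine le_trans (le_of_eq ?_) (hkB y)
    rw [hk₀]
    simp only [coord]
    congr 2
    rw [mul_inv, mul_assoc]
    congr 3
    rw [← ht]
    field_simp
  have hk₀m : Measurable k₀ :=
    ((measurable_cutG M).comp (((measurable_rep.comp (measurable_id.sub_const _)).sub_const
      _).div_const _)).const_mul _
  have hk₀i : Integrable (fun y => (k₀ y : ℂ) * φ y) := by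
    refine (Integrable.of_bound hk₀m.aestronglyMeasurable ((ε * s)⁻¹) (ae_of_all _ fun y => ?_)
      |>.ofReal).mul_bdd (c := ‖φ‖) (BddMeas.measurable φ).aestronglyMeasurable (ae_of_all _ hD)
    rw [Real.norm_eq_abs, hk₀, abs_of_nonneg (mul_nonneg (inv_nonneg.2 hh.le) (cutG_nonneg _ _))]
    exact mul_le_of_le_one_right (inv_nonneg.2 hh.le) (cutG_le_one _ _)
  have hdi : Integrable (fun y => ((k₀ y - k y : ℝ) : ℂ) * φ y) := by
    refine (Integrable.of_bound (hk₀m.sub hk).aestronglyMeasurable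
      (ε⁻¹ * (B * M ^ J * Real.exp (-M))) (ae_of_all _ fun y => ?_)
      |>.ofReal).mul_bdd (c := ‖φ‖) (BddMeas.measurable φ).aestronglyMeasurable (ae_of_all _ hD)
    rw [Real.norm_eq_abs, Pi.sub_apply, abs_sub_comm]
    exact hk₀B y
  have e5 : ∫ y, (k y : ℂ) * φ y
      = (∫ y, (k₀ y : ℂ) * φ y) - ∫ y, ((k₀ y - k y : ℝ) : ℂ) * φ y := by
    rw [← integral_sub hk₀i hdi]
    refine integral_congr_ae (ae_of_all _ fun y => ?_)
    simp only
    push_cast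
    ring
  -- The correction has density at most `ε⁻¹ B M ^ J e^{-M} = B M ^ (J + 4) e^{-M}`, still
  -- exponentially small.
  have e6 : ‖∫ y, ((k₀ y - k y : ℝ) : ℂ) * φ y‖ ≤ τ / 3 * ‖φ‖ := by
    have h8 : ‖∫ y, ((k₀ y - k y : ℝ) : ℂ) * φ y‖
        ≤ ε⁻¹ * (B * M ^ J * Real.exp (-M)) * ‖φ‖ * (volume : Measure S1).real Set.univ := by
      refine norm_integral_le_of_norm_le_const (ae_of_all _ fun y => ?_)
      rw [norm_mul, Complex.norm_real, Real.norm_eq_abs, abs_sub_comm]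
      exact mul_le_mul (hk₀B y) (hD y) (norm_nonneg _) ((abs_nonneg _).trans (hk₀B y))
    refine h8.trans ?_
    rw [hεM]
    refine le_trans (le_of_eq ?_) (mul_le_mul_of_nonneg_right h6 hD0)
    ring
  rw [e1, e5, e4]
  set I₁ := ∫ z, (stdG z : ℂ) * ψ (G t + ε * σ x * z)
  set I₂ := ∫ z, (stdG z : ℂ) * ψ (c * t + ε * s * z)
  set I₃ := ∫ z, (cutG M z : ℂ) * ψ (c * t + ε * s * z)
  set I₄ := ∫ y, ((k₀ y - k y : ℝ) : ℂ) * φ y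
  calc ‖I₁ - (I₃ - I₄)‖ = ‖(I₁ - I₂) + (I₂ - I₃) + I₄‖ := by congr 1; ring
    _ ≤ ‖I₁ - I₂‖ + ‖I₂ - I₃‖ + ‖I₄‖ := norm_add₃_le
    _ ≤ τ / 3 * ‖φ‖ + τ / 3 * ‖φ‖ + τ / 3 * ‖φ‖ := by
        gcongr
        exact e3.trans (mul_le_mul_of_nonneg_right h1 hD0)
    _ = _ := by ring

end Rows

/-! ### Gluing the local kernels. -/

section Glue

open Classical in
/-- The kernel that is given by `k₁, k₂, l₁, l₂` on the sets `U₁, U₂, V₁, V₂` of initial points, and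
by `k₀` elsewhere. -/
noncomputable def gluedKernel {X : Type*} (U₁ U₂ V₁ V₂ : Set X) (k₁ k₂ l₁ l₂ k₀ : X → X → ℝ)
    (x y : X) : ℝ :=
  if x ∈ U₁ then k₁ x y else if x ∈ U₂ then k₂ x y else if x ∈ V₁ then l₁ x y
  else if x ∈ V₂ then l₂ x y else k₀ x y

theorem IsBddKernel.ite {X : Type*} [MeasurableSpace X] {k l : X → X → ℝ} (hk : IsBddKernel k)
    (hl : IsBddKernel l) {A : Set X} (hA : MeasurableSet A) [DecidablePred (· ∈ A)] :
    IsBddKernel fun x y => if x ∈ A then k x y else l x y where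
  measurable := Measurable.ite (measurable_fst hA) hk.measurable hl.measurable
  bdd := by
    obtain ⟨C, hC⟩ := hk.bdd
    obtain ⟨D, hD⟩ := hl.bdd
    refine ⟨max C D, fun x y => ?_⟩
    split_ifs
    exacts [(hC x y).trans (le_max_left _ _), (hD x y).trans (le_max_right _ _)]

variable {X : Type*} {U₁ U₂ V₁ V₂ : Set X} {k₁ k₂ l₁ l₂ k₀ : X → X → ℝ}

theorem gluedKernel_of_mem_U₁ {x : X} (hx : x ∈ U₁) (y : X) :
    gluedKernel U₁ U₂ V₁ V₂ k₁ k₂ l₁ l₂ k₀ x y = k₁ x y := by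
  simp [gluedKernel, hx]

theorem gluedKernel_of_mem_U₂ (h : Disjoint U₁ U₂) {x : X} (hx : x ∈ U₂) (y : X) :
    gluedKernel U₁ U₂ V₁ V₂ k₁ k₂ l₁ l₂ k₀ x y = k₂ x y := by
  simp [gluedKernel, hx, Set.disjoint_right.1 h hx]

theorem gluedKernel_of_mem_V₁ (h₁ : Disjoint U₁ V₁) (h₂ : Disjoint U₂ V₁) {x : X} (hx : x ∈ V₁)
    (y : X) : gluedKernel U₁ U₂ V₁ V₂ k₁ k₂ l₁ l₂ k₀ x y = l₁ x y := by
  simp [gluedKernel, hx, Set.disjoint_right.1 h₁ hx, Set.disjoint_right.1 h₂ hx]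

theorem gluedKernel_of_mem_V₂ (h₁ : Disjoint U₁ V₂) (h₂ : Disjoint U₂ V₂) (h₃ : Disjoint V₁ V₂)
    {x : X} (hx : x ∈ V₂) (y : X) : gluedKernel U₁ U₂ V₁ V₂ k₁ k₂ l₁ l₂ k₀ x y = l₂ x y := by
  simp [gluedKernel, hx, Set.disjoint_right.1 h₁ hx, Set.disjoint_right.1 h₂ hx,
    Set.disjoint_right.1 h₃ hx]

theorem gluedKernel_of_notMem {x : X} (h₁ : x ∉ U₁) (h₂ : x ∉ U₂) (h₃ : x ∉ V₁) (h₄ : x ∉ V₂)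
    (y : X) : gluedKernel U₁ U₂ V₁ V₂ k₁ k₂ l₁ l₂ k₀ x y = k₀ x y := by
  simp [gluedKernel, h₁, h₂, h₃, h₄]

/-- Each triangularity condition is checked by the set of the starting point; rows starting in the
attracting arcs stay there and so avoid the repelling ones. -/
theorem isRepellerAttractor_gluedKernel [MeasurableSpace X] (hU₁ : MeasurableSet U₁)
    (hU₂ : MeasurableSet U₂) (hV₁ : MeasurableSet V₁) (hV₂ : MeasurableSet V₂)
    (dUU : Disjoint U₁ U₂) (dUV₁₁ : Disjoint U₁ V₁) (dUV₁₂ : Disjoint U₁ V₂)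
    (dUV₂₁ : Disjoint U₂ V₁) (dUV₂₂ : Disjoint U₂ V₂) (dVV : Disjoint V₁ V₂)
    (hk₁ : IsBddKernel k₁) (hk₂ : IsBddKernel k₂) (hl₁ : IsBddKernel l₁) (hl₂ : IsBddKernel l₂)
    (hk₀ : IsBddKernel k₀)
    (z₁ : ∀ x ∈ U₁, ∀ y ∈ U₂, k₁ x y = 0) (z₂ : ∀ x ∈ U₂, ∀ y ∈ U₁, k₂ x y = 0)
    (s₁ : ∀ x ∈ V₁, ∀ y ∉ V₂, l₁ x y = 0) (s₂ : ∀ x ∈ V₂, ∀ y ∉ V₁, l₂ x y = 0)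
    (r₁ : ∀ x ∉ U₁, ∀ y ∈ U₁, k₀ x y = 0) (r₂ : ∀ x ∉ U₂, ∀ y ∈ U₂, k₀ x y = 0)
    (hc : ∃ n : ℕ, ∀ c : ℕ → X, (∀ i ≤ n, c i ∉ U₁ ∧ c i ∉ U₂ ∧ c i ∉ V₁ ∧ c i ∉ V₂) →
      ∃ i < n, k₀ (c i) (c (i + 1)) = 0) :
    IsRepellerAttractor (gluedKernel U₁ U₂ V₁ V₂ k₁ k₂ l₁ l₂ k₀) U₁ U₂ (V₁ ∪ V₂) where
  kernel := by
    classical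
    exact hk₁.ite (hk₂.ite (hl₁.ite (hl₂.ite hk₀ hV₂) hV₁) hU₂) hU₁
  meas₁ := hU₁
  meas₂ := hU₂
  measV := hV₁.union hV₂
  disj := dUU
  disj₁ := dUV₁₁.union_right dUV₁₂
  disj₂ := dUV₂₁.union_right dUV₂₂
  into₁ := by
    intro x hx y hy
    by_cases h₂ : x ∈ U₂
    · rw [gluedKernel_of_mem_U₂ dUU h₂, z₂ x h₂ y hy]
    by_cases h₃ : x ∈ V₁
    · rw [gluedKernel_of_mem_V₁ dUV₁₁ dUV₂₁ h₃, s₁ x h₃ y (Set.disjoint_left.1 dUV₁₂ hy)]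
    by_cases h₄ : x ∈ V₂
    · rw [gluedKernel_of_mem_V₂ dUV₁₂ dUV₂₂ dVV h₄, s₂ x h₄ y (Set.disjoint_left.1 dUV₁₁ hy)]
    rw [gluedKernel_of_notMem hx h₂ h₃ h₄, r₁ x hx y hy]
  into₂ := by
    intro x hx y hy
    by_cases h₂ : x ∈ U₁
    · rw [gluedKernel_of_mem_U₁ h₂, z₁ x h₂ y hy]
    by_cases h₃ : x ∈ V₁
    · rw [gluedKernel_of_mem_V₁ dUV₁₁ dUV₂₁ h₃, s₁ x h₃ y (Set.disjoint_left.1 dUV₂₂ hy)]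
    by_cases h₄ : x ∈ V₂
    · rw [gluedKernel_of_mem_V₂ dUV₁₂ dUV₂₂ dVV h₄, s₂ x h₄ y (Set.disjoint_left.1 dUV₂₁ hy)]
    rw [gluedKernel_of_notMem h₂ hx h₃ h₄, r₂ x hx y hy]
  outV := by
    rintro x (hx | hx) y hy
    · rw [gluedKernel_of_mem_V₁ dUV₁₁ dUV₂₁ hx, s₁ x hx y fun h => hy (Or.inr h)]
    · rw [gluedKernel_of_mem_V₂ dUV₁₂ dUV₂₂ dVV hx, s₂ x hx y fun h => hy (Or.inl h)]
  chain := by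
    obtain ⟨n, hn⟩ := hc
    refine ⟨n, fun c hcc => ?_⟩
    have h1 : ∀ i ≤ n, c i ∉ U₁ ∧ c i ∉ U₂ ∧ c i ∉ V₁ ∧ c i ∉ V₂ := fun i hi =>
      ⟨(hcc i hi).1, (hcc i hi).2.1, fun h => (hcc i hi).2.2 (Or.inl h),
        fun h => (hcc i hi).2.2 (Or.inr h)⟩
    obtain ⟨i, hi, h2⟩ := hn c h1
    obtain ⟨a1, a2, a3, a4⟩ := h1 i hi.le
    exact ⟨i, hi, by rw [gluedKernel_of_notMem a1 a2 a3 a4, h2]⟩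

end Glue

/-! ### Linearised kernels at the four points: scalings, multipliers, supports. -/

section LocalKernels

variable (f : S1 → S1) (σ : S1 → ℝ)

/-- The modified transition kernel near a repelling fixed point. -/
noncomputable def repellerKernel (ε M R : ℝ) (J : ℕ) (ν : ℕ → ℝ) (e : ℕ → ℝ → ℝ) (p x y : S1) : ℝ :=
  ε⁻¹ * blockLine J (betaScale (circleDeriv f p) (σ p)) (R * M) (σ p)⁻¹ (circleDeriv f p / σ p)
    (σ p)⁻¹ M ν e e (coord ε p y) (coord ε p x)

/-- The modified transition kernel from an attracting periodic point `p` to its image `q`. -/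
noncomputable def attractorKernel (α ε M R : ℝ) (J : ℕ) (ν : ℕ → ℝ) (e e' : ℕ → ℝ → ℝ)
    (p q x y : S1) : ℝ :=
  ε⁻¹ * blockLine J α (R * M) (σ p)⁻¹ (σ p)⁻¹ (circleDeriv f p / σ p) M ν e e' (coord ε p x)
    (coord ε q y)

variable {f σ} {ε M R R' α α' C κ C' κ' : ℝ} {J : ℕ} {ν : ℕ → ℝ} {e e' : ℕ → ℝ → ℝ} {p q : S1}

theorem cutG_neg (M u : ℝ) : cutG M (-u) = cutG M u := by
  have : u ∈ Set.Icc (-M) M ↔ -u ∈ Set.Icc (-M) M := by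
    rw [Set.mem_Icc, Set.mem_Icc]; constructor <;> rintro ⟨h1, h2⟩ <;> constructor <;> linarith
  by_cases h : u ∈ Set.Icc (-M) M
  · rw [cutG, cutG, Set.indicator_of_mem h, Set.indicator_of_mem (this.1 h), stdG_neg]
  · rw [cutG, cutG, Set.indicator_of_notMem h, Set.indicator_of_notMem fun h' => h (this.2 h')]

theorem betaScale_pos {c s : ℝ} (hc : 1 < |c|) (hs : 0 < s) : 0 < betaScale c s := by
  have : 1 < c ^ 2 := by rw [← sq_abs]; exact one_lt_pow₀ hc two_ne_zero
  exact Real.sqrt_pos.2 (div_pos (by linarith) (by positivity))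

/-- The variance matching condition of `integral_hermiteFn_mul_stdG` with equal scalings in source
and target; it reads `c ^ 2 = 1 + 2 s ^ 2 β ^ 2` and determines `betaScale`. -/
theorem betaScale_rel {c s : ℝ} (hc : 1 < |c|) (hs : 0 < s) :
    (c / s) ^ 2 * betaScale c s ^ 2
      = betaScale c s ^ 2 * ((s⁻¹) ^ 2 + 2 * betaScale c s ^ 2) := by
  have : 1 < c ^ 2 := by rw [← sq_abs]; exact one_lt_pow₀ hc two_ne_zero
  rw [betaScale, Real.sq_sqrt (div_nonneg (by linarith) (by positivity))]
  field_simp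
  ring

theorem hermMult_repeller {c s β : ℝ} (hc : c ≠ 0) (hs : 0 < s) (hβ : 0 < β) (j : ℕ) :
    hermMult β β s⁻¹ (c / s) s⁻¹ j = |c|⁻¹ * (c ^ j)⁻¹ := by
  rw [hermMult, abs_div, abs_of_pos hs, ← inv_pow]
  have h1 : s⁻¹ * β / (c / s * β) = c⁻¹ := by field_simp
  have h2 : |c| ≠ 0 := abs_ne_zero.2 hc
  rw [h1, ← mul_assoc]
  congr 1
  field_simp

theorem alphaScale_pos {c c' s s' : ℝ} (hcc : |c * c'| < 1) (hs' : 0 < s') :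
    0 < alphaScale c c' s s' := by
  have : (c * c') ^ 2 < 1 := by rw [← sq_abs]; exact pow_lt_one₀ (abs_nonneg _) hcc two_ne_zero
  exact div_pos (Real.sqrt_pos.2 (by linarith)) (Real.sqrt_pos.2 (by positivity))

/-- Propagation of variance along the cycle: with variance `1 / (2 α ^ 2)` at a point, its image has
`c ^ 2 / (2 α ^ 2) + s ^ 2`, and `alphaScale` is the two-periodic solution. -/
theorem alphaScale_rel {c c' s s' : ℝ} (hcc : |c * c'| < 1) (hs : 0 < s) (hs' : 0 < s') :
    (s⁻¹) ^ 2 * alphaScale c c' s s' ^ 2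
      = alphaScale c' c s' s ^ 2 * ((c / s) ^ 2 + 2 * alphaScale c c' s s' ^ 2) := by
  have h1 : (c * c') ^ 2 < 1 := by rw [← sq_abs]; exact pow_lt_one₀ (abs_nonneg _) hcc two_ne_zero
  have h2 : (c' * c) ^ 2 < 1 := by rwa [mul_comm]
  have h3 : 0 < c' ^ 2 * s ^ 2 + s' ^ 2 := by positivity
  have h4 : 0 < c ^ 2 * s' ^ 2 + s ^ 2 := by positivity
  have h5 : 0 ≤ (1 - (c * c') ^ 2) / 2 := by linarith
  have h6 : 0 ≤ (1 - (c' * c) ^ 2) / 2 := by linarith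
  rw [alphaScale, alphaScale, div_pow, div_pow, Real.sq_sqrt h5, Real.sq_sqrt h6,
    Real.sq_sqrt h3.le, Real.sq_sqrt h4.le]
  field_simp
  ring

/-- Each multiplier alone depends on the ratio of the two scalings; the ratios cancel around the
cycle. -/
theorem hermMult_attractor {c c' s s' α α' : ℝ} (hs : 0 < s) (hs' : 0 < s') (hα : 0 < α)
    (hα' : 0 < α') (j : ℕ) :
    hermMult α α' s⁻¹ s⁻¹ (c / s) j * hermMult α' α s'⁻¹ s'⁻¹ (c' / s') j = (c * c') ^ j := by
  rw [hermMult, hermMult, abs_of_pos (inv_pos.2 hs), abs_of_pos (inv_pos.2 hs')]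
  have h1 : c / s * α' / (s⁻¹ * α) * (c' / s' * α / (s'⁻¹ * α')) = c * c' := by field_simp
  rw [← h1, mul_pow]
  field_simp

theorem isBddKernel_mul_blockLine {w a b A A' D : ℝ} (he : IsCutHermite J α A C κ e)
    (he' : IsCutHermite J α' A' C' κ' e')
    (hD : ∀ x y, |blockLine J α A w a b M ν e e' x y - w * cutG M (a * y - b * x)| ≤ D)
    (hε : 0 < ε) (p q : S1) :
    IsBddKernel fun x y => ε⁻¹ * blockLine J α A w a b M ν e e' (coord ε p x) (coord ε q y) where
  measurable := ((measurable_blockLine he he').comp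
    (((measurable_coord ε p).comp measurable_fst).prodMk
      ((measurable_coord ε q).comp measurable_snd))).const_mul _
  bdd := by
    refine ⟨ε⁻¹ * (D + |w|), fun x y => ?_⟩
    rw [abs_mul, abs_of_pos (inv_pos.2 hε)]
    refine mul_le_mul_of_nonneg_left ?_ (inv_pos.2 hε).le
    have h1 := hD (coord ε p x) (coord ε q y)
    set B := blockLine J α A w a b M ν e e' (coord ε p x) (coord ε q y)
    set g := cutG M (a * coord ε q y - b * coord ε p x)
    have h2 : |w * g| ≤ |w| := by
      rw [abs_mul, abs_of_nonneg (cutG_nonneg _ _)]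
      exact mul_le_of_le_one_right (abs_nonneg _) (cutG_le_one _ _)
    calc |B| = |(B - w * g) + w * g| := by rw [sub_add_cancel]
      _ ≤ |B - w * g| + |w * g| := abs_add_le _ _
      _ ≤ D + |w| := add_le_add h1 h2

theorem isBddKernel_noiseKernel {f : C(S1, S1)} {σ : C(S1, ℝ)} (hσ : ∀ x, 0 < σ x) (hε : 0 < ε)
    (M : ℝ) : IsBddKernel (noiseKernel f σ ε M) where
  measurable := by
    have hs : Measurable fun z : S1 × S1 => ε * σ z.1 :=
      (σ.continuous.measurable.comp measurable_fst).const_mul ε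
    have hr : Measurable fun z : S1 × S1 => rep (z.2 - f z.1) :=
      measurable_rep.comp (measurable_snd.sub (f.continuous.measurable.comp measurable_fst))
    exact hs.inv.mul ((measurable_cutG M).comp (hr.div hs))
  bdd := by
    obtain ⟨s₀, hs₀, s₁, -, hs⟩ := exists_forall_le_and_pos hσ
    refine ⟨(ε * s₀)⁻¹, fun x y => ?_⟩
    have h1 : 0 < ε * s₀ := mul_pos hε hs₀
    have h2 : ε * s₀ ≤ ε * σ x := mul_le_mul_of_nonneg_left (hs x).1 hε.le
    rw [noiseKernel, abs_of_nonneg (mul_nonneg (inv_nonneg.2 (h1.le.trans h2)) (cutG_nonneg _ _))]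
    calc (ε * σ x)⁻¹ * cutG M (rep (y - f x) / (ε * σ x)) ≤ (ε * σ x)⁻¹ * 1 :=
          mul_le_mul_of_nonneg_left (cutG_le_one _ _) (inv_nonneg.2 (h1.le.trans h2))
      _ ≤ (ε * s₀)⁻¹ := by rw [mul_one]; exact inv_anti₀ h1 h2

theorem noiseKernel_eq_zero {S : ℝ} (hε : 0 < ε) (hM : 0 ≤ M) {x y : S1} (hσ : 0 < σ x)
    (hS : σ x ≤ S) (h : S * (ε * M) < dist y (f x)) : noiseKernel f σ ε M x y = 0 := by
  rw [noiseKernel, cutG_eq_zero, mul_zero]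
  have h1 : 0 < ε * σ x := mul_pos hε hσ
  rw [abs_div, abs_of_pos h1, lt_div_iff₀ h1, ← dist_eq_abs_rep]
  refine lt_of_le_of_lt ?_ h
  have : σ x * (ε * M) ≤ S * (ε * M) := mul_le_mul_of_nonneg_right hS (by positivity)
  linarith

/-- The correction stays in the original arc, while the linearised step reaches at most `|c| R M + σ
M` in rescaled units. -/
theorem repellerKernel_eq_zero (hσ : 0 < σ p) (hc : 1 < |circleDeriv f p|)
    (he : IsCutHermite J (betaScale (circleDeriv f p) (σ p)) (R * M) C κ e)
    (hA : M + |(σ p)⁻¹| * (R * M) ≤ |circleDeriv f p / σ p| * (R * M)) {x y : S1}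
    (hx : x ∈ disk ε (R * M) p)
    (hy : y ∉ disk ε ((|circleDeriv f p| * R + σ p) * M) p) (hM : 0 ≤ M) (hR : 0 ≤ R) :
    repellerKernel f σ ε M R J ν e p x y = 0 := by
  set c := circleDeriv f p
  have hx' : |coord ε p x| ≤ R * M := hx
  have hy' : (|c| * R + σ p) * M < |coord ε p y| := not_le.1 hy
  have hRM : 0 ≤ R * M := mul_nonneg hR hM
  have h1 : R * M < |coord ε p y| := by
    refine lt_of_le_of_lt ?_ hy'
    have : R * M ≤ |c| * (R * M) := le_mul_of_one_le_left hRM hc.le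
    nlinarith [mul_nonneg hσ.le hM]
  have hne : c / σ p ≠ 0 := div_ne_zero (fun h => by simp [h] at hc; linarith) hσ.ne'
  rw [repellerKernel, blockLine_eq he he hne hA (Or.inl h1), cutG_eq_zero]
  · simp
  · have h2 : c / σ p * coord ε p x - (σ p)⁻¹ * coord ε p y
        = (c * coord ε p x - coord ε p y) / σ p := by field_simp
    rw [h2, abs_div, abs_of_pos hσ, lt_div_iff₀ hσ]
    have h3 := abs_sub_abs_le_abs_sub (coord ε p y) (c * coord ε p x)
    rw [abs_sub_comm, abs_mul] at h3
    have h4 : |c| * |coord ε p x| ≤ |c| * (R * M) := mul_le_mul_of_nonneg_left hx' (abs_nonneg _)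
    linarith

/-- By the contraction condition both the truncated step and the correction land in the target arc.
-/
theorem attractorKernel_eq_zero (hσ : 0 < σ p)
    (he : IsCutHermite J α (R * M) C κ e) (he' : IsCutHermite J α' (R' * M) C' κ' e')
    (hA : M + |circleDeriv f p / σ p| * (R * M) ≤ |(σ p)⁻¹| * (R' * M)) {x y : S1}
    (hx : x ∈ disk ε (R * M) p) (hy : y ∉ disk ε (R' * M) q) :
    attractorKernel f σ α ε M R J ν e e' p q x y = 0 := by
  have hx' : |coord ε p x| ≤ R * M := hx
  have hy' : R' * M < |coord ε q y| := not_le.1 hy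
  have hne : (σ p)⁻¹ ≠ 0 := inv_ne_zero hσ.ne'
  rw [attractorKernel, blockLine_eq he he' hne hA (Or.inr hy'), cutG_eq_zero]
  · simp
  · have h1 : |(σ p)⁻¹| * (R' * M) < |(σ p)⁻¹| * |coord ε q y| :=
      mul_lt_mul_of_pos_left hy' (abs_pos.2 hne)
    have h2 : |circleDeriv f p / σ p| * |coord ε p x| ≤ |circleDeriv f p / σ p| * (R * M) :=
      mul_le_mul_of_nonneg_left hx' (abs_nonneg _)
    have h3 := abs_sub_abs_le_abs_sub ((σ p)⁻¹ * coord ε q y) (circleDeriv f p / σ p * coord ε p x)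
    rw [abs_mul, abs_mul] at h3
    linarith

theorem IsCutHermite.exists_ne_zero {A : ℝ} (he : IsCutHermite J α A C κ e) (hα : 0 < α) {j : ℕ}
    (hj : j < J) (hε : 0 < ε) (hA : ε * A < Real.pi) (p : S1) :
    ∃ x ∈ disk ε A p, e j (coord ε p x) ≠ 0 := by
  have h1 := he.hermCoeff_eq hα hj hj
  have h2 : ∃ t, e j t ≠ 0 := by
    by_contra! h3
    simp [hermCoeff, h3] at h1
  obtain ⟨t, ht⟩ := h2
  have htA : |t| ≤ A := by
    by_contra h3
    exact ht (he.support j hj t (not_le.1 h3))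
  have h4 := coord_add (p := p) hε hA htA
  exact ⟨p + ((ε * t : ℝ) : S1), by rw [disk, Set.mem_ofPred_eq, h4]; exact htA, by rwa [h4]⟩

theorem hasEigenSystem_repeller {K : S1 → S1 → ℝ} (hσ : 0 < σ p) (hc : 1 < |circleDeriv f p|)
    (hε : 0 < ε) (hC : 0 ≤ C) (hκ : 0 ≤ κ)
    (he : IsCutHermite J (betaScale (circleDeriv f p) (σ p)) (R * M) C κ e)
    (hA : M + |(σ p)⁻¹| * (R * M) ≤ |circleDeriv f p / σ p| * (R * M))
    (hεA : ε * (R * M) < Real.pi)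
    (hK : ∀ x ∈ disk ε (R * M) p, ∀ y, K x y = repellerKernel f σ ε M R J ν e p x y) {r : ℝ}
    (hr : 0 < r) (hJ : ∀ n, J ≤ n → |circleDeriv f p|⁻¹ * (|circleDeriv f p| ^ n)⁻¹ ≤ r) :
    HasEigenSystem volume (blockKernel (disk ε (R * M) p) K) r J ν
      fun j x => e j (coord ε p x) where
  expansion := by
    intro lam φ hl hφ
    have hc0 : circleDeriv f p ≠ 0 := fun h => by rw [h, abs_zero] at hc; linarith
    refine disk_eigen_expansion hε (betaScale_pos hc hσ) hC hκ he (div_ne_zero hc0 hσ.ne') hA hεA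
      (fun x hx y _ => hK x hx y) (norm_pos_iff.1 (hr.trans hl)) (fun n hn => ?_) hφ
    have h1 : |(σ p)⁻¹| / |circleDeriv f p / σ p| * |(σ p)⁻¹ / (circleDeriv f p / σ p)| ^ n
        = |circleDeriv f p|⁻¹ * (|circleDeriv f p| ^ n)⁻¹ := by
      rw [← abs_div, ← inv_pow]
      have : (σ p)⁻¹ / (circleDeriv f p / σ p) = (circleDeriv f p)⁻¹ := by
        have := hσ.ne'
        field_simp
      rw [this, abs_inv]
    rw [h1, ← sq]
    exact pow_lt_pow_left₀ ((hJ n hn).trans_lt hl) (by positivity) two_ne_zero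
  eigen := fun j hj => disk_eigen_of_mult hε (betaScale_pos hc hσ) hC hκ he hεA
    (fun x hx y _ => hK x hx y) hj
  ne_zero := fun j hj => by
    obtain ⟨x, -, hx⟩ := he.exists_ne_zero (betaScale_pos hc hσ) hj hε hεA p
    exact ⟨x, hx⟩

theorem hasPairSystem_attractor {K : S1 → S1 → ℝ} {ν₁ ν₂ : ℕ → ℝ} {e₁ e₂ : ℕ → ℝ → ℝ}
    {R₁ R₂ α₁ α₂ : ℝ} {p₁ p₂ : S1} (hσ₁ : 0 < σ p₁) (hσ₂ : 0 < σ p₂) (hα₁ : 0 < α₁) (hα₂ : 0 < α₂)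
    (hε : 0 < ε) (hC : 0 ≤ C) (hκ : 0 ≤ κ) (hC' : 0 ≤ C') (hκ' : 0 ≤ κ')
    (he₁ : IsCutHermite J α₁ (R₁ * M) C κ e₁) (he₂ : IsCutHermite J α₂ (R₂ * M) C' κ' e₂)
    (hA₁ : M + |circleDeriv f p₁ / σ p₁| * (R₁ * M) ≤ |(σ p₁)⁻¹| * (R₂ * M))
    (hA₂ : M + |circleDeriv f p₂ / σ p₂| * (R₂ * M) ≤ |(σ p₂)⁻¹| * (R₁ * M))
    (hεA₁ : ε * (R₁ * M) < Real.pi) (hεA₂ : ε * (R₂ * M) < Real.pi)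
    (hdisj : Disjoint (disk ε (R₁ * M) p₁) (disk ε (R₂ * M) p₂))
    (hK₁ : ∀ x ∈ disk ε (R₁ * M) p₁, ∀ y,
      K x y = attractorKernel f σ α₁ ε M R₁ J ν₁ e₁ e₂ p₁ p₂ x y)
    (hK₂ : ∀ x ∈ disk ε (R₂ * M) p₂, ∀ y,
      K x y = attractorKernel f σ α₂ ε M R₂ J ν₂ e₂ e₁ p₂ p₁ x y) {r : ℝ} (hr : 0 < r)
    (hJ : ∀ n, J ≤ n → |circleDeriv f p₁ * circleDeriv f p₂| ^ n ≤ r ^ 2) :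
    HasPairSystem volume
      (blockKernel (disk ε (R₁ * M) p₁ ∪ disk ε (R₂ * M) p₂) fun y x => K x y) r J ν₁ ν₂
      (fun j x => e₁ j (coord ε p₁ x)) (fun j x => e₂ j (coord ε p₂ x)) := by
  have hK₁₁ : ∀ x ∈ disk ε (R₁ * M) p₁, ∀ y ∈ disk ε (R₁ * M) p₁, K x y = 0 := fun x hx y hy => by
    rw [hK₁ x hx, attractorKernel_eq_zero hσ₁ he₁ he₂ hA₁ hx (Set.disjoint_left.1 hdisj hy)]
  have hK₂₂ : ∀ x ∈ disk ε (R₂ * M) p₂, ∀ y ∈ disk ε (R₂ * M) p₂, K x y = 0 := fun x hx y hy => by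
    rw [hK₂ x hx, attractorKernel_eq_zero hσ₂ he₂ he₁ hA₂ hx (Set.disjoint_right.1 hdisj hy)]
  refine ⟨fun lam g hl hg => ?_, fun j hj lam c d hcd hdc => ?_, fun j hj => ?_⟩
  · refine pair_eigen_expansion hε hα₁ hα₂ hC hκ hC' hκ' he₁ he₂ (inv_ne_zero hσ₁.ne')
      (inv_ne_zero hσ₂.ne') hA₁ hA₂ hεA₁ hεA₂ hdisj (fun x hx y _ => hK₁ x hx y)
      (fun x hx y _ => hK₂ x hx y) hK₁₁ hK₂₂ (norm_pos_iff.1 (hr.trans hl)) (fun n hn => ?_) hg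
    have h1 : ∀ p, 0 < σ p → |(σ p)⁻¹| / |(σ p)⁻¹| * |circleDeriv f p / σ p / (σ p)⁻¹| ^ n
        = |circleDeriv f p| ^ n := by
      intro p hp
      rw [div_self (abs_ne_zero.2 (inv_ne_zero hp.ne')), one_mul]
      congr 2
      have := hp.ne'
      field_simp
    rw [h1 p₁ hσ₁, h1 p₂ hσ₂, ← mul_pow, ← abs_mul]
    exact (hJ n hn).trans_lt (pow_lt_pow_left₀ hl hr.le two_ne_zero)
  · exact pair_eigen_of_mult hε hα₁ hα₂ hC hκ hC' hκ' he₁ he₂ hεA₁ hεA₂ hdisj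
      (fun x hx y _ => hK₁ x hx y) (fun x hx y _ => hK₂ x hx y) hK₁₁ hK₂₂ hj hcd hdc
  · obtain ⟨x, hx, hx'⟩ := he₁.exists_ne_zero hα₁ hj hε hεA₁ p₁
    exact ⟨x, hx', he₂.support j hj _ (not_le.1 (Set.disjoint_left.1 hdisj hx))⟩

end LocalKernels

/-! ### Radii of the arcs compatible with the dynamics. -/

section Geometry

/-- Only the product of the two derivatives is below one, so a single derivative may expand; unequal
radii compensate for this. -/
theorem exists_contracting_radii {a b S : ℝ} (ha : 0 ≤ a) (hb : 0 ≤ b) (hab : a * b < 1)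
    (hS : 0 < S) : ∃ τ > 0, ∃ R₁ > 0, ∃ R₂ > 0,
      (a + τ) * R₁ + S < R₂ ∧ (b + τ) * R₂ + S < R₁ := by
  have h1 : ∀ᶠ τ : ℝ in 𝓝[>] 0, (a + τ) * (b + τ) < 1 := by
    have h2 : Continuous fun τ : ℝ => (a + τ) * (b + τ) := by fun_prop
    exact ((h2.tendsto' 0 (a * b) (by simp)).eventually (gt_mem_nhds hab)).filter_mono
      nhdsWithin_le_nhds
  obtain ⟨τ, hτ, hτ0⟩ := (h1.and self_mem_nhdsWithin).exists
  have hτ0 : 0 < τ := hτ0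
  have hq : 0 < 1 - (a + τ) * (b + τ) := by linarith
  -- The radii solve `R₂ = (a + τ) R₁ + 2 S` and `R₁ = (b + τ) R₂ + 2 S`, leaving a slack of `S` in
  -- each inequality.
  refine ⟨τ, hτ0, 2 * S * (1 + (b + τ)) / (1 - (a + τ) * (b + τ)), by positivity,
    (a + τ) * (2 * S * (1 + (b + τ)) / (1 - (a + τ) * (b + τ))) + 2 * S, by positivity,
    by linarith, ?_⟩
  set R := 2 * S * (1 + (b + τ)) / (1 - (a + τ) * (b + τ)) with hR
  have h2 : R * (1 - (a + τ) * (b + τ)) = 2 * S * (1 + (b + τ)) := div_mul_cancel₀ _ hq.ne'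
  nlinarith

/-- Another preimage of the repelling point would have its orbit stuck at `p` and could not be
attracted to the cycle. -/
theorem eq_of_map_eq_of_attracted {X : Type*} [MetricSpace X] {f : X → X} {p p' q₁ q₂ : X}
    (hpp : p ≠ p') (hp : f p = p) (hp' : f p' = p') (hq₁ : p ≠ q₁) (hq₂ : p ≠ q₂)
    (hattr : ∀ x, x ≠ p → x ≠ p' →
      Tendsto (fun n : ℕ => Metric.infDist (f^[n] x) {q₁, q₂}) atTop (𝓝 0)) {x : X}
    (hx : f x = p) : x = p := by
  by_contra hne
  have hne' : x ≠ p' := fun h => hpp (by rw [← hx, h, hp'])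
  have h1 := (hattr x hne hne').comp (tendsto_add_atTop_nat 1)
  have h2 : ∀ n : ℕ, f^[n + 1] x = p := fun n => by
    rw [Function.iterate_succ_apply, hx, Function.iterate_fixed hp]
  have h3 : Tendsto (fun _ : ℕ => Metric.infDist p {q₁, q₂}) atTop (𝓝 0) := by
    refine h1.congr fun n => ?_
    simp only [Function.comp_apply, h2]
  have h4 : Metric.infDist p {q₁, q₂} = 0 := tendsto_nhds_unique tendsto_const_nhds h3
  have h5 : p ∈ ({q₁, q₂} : Set X) :=
    ((Set.toFinite _).isClosed.mem_iff_infDist_zero ⟨q₁, Or.inl rfl⟩).2 h4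
  rcases h5 with h | h
  exacts [hq₁ h, hq₂ h]

variable {f : C(S1, S1)} {σ : C(S1, ℝ)}

/-- The conditions on the radii of the four arcs, and the resulting properties of the truncated
noise. -/
structure IsAdmissibleRadii (f : C(S1, S1)) (σ : C(S1, ℝ)) (xs xu x₁ x₂ : S1)
    (Rs Ru R₁ R₂ : ℝ) : Prop where
  pos_s : 0 < Rs
  pos_u : 0 < Ru
  pos₁ : 0 < R₁
  pos₂ : 0 < R₂
  expand_s : σ xs + Rs ≤ |circleDeriv f xs| * Rs
  expand_u : σ xu + Ru ≤ |circleDeriv f xu| * Ru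
  contract₁ : σ x₁ + |circleDeriv f x₁| * R₁ ≤ R₂
  contract₂ : σ x₂ + |circleDeriv f x₂| * R₂ ≤ R₁
  no_return_s : ∀ᶠ M : ℝ in atTop, ∀ x ∉ disk (noiseLevel M) (Rs * M) xs,
    ∀ y ∈ disk (noiseLevel M) (Rs * M) xs, noiseKernel f σ (noiseLevel M) M x y = 0
  no_return_u : ∀ᶠ M : ℝ in atTop, ∀ x ∉ disk (noiseLevel M) (Ru * M) xu,
    ∀ y ∈ disk (noiseLevel M) (Ru * M) xu, noiseKernel f σ (noiseLevel M) M x y = 0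
  chain : ∀ᶠ M : ℝ in atTop, ∃ n : ℕ, ∀ c : ℕ → S1,
    (∀ i ≤ n, c i ∉ disk (noiseLevel M) (Rs * M) xs ∧ c i ∉ disk (noiseLevel M) (Ru * M) xu ∧
      c i ∉ disk (noiseLevel M) (R₁ * M) x₁ ∧ c i ∉ disk (noiseLevel M) (R₂ * M) x₂) →
    ∃ i < n, noiseKernel f σ (noiseLevel M) M (c i) (c (i + 1)) = 0

theorem notMem_disk_iff {ε R M : ℝ} (hε : 0 < ε) {p x : S1} :
    x ∉ disk ε (R * M) p ↔ R * (ε * M) < dist x p := by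
  rw [mem_disk_iff hε, not_le, mul_left_comm]

theorem eventually_noiseLevel_mul_self_lt {δ : ℝ} (hδ : 0 < δ) :
    ∀ᶠ M : ℝ in atTop, noiseLevel M * M < δ := by
  filter_upwards [eventually_noiseLevel_mul_le 1 (δ := δ / 2) (by positivity)] with M hM
  rw [one_mul] at hM
  linarith

theorem eventually_no_return (hσ : ∀ x, 0 < σ x) {S : ℝ} (hS : 0 < S) (hσS : ∀ x, σ x ≤ S) {p : S1}
    (hfp : f p = p) (hp : ∀ x, f x = p → x = p) {δ ℓ R : ℝ} (hδ : 0 < δ) (hℓ : 0 < ℓ)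
    (hE : ∀ x, dist x p ≤ δ → ℓ * dist x p ≤ dist (f x) (f p)) (hR : 0 < R)
    (hRS : S < (ℓ - 1) * R) :
    ∀ᶠ M : ℝ in atTop, ∀ x ∉ disk (noiseLevel M) (R * M) p,
      ∀ y ∈ disk (noiseLevel M) (R * M) p, noiseKernel f σ (noiseLevel M) M x y = 0 := by
  rw [hfp] at hE
  obtain ⟨η₀, hη₀, h1⟩ := exists_no_return f.continuous hp hδ hℓ hE hR hS hRS
  filter_upwards [eventually_noiseLevel_mul_self_lt hη₀, eventually_gt_atTop 0] with M h2 hM x hx y hy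
  have hε := noiseLevel_pos hM
  refine noiseKernel_eq_zero hε hM.le (hσ x) (hσS x) ?_
  by_contra hcon
  exact (notMem_disk_iff hε).2 (h1 _ (mul_pos hε hM) h2 x y ((notMem_disk_iff hε).1 hx)
    (not_lt.1 hcon)) hy

theorem exists_isAdmissibleRadii (hf : IsSmoothCircleMap f) (hσ : ∀ x, 0 < σ x)
    {xs xu x₁ x₂ : S1} (hsu : xs ≠ xu) (h₁₂ : x₁ ≠ x₂) (hxs : f xs = xs) (hxu : f xu = xu)
    (hx₁ : f x₁ = x₂) (hx₂ : f x₂ = x₁) (hcs : 1 < |circleDeriv f xs|)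
    (hcu : 1 < |circleDeriv f xu|) (hc : |circleDeriv f x₁ * circleDeriv f x₂| < 1)
    (hattr : ∀ x : S1, x ≠ xs → x ≠ xu →
      Tendsto (fun n : ℕ => Metric.infDist (f^[n] x) {x₁, x₂}) atTop (𝓝 0)) :
    ∃ Rs Ru R₁ R₂, IsAdmissibleRadii f σ xs xu x₁ x₂ Rs Ru R₁ R₂ := by
  obtain ⟨_, _, S, hS, hσS⟩ := exists_forall_le_and_pos hσ
  have hσS : ∀ x, σ x ≤ S := fun x => (hσS x).2
  have hfix : ∀ p, f p = p → p ≠ x₁ ∧ p ≠ x₂ := fun p hp =>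
    ⟨fun h => h₁₂ (by rw [← hx₁, ← h, hp]), fun h => h₁₂ (by rw [← hx₂, ← h, hp])⟩
  rw [abs_mul] at hc
  obtain ⟨τ, hτ, R₁, hR₁, R₂, hR₂, h₁, h₂⟩ :=
    exists_contracting_radii (abs_nonneg _) (abs_nonneg _) hc hS
  obtain ⟨δ₁, hδ₁, d₁⟩ := exists_dist_expansion hf x₁ hτ
  obtain ⟨δ₂, hδ₂, d₂⟩ := exists_dist_expansion hf x₂ hτ
  obtain ⟨δs, hδs, ds⟩ := exists_dist_expansion hf xs
    (τ := (|circleDeriv f xs| - 1) / 2) (by linarith)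
  obtain ⟨δu, hδu, du⟩ := exists_dist_expansion hf xu
    (τ := (|circleDeriv f xu| - 1) / 2) (by linarith)
  rw [hx₁] at d₁
  rw [hx₂] at d₂
  have radius : ∀ c : ℝ, 1 < c → 0 < 4 * S / (c - 1) ∧
      S < (c - (c - 1) / 2 - 1) * (4 * S / (c - 1)) ∧
      S + 4 * S / (c - 1) ≤ c * (4 * S / (c - 1)) := by
    intro c hc
    have h0 : 0 < c - 1 := by linarith
    have h1 : 4 * S / (c - 1) * (c - 1) = 4 * S := div_mul_cancel₀ _ h0.ne'
    exact ⟨by positivity, by nlinarith, by nlinarith⟩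
  obtain ⟨ps, rs, es⟩ := radius _ hcs
  obtain ⟨pu, ru, eu⟩ := radius _ hcu
  have hxsn := fun x => eq_of_map_eq_of_attracted (x := x) hsu hxs hxu (hfix xs hxs).1
    (hfix xs hxs).2 hattr
  have hxun := fun x => eq_of_map_eq_of_attracted (x := x) hsu.symm hxu hxs (hfix xu hxu).1
    (hfix xu hxu).2 (fun x h h' => hattr x h' h)
  refine ⟨4 * S / (|circleDeriv f xs| - 1), 4 * S / (|circleDeriv f xu| - 1), R₁, R₂, ps, pu, hR₁,
    hR₂, by linarith [hσS xs], by linarith [hσS xu], ?_, ?_, ?_, ?_, ?_⟩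
  · nlinarith [hσS x₁]
  · nlinarith [hσS x₂]
  · exact eventually_no_return hσ hS hσS hxs hxsn hδs (by linarith) (fun x hx => (ds x hx).1) ps rs
  · exact eventually_no_return hσ hS hσS hxu hxun hδu (by linarith) (fun x hx => (du x hx).1) pu ru
  · set δ := min (min δ₁ δ₂) (min δs δu)
    have hδ : 0 < δ := lt_min (lt_min hδ₁ hδ₂) (lt_min hδs hδu)
    have l₁ : δ ≤ δ₁ := (min_le_left _ _).trans (min_le_left _ _)
    have l₂ : δ ≤ δ₂ := (min_le_left _ _).trans (min_le_right _ _)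
    have ls : δ ≤ δs := (min_le_right _ _).trans (min_le_left _ _)
    have lu : δ ≤ δu := (min_le_right _ _).trans (min_le_right _ _)
    have ds' := fun x hx => (ds x hx).1
    have du' := fun x hx => (du x hx).1
    rw [hxs] at ds'
    rw [hxu] at du'
    obtain ⟨η₀, hη₀, h3⟩ := exists_chain_bound f.continuous hsu hxs hxu hδ
      (fun x hx => ds' x (hx.trans ls)) (fun x hx => du' x (hx.trans lu)) ps pu hS rs ru
      (by positivity) (by positivity) (fun x hx => (d₁ x (hx.trans l₁)).2)
      (fun x hx => (d₂ x (hx.trans l₂)).2) hR₁ hR₂ h₁ h₂ hattr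
    filter_upwards [eventually_noiseLevel_mul_self_lt hη₀, eventually_gt_atTop 0] with M h4 hM
    have hε := noiseLevel_pos hM
    obtain ⟨n, hn⟩ := h3 _ (mul_pos hε hM) h4
    refine ⟨n, fun c hcc => ?_⟩
    obtain ⟨i, hi, h5⟩ := hn c fun i hi => by
      obtain ⟨a1, a2, a3, a4⟩ := hcc i hi
      exact ⟨(notMem_disk_iff hε).1 a1, (notMem_disk_iff hε).1 a2, (notMem_disk_iff hε).1 a3,
        (notMem_disk_iff hε).1 a4⟩
    exact ⟨i, hi, noiseKernel_eq_zero hε hM.le (hσ _) (hσS _) h5⟩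

end Geometry

/-! ### Errors below the noise level and separation of eigenvalues. -/

section LocalAsymptotics

/-- Cut-off Hermite functions on intervals that grow linearly in `M`. -/
theorem exists_isCutHermite_family (J : ℕ) {α R : ℝ} (hα : 0 < α) (hR : 0 < R) :
    ∃ C > 0, ∃ κ > 0, ∃ e : ℝ → ℕ → ℝ → ℝ, ∀ᶠ M : ℝ in atTop,
      IsCutHermite J α (R * M) C κ (e M) := by
  obtain ⟨C, hC, κ, hκ, h⟩ := exists_isCutHermite J hα
  choose! e he using h
  refine ⟨C, hC, κ, hκ, fun M => e (R * M), ?_⟩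
  filter_upwards [(tendsto_id.const_mul_atTop hR).eventually_ge_atTop 1] with M hM
  exact he _ hM

/-- This lets the cut-off error of the profiles count as `O(ε)` with constant one. -/
theorem eventually_exp_neg_sq_le (C : ℝ) {κ R : ℝ} (hC : 0 ≤ C) (hκ : 0 < κ) (hR : 0 < R) :
    ∀ᶠ M : ℝ in atTop, C * Real.exp (-κ * (R * M) ^ 2) ≤ noiseLevel M := by
  filter_upwards [eventually_pow_mul_exp_le C 4 one_pos, eventually_gt_atTop 0,
    eventually_ge_atTop (κ * R ^ 2)⁻¹] with M h1 hM h2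
  have h3 : 1 ≤ κ * R ^ 2 * M := by
    rwa [inv_le_iff_one_le_mul₀' (by positivity)] at h2
  have h4 : Real.exp (-κ * (R * M) ^ 2) ≤ Real.exp (-M) := by
    refine Real.exp_le_exp.2 ?_
    nlinarith
  rw [noiseLevel, ← one_div, le_div_iff₀ (by positivity)]
  calc C * Real.exp (-κ * (R * M) ^ 2) * M ^ 4 ≤ C * Real.exp (-M) * M ^ 4 := by gcongr
    _ ≤ 1 := by linarith

theorem IsCutHermite.abs_sub_profile_le {J : ℕ} {α A C κ κ' ε : ℝ} {e : ℕ → ℝ → ℝ}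
    (he : IsCutHermite J α A C κ e) (hC : C * Real.exp (-κ * A ^ 2) ≤ ε) (hκ : κ' ≤ κ) {j : ℕ}
    (hj : j < J) (p x : S1) :
    |e j (coord ε p x) - profile j α ε p x| ≤ ε * gaussWeight κ' ε p x := by
  have h1 := he.approx j hj (coord ε p x)
  have h2 : profile j α ε p x = hermiteFn j (α * coord ε p x) := by
    rw [profile, coord, mul_div_assoc]
  rw [h2]
  refine h1.trans (mul_le_mul hC ?_ (Real.exp_pos _).le ?_)
  · rw [gaussWeight, dist_eq_abs_rep, sq_abs, coord]
    refine Real.exp_le_exp.2 ?_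
    rw [mul_div_assoc, ← div_pow]
    nlinarith [sq_nonneg (rep (x - p) / ε)]
  · have h3 := (abs_nonneg _).trans h1
    have h4 : 0 ≤ C * Real.exp (-κ * A ^ 2) := by
      by_contra h5
      exact absurd h3 (not_le.2 (mul_neg_of_neg_of_pos (not_le.1 h5) (Real.exp_pos _)))
    exact h4.trans hC

theorem eventually_forall_lt (J : ℕ) {P : ℕ → ℝ → Prop} (h : ∀ i < J, ∀ᶠ M in atTop, P i M) :
    ∀ᶠ M in atTop, ∀ i < J, P i M :=
  (Filter.eventually_all_finite (Set.finite_Iio J)).2 h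

theorem tendsto_add_mul_exp_neg (a u : ℝ) :
    Tendsto (fun M : ℝ => a + u * Real.exp (-M)) atTop (𝓝 a) := by
  have := ((Real.tendsto_exp_neg_atTop_nhds_zero).const_mul u).const_add a
  simpa using this

/-- If the limits differ the values separate by continuity; if they agree, the different shifts
separate them. This removes resonances between the two repelling points. -/
theorem eventually_add_mul_exp_ne (a b : ℝ) {u v : ℝ} (huv : u ≠ v) :
    ∀ᶠ M : ℝ in atTop, a + u * Real.exp (-M) ≠ b + v * Real.exp (-M) := by
  by_cases hab : a = b
  · refine Eventually.of_forall fun M h => huv ?_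
    rw [hab] at h
    exact mul_right_cancel₀ (Real.exp_pos (-M)).ne' (add_left_cancel h)
  · have h1 := (tendsto_add_mul_exp_neg a u).sub (tendsto_add_mul_exp_neg b v)
    filter_upwards [h1.eventually_ne (sub_ne_zero.2 hab)] with M h2 using sub_ne_zero.1 h2

/-- A nonzero shift moves the value off both square roots of `q`, removing resonances with the
attracting cycle. -/
theorem eventually_sq_ne (m q : ℝ) {u : ℝ} (hu : u ≠ 0) :
    ∀ᶠ M : ℝ in atTop, (m + u * Real.exp (-M)) ^ 2 ≠ q := by
  filter_upwards [eventually_add_mul_exp_ne m (√q) hu, eventually_add_mul_exp_ne m (-√q) hu]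
    with M h1 h2 h3
  rw [zero_mul, add_zero] at h1 h2
  have h4 : √q = |m + u * Real.exp (-M)| := by rw [← h3, Real.sqrt_sq_eq_abs]
  rcases abs_choice (m + u * Real.exp (-M)) with h5 | h5
  · exact h1 (by rw [h4, h5])
  · exact h2 (by rw [h4, h5, neg_neg])

variable {f : C(S1, S1)} {σ : C(S1, ℝ)}

theorem eventually_repeller_row (hf : IsSmoothCircleMap f) (hσ : ∀ x, 0 < σ x) {p : S1}
    (hp : f p = p) (R B : ℝ) (J : ℕ) {τ : ℝ} (hτ : 0 < τ) :
    ∀ᶠ M : ℝ in atTop, ∀ (ν : ℕ → ℝ) (e : ℕ → ℝ → ℝ) (C κ : ℝ),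
      IsCutHermite J (betaScale (circleDeriv f p) (σ p)) (R * M) C κ e →
      (∀ x y, |blockLine J (betaScale (circleDeriv f p) (σ p)) (R * M) (σ p)⁻¹
        (circleDeriv f p / σ p) (σ p)⁻¹ M ν e e x y
        - (σ p)⁻¹ * cutG M (circleDeriv f p / σ p * y - (σ p)⁻¹ * x)|
        ≤ B * M ^ J * Real.exp (-M)) →
      IsBddKernel (repellerKernel f σ (noiseLevel M) M R J ν e p) ∧
      ∀ x ∈ disk (noiseLevel M) (R * M) p, ∀ φ : BddMeas, ‖stepMean f σ (noiseLevel M) φ x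
        - ∫ y, (repellerKernel f σ (noiseLevel M) M R J ν e p x y : ℂ) * φ y‖ ≤ τ * ‖φ‖ := by
  filter_upwards [eventually_local_row hf hσ p R B J hτ, eventually_gt_atTop 0]
    with M hrow hM ν e C κ he hB
  have hε := noiseLevel_pos hM
  have hbdd : IsBddKernel (repellerKernel f σ (noiseLevel M) M R J ν e p) :=
    (isBddKernel_mul_blockLine he he hB hε p p).swap
  refine ⟨hbdd, fun x hx φ => hrow x hx _ (hbdd.measurable_right x) (fun y => ?_) φ⟩
  rw [repellerKernel, ← mul_sub, abs_mul, abs_of_pos (inv_pos.2 hε), hp]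
  refine mul_le_mul_of_nonneg_left ?_ (inv_pos.2 hε).le
  refine le_trans (le_of_eq ?_) (hB (coord (noiseLevel M) p y) (coord (noiseLevel M) p x))
  congr 3
  -- The linearised density is written in the opposite sign convention; the truncated Gaussian is
  -- even.
  rw [← cutG_neg]
  congr 1
  ring

theorem eventually_attractor_row (hf : IsSmoothCircleMap f) (hσ : ∀ x, 0 < σ x) {p q : S1}
    (hp : f p = q) (R R' B α α' : ℝ) (J : ℕ) {τ : ℝ} (hτ : 0 < τ) :
    ∀ᶠ M : ℝ in atTop, ∀ (ν : ℕ → ℝ) (e e' : ℕ → ℝ → ℝ) (C κ C' κ' : ℝ),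
      IsCutHermite J α (R * M) C κ e → IsCutHermite J α' (R' * M) C' κ' e' →
      (∀ x y, |blockLine J α (R * M) (σ p)⁻¹ (σ p)⁻¹ (circleDeriv f p / σ p) M ν e e' x y
        - (σ p)⁻¹ * cutG M ((σ p)⁻¹ * y - circleDeriv f p / σ p * x)|
        ≤ B * M ^ J * Real.exp (-M)) →
      IsBddKernel (attractorKernel f σ α (noiseLevel M) M R J ν e e' p q) ∧
      ∀ x ∈ disk (noiseLevel M) (R * M) p, ∀ φ : BddMeas, ‖stepMean f σ (noiseLevel M) φ x
        - ∫ y, (attractorKernel f σ α (noiseLevel M) M R J ν e e' p q x y : ℂ) * φ y‖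
          ≤ τ * ‖φ‖ := by
  filter_upwards [eventually_local_row hf hσ p R B J hτ, eventually_gt_atTop 0]
    with M hrow hM ν e e' C κ C' κ' he he' hB
  have hε := noiseLevel_pos hM
  have hbdd : IsBddKernel (attractorKernel f σ α (noiseLevel M) M R J ν e e' p q) :=
    isBddKernel_mul_blockLine he he' hB hε p q
  refine ⟨hbdd, fun x hx φ => hrow x hx _ (hbdd.measurable_right x) (fun y => ?_) φ⟩
  rw [attractorKernel, ← mul_sub, abs_mul, abs_of_pos (inv_pos.2 hε), hp]
  refine mul_le_mul_of_nonneg_left ?_ (inv_pos.2 hε).le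
  refine le_trans (le_of_eq ?_) (hB (coord (noiseLevel M) p x) (coord (noiseLevel M) q y))
  congr 4
  ring

end LocalAsymptotics

/-! ### From the spectral data of the kernel to the decomposition of the operator. -/

section Model

variable {f : C(S1, S1)} {σ : C(S1, ℝ)} {r κ ε : ℝ} {J : ℕ} {K : S1 → S1 → ℝ} {U₁ U₂ V : Set S1}
  {νs νu ν₁ ν₂ : ℕ → ℝ} {es eu e₁ e₂ : ℕ → S1 → ℝ}

theorem norm_mul_sub_mul_le {c : ℂ} {u v w : ℝ} (h : |u - v| ≤ w) :
    ‖c * (u : ℂ) - c * (v : ℂ)‖ ≤ w * ‖c‖ := by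
  rw [← mul_sub, norm_mul, ← Complex.ofReal_sub, Complex.norm_real, Real.norm_eq_abs, mul_comm]
  exact mul_le_mul_of_nonneg_right h (norm_nonneg _)

theorem HasSplitSpectrum.isUnstableEigenvalue
    (h : HasSplitSpectrum volume K U₁ U₂ V r J νs νu ν₁ ν₂ es eu e₁ e₂) (hK : IsBddKernel K)
    {p : S1} (happ : ∀ j < J, ∀ x, |es j x - profile j (betaScale (circleDeriv f p) (σ p)) ε p x|
      ≤ ε * gaussWeight κ ε p x)
    (hnear : ∀ j < J, |νs j - |circleDeriv f p|⁻¹ * (circleDeriv f p ^ j)⁻¹| ≤ ε) {j : ℕ}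
    (hj : j < J) (hl : r < |νs j|) :
    IsUnstableEigenvalue f σ 1 1 κ ε (kernelOp hK) p j (νs j) := by
  refine ⟨?_, ?_, fun φ hφ => ?_⟩
  · obtain ⟨φ, hφ0, hφ⟩ := h.exists_right hj (abs_pos.1 (h.pos.trans hl))
    exact hasEigenvalue_of_isKernelEigen hK hφ hφ0
  · rw [← Complex.ofReal_sub, Complex.norm_real, one_mul]
    exact hnear j hj
  · obtain ⟨a, ha⟩ := h.right_eq hj hl (isKernelEigen_of_hasEigenvector hK hφ).1
    refine ⟨a, fun x => ?_⟩
    rw [ha x, one_mul]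
    refine (norm_mul_sub_mul_le (happ j hj x)).trans (le_of_eq ?_)
    ring

/-- Attractor eigenvalues are exact, so `lam` is its own limiting value. Only the density is
explicit; that `lam` is an eigenvalue on functions comes from the Fredholm alternative. -/
theorem HasSplitSpectrum.isStableEigenvalue
    (h : HasSplitSpectrum volume K U₁ U₂ V r J νs νu ν₁ ν₂ es eu e₁ e₂) (hK : IsBddKernel K)
    (hε : 0 ≤ ε) {x₁ x₂ : S1}
    (happ₁ : ∀ j < J, ∀ x, |e₁ j x - profile j (alphaScale (circleDeriv f x₁) (circleDeriv f x₂)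
      (σ x₁) (σ x₂)) ε x₁ x| ≤ ε * gaussWeight κ ε x₁ x)
    (happ₂ : ∀ j < J, ∀ x, |e₂ j x - profile j (alphaScale (circleDeriv f x₂) (circleDeriv f x₁)
      (σ x₂) (σ x₁)) ε x₂ x| ≤ ε * gaussWeight κ ε x₂ x) {j : ℕ}
    (hj : j < J) {lam : ℂ} (hl : r < ‖lam‖) (hlam : lam ^ 2 = ν₁ j * ν₂ j) :
    IsStableEigenvalue f σ 1 1 κ ε (kernelOp hK) x₁ x₂ j lam lam := by
  have hl0 : lam ≠ 0 := norm_pos_iff.1 (h.pos.trans hl)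
  obtain ⟨g, hg0, hg⟩ := h.exists_left hj hl0 hlam
  refine ⟨?_, ?_, ⟨g, isEigendensity_of_isKernelEigen hK hl0 hg hg0⟩, fun g hg => ?_⟩
  · obtain ⟨φ, hφ0, hφ⟩ := exists_eigen_of_transpose hK hl0 hg hg0
    exact hasEigenvalue_of_isKernelEigen hK hφ hφ0
  · simpa using hε
  · obtain ⟨ψ, hψ, hψg⟩ := exists_isKernelEigen_of_isEigendensity hK hl0 hg
    obtain ⟨c, d, hcd⟩ := h.left_eq hj hl hlam hψ
    refine ⟨c, d, ?_⟩
    filter_upwards [hψg] with x hx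
    rw [← hx, hcd x, one_mul, add_sub_add_comm]
    refine (norm_add_le _ _).trans ((add_le_add (norm_mul_sub_mul_le (happ₁ j hj x))
      (norm_mul_sub_mul_le (happ₂ j hj x))).trans (le_of_eq ?_))
    ring

/-- A kernel near the transition kernel with explicit leading spectral data. -/
structure IsModel (f : C(S1, S1)) (σ : C(S1, ℝ)) (xs xu x₁ x₂ : S1) (r κ ε : ℝ) (J : ℕ)
    (K : S1 → S1 → ℝ) (U₁ U₂ V : Set S1) (νs νu ν₁ ν₂ : ℕ → ℝ) (es eu e₁ e₂ : ℕ → S1 → ℝ) :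
    Prop where
  spectrum : HasSplitSpectrum volume K U₁ U₂ V r J νs νu ν₁ ν₂ es eu e₁ e₂
  row : ∀ (φ : BddMeas) x, ‖stepMean f σ ε φ x - kerInt volume K φ x‖ ≤ r / 2 * ‖φ‖
  approx_s : ∀ j < J, ∀ x, |es j x - profile j (betaScale (circleDeriv f xs) (σ xs)) ε xs x|
    ≤ ε * gaussWeight κ ε xs x
  approx_u : ∀ j < J, ∀ x, |eu j x - profile j (betaScale (circleDeriv f xu) (σ xu)) ε xu x|
    ≤ ε * gaussWeight κ ε xu x
  approx₁ : ∀ j < J, ∀ x, |e₁ j x - profile j (alphaScale (circleDeriv f x₁) (circleDeriv f x₂)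
    (σ x₁) (σ x₂)) ε x₁ x| ≤ ε * gaussWeight κ ε x₁ x
  approx₂ : ∀ j < J, ∀ x, |e₂ j x - profile j (alphaScale (circleDeriv f x₂) (circleDeriv f x₁)
    (σ x₂) (σ x₁)) ε x₂ x| ≤ ε * gaussWeight κ ε x₂ x
  near_s : ∀ j < J, |νs j - |circleDeriv f xs|⁻¹ * (circleDeriv f xs ^ j)⁻¹| ≤ ε
  near_u : ∀ j < J, |νu j - |circleDeriv f xu|⁻¹ * (circleDeriv f xu ^ j)⁻¹| ≤ ε
  mult : ∀ j < J, ν₁ j * ν₂ j = (circleDeriv f x₁ * circleDeriv f x₂) ^ j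
  large_s : ∀ j < J, r < |circleDeriv f xs|⁻¹ * (|circleDeriv f xs| ^ j)⁻¹ → r < |νs j|
  large_u : ∀ j < J, r < |circleDeriv f xu|⁻¹ * (|circleDeriv f xu| ^ j)⁻¹ → r < |νu j|
  small_s : ∀ n, J ≤ n → |circleDeriv f xs|⁻¹ * (|circleDeriv f xs| ^ n)⁻¹ ≤ r
  small_u : ∀ n, J ≤ n → |circleDeriv f xu|⁻¹ * (|circleDeriv f xu| ^ n)⁻¹ ≤ r
  small_V : ∀ n, J ≤ n → |circleDeriv f x₁ * circleDeriv f x₂| ^ n ≤ r ^ 2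

theorem IsModel.exists_decomposition {xs xu x₁ x₂ : S1}
    (h : IsModel f σ xs xu x₁ x₂ r κ ε J K U₁ U₂ V νs νu ν₁ ν₂ es eu e₁ e₂) (hε : 0 < ε) :
    ∃ Tlp Tup : BddMeas →L[ℂ] BddMeas,
      IsRealOp Tlp ∧ IsRealOp Tup ∧ transitionOp f σ ε = Tlp + Tup ∧ ‖Tlp‖ < r ∧
      (∀ lam : ℂ, Module.End.HasEigenvalue (Tup : BddMeas →ₗ[ℂ] BddMeas) lam → r < ‖lam‖ →
        (∃ (j : ℕ) (z : ℂ),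
          z ^ 2 = (((circleDeriv f x₁ * circleDeriv f x₂) ^ j : ℝ) : ℂ) ∧
          IsStableEigenvalue f σ 1 1 κ ε Tup x₁ x₂ j z lam) ∨
        (∃ (p : S1) (j : ℕ), (p = xs ∨ p = xu) ∧
          IsUnstableEigenvalue f σ 1 1 κ ε Tup p j lam)) ∧
      (∀ (j : ℕ) (z : ℂ),
        z ^ 2 = (((circleDeriv f x₁ * circleDeriv f x₂) ^ j : ℝ) : ℂ) → r < ‖z‖ →
        ∃ lam : ℂ, IsStableEigenvalue f σ 1 1 κ ε Tup x₁ x₂ j z lam) ∧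
      (∀ (p : S1) (j : ℕ), p = xs ∨ p = xu →
        r < |circleDeriv f p|⁻¹ * (|circleDeriv f p| ^ j)⁻¹ →
        ∃ lam : ℂ, IsUnstableEigenvalue f σ 1 1 κ ε Tup p j lam) := by
  have hK := h.spectrum.split.kernel
  have hr := h.spectrum.pos
  have stable : ∀ j < J, ∀ z : ℂ, z ^ 2 = (((circleDeriv f x₁ * circleDeriv f x₂) ^ j : ℝ) : ℂ) →
      r < ‖z‖ → IsStableEigenvalue f σ 1 1 κ ε (kernelOp hK) x₁ x₂ j z z := by
    intro j hj z hz hl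
    refine h.spectrum.isStableEigenvalue hK hε.le h.approx₁ h.approx₂ hj hl ?_
    rw [hz, ← h.mult j hj, Complex.ofReal_mul]
  have uns : ∀ j < J, r < |νs j| → IsUnstableEigenvalue f σ 1 1 κ ε (kernelOp hK) xs j (νs j) :=
    fun j hj hl => h.spectrum.isUnstableEigenvalue hK h.approx_s h.near_s hj hl
  have unu : ∀ j < J, r < |νu j| → IsUnstableEigenvalue f σ 1 1 κ ε (kernelOp hK) xu j (νu j) :=
    fun j hj hl => h.spectrum.swap.isUnstableEigenvalue hK h.approx_u h.near_u hj hl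
  refine ⟨transitionOp f σ ε - kernelOp hK, kernelOp hK,
    (isRealOp_transitionOp f σ ε).sub (isRealOp_kernelOp hK), isRealOp_kernelOp hK,
    (sub_add_cancel _ _).symm,
    (norm_transitionOp_sub_le hK (by linarith) h.row).trans_lt (by linarith),
    fun lam hlam hl => ?_, fun j z hz hl => ⟨z, stable j ?_ z hz hl⟩, ?_⟩
  · by_cases hV : ∃ j < J, lam ^ 2 = ν₁ j * ν₂ j
    · obtain ⟨j, hj, hlj⟩ := hV
      have hz : lam ^ 2 = (((circleDeriv f x₁ * circleDeriv f x₂) ^ j : ℝ) : ℂ) := by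
        rw [hlj, ← h.mult j hj, Complex.ofReal_mul]
      exact Or.inl ⟨j, lam, hz, stable j hj lam hz hl⟩
    · push Not at hV
      obtain ⟨φ, hφ0, hφ⟩ := exists_isKernelEigen_of_hasEigenvalue hK hlam
      refine Or.inr ?_
      rcases h.spectrum.exists_of_ne hl hV hφ hφ0 with ⟨j, hj, rfl⟩ | ⟨j, hj, rfl⟩
      · rw [Complex.norm_real] at hl
        exact ⟨xs, j, Or.inl rfl, uns j hj hl⟩
      · rw [Complex.norm_real] at hl
        exact ⟨xu, j, Or.inr rfl, unu j hj hl⟩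
  -- From index `J` on all limiting values have modulus at most `r`.
  · by_contra hj
    have h1 : ‖z‖ ^ 2 = |circleDeriv f x₁ * circleDeriv f x₂| ^ j := by
      rw [← norm_pow, hz, Complex.norm_real, Real.norm_eq_abs, abs_pow]
    have h2 := h.small_V j (not_lt.1 hj)
    rw [← h1] at h2
    exact absurd (pow_lt_pow_left₀ hl hr.le two_ne_zero) (not_lt.2 h2)
  · rintro p j (rfl | rfl) hl
    · have hj : j < J := by
        by_contra hj
        exact absurd hl (not_lt.2 (h.small_s j (not_lt.1 hj)))
      exact ⟨_, uns j hj (h.large_s j hj hl)⟩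
    · have hj : j < J := by
        by_contra hj
        exact absurd hl (not_lt.2 (h.small_u j (not_lt.1 hj)))
      exact ⟨_, unu j hj (h.large_u j hj hl)⟩

end Model

/-! ### Assembly of the model kernel. -/

section Existence

variable {f : C(S1, S1)} {σ : C(S1, ℝ)}

theorem exists_repeller_family (hσ : ∀ x, 0 < σ x) {p : S1} (hc : 1 < |circleDeriv f p|) {R : ℝ}
    (hR : 0 < R) (J : ℕ) {t : ℝ} (ht : 0 ≤ t) :
    ∃ C > 0, ∃ κ > 0, ∃ B : ℝ, ∃ e : ℝ → ℕ → ℝ → ℝ, ∀ᶠ M : ℝ in atTop,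
      IsCutHermite J (betaScale (circleDeriv f p) (σ p)) (R * M) C κ (e M) ∧
      ∀ ν : ℕ → ℝ, (∀ j < J, |ν j - |circleDeriv f p|⁻¹ * (circleDeriv f p ^ j)⁻¹|
          ≤ t * Real.exp (-M)) → ∀ x y,
        |blockLine J (betaScale (circleDeriv f p) (σ p)) (R * M) (σ p)⁻¹
          (circleDeriv f p / σ p) (σ p)⁻¹ M ν (e M) (e M) x y
          - (σ p)⁻¹ * cutG M (circleDeriv f p / σ p * y - (σ p)⁻¹ * x)|
          ≤ B * M ^ J * Real.exp (-M) := by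
  have hβ := betaScale_pos hc (hσ p)
  have hc0 : circleDeriv f p ≠ 0 := fun h => by rw [h, abs_zero] at hc; linarith
  obtain ⟨C, hC, κ, hκ, e, he⟩ := exists_isCutHermite_family J hβ hR
  obtain ⟨B, -, M₀, -, hB⟩ := exists_blockLine_sub_le J hβ hβ (div_ne_zero hc0 (hσ p).ne')
    (betaScale_rel hc (hσ p)) (inv_pos.2 (hσ p)).le hR hR hC hκ hC hκ ht
  refine ⟨C, hC, κ, hκ, B, e, ?_⟩
  filter_upwards [he, eventually_ge_atTop M₀] with M h1 h2
  refine ⟨h1, fun ν hν => hB M h2 _ _ ν h1 h1 fun j hj => ?_⟩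
  rw [hermMult_repeller hc0 (hσ p) hβ]
  exact hν j hj

/-- Here the multiplier is taken to be exactly `hermMult`; shifting the repeller eigenvalues alone
already separates the blocks. -/
theorem eventually_attractor_blockLine {c c' s s' R R' C κ C' κ' : ℝ} (hcc : |c * c'| < 1)
    (hs : 0 < s) (hs' : 0 < s') (hR : 0 < R) (hR' : 0 < R') (hC : 0 < C) (hκ : 0 < κ) (hC' : 0 < C')
    (hκ' : 0 < κ') (J : ℕ) : ∃ B : ℝ, ∀ᶠ M : ℝ in atTop, ∀ e e' : ℕ → ℝ → ℝ,
      IsCutHermite J (alphaScale c c' s s') (R * M) C κ e →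
      IsCutHermite J (alphaScale c' c s' s) (R' * M) C' κ' e' → ∀ x y,
      |blockLine J (alphaScale c c' s s') (R * M) s⁻¹ s⁻¹ (c / s) M
        (hermMult (alphaScale c c' s s') (alphaScale c' c s' s) s⁻¹ s⁻¹ (c / s)) e e' x y
        - s⁻¹ * cutG M (s⁻¹ * y - c / s * x)| ≤ B * M ^ J * Real.exp (-M) := by
  obtain ⟨B, -, M₀, -, hB⟩ := exists_blockLine_sub_le J (alphaScale_pos hcc hs')
    (alphaScale_pos (by rwa [mul_comm]) hs) (inv_ne_zero hs.ne')
    (alphaScale_rel hcc hs hs') (inv_pos.2 hs).le hR hR' hC hκ hC' hκ' le_rfl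
  refine ⟨B, ?_⟩
  filter_upwards [eventually_ge_atTop M₀] with M h2 e e' he he'
  exact hB M h2 e e' _ he he' fun j _ => by simp

theorem eventually_inv_mul_inv_pow_le {c r : ℝ} (hc : 1 < c) (hr : 0 < r) :
    ∀ᶠ n : ℕ in atTop, c⁻¹ * (c ^ n)⁻¹ ≤ r := by
  have h1 : Tendsto (fun n : ℕ => c⁻¹ * (c⁻¹) ^ n) atTop (𝓝 (c⁻¹ * 0)) :=
    (tendsto_pow_atTop_nhds_zero_of_lt_one (by positivity) (inv_lt_one_of_one_lt₀ hc)).const_mul _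
  rw [mul_zero] at h1
  filter_upwards [h1.eventually (gt_mem_nhds hr)] with n hn
  rw [← inv_pow]; exact hn.le

theorem inv_mul_inv_pow_injective {c : ℝ} (hc : 1 < |c|) {i j : ℕ}
    (h : |c|⁻¹ * (c ^ i)⁻¹ = |c|⁻¹ * (c ^ j)⁻¹) : i = j := by
  have h1 : |c|⁻¹ ≠ 0 := inv_ne_zero (by linarith)
  have h2 := inv_injective (mul_left_cancel₀ h1 h)
  have h3 : |c| ^ i = |c| ^ j := by rw [← abs_pow, ← abs_pow, h2]
  exact pow_right_injective₀ (by linarith) hc.ne' h3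

theorem eventually_lt_abs_add {m r : ℝ} (h : r < |m|) (u : ℝ) :
    ∀ᶠ M : ℝ in atTop, r < |m + u * Real.exp (-M)| :=
  ((continuous_abs.tendsto m).comp (tendsto_add_mul_exp_neg m u)).eventually (lt_mem_nhds h)

theorem pow_ne_pow_of_abs_lt_one {q : ℝ} (hq : |q| < 1) {i j : ℕ} (hij : i ≠ j) (h0 : q ^ i ≠ 0) :
    q ^ i ≠ q ^ j := by
  intro h
  by_cases hq0 : q = 0
  · subst hq0
    have hi : i = 0 := by by_contra hi; exact h0 (zero_pow hi)
    have hj : j ≠ 0 := fun hj => hij (hi.trans hj.symm)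
    rw [hi, zero_pow hj] at h
    simp at h
  · refine hij (pow_right_injective₀ (abs_pos.2 hq0) hq.ne ?_)
    simp only
    rw [← abs_pow, ← abs_pow, h]

theorem expand_scaled {s c R M : ℝ} (hs : 0 < s) (hM : 0 ≤ M) (h : s + R ≤ |c| * R) :
    M + |s⁻¹| * (R * M) ≤ |c / s| * (R * M) := by
  rw [abs_div, abs_of_pos hs, abs_of_pos (inv_pos.2 hs)]
  have h1 : M + s⁻¹ * (R * M) = (s + R) * M / s := by field_simp
  have h2 : |c| / s * (R * M) = |c| * R * M / s := by ring
  rw [h1, h2]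
  gcongr

theorem contract_scaled {s c R R' M : ℝ} (hs : 0 < s) (hM : 0 ≤ M) (h : s + |c| * R ≤ R') :
    M + |c / s| * (R * M) ≤ |s⁻¹| * (R' * M) := by
  rw [abs_div, abs_of_pos hs, abs_of_pos (inv_pos.2 hs)]
  have h1 : M + |c| / s * (R * M) = (s + |c| * R) * M / s := by field_simp
  have h2 : s⁻¹ * (R' * M) = R' * M / s := by ring
  rw [h1, h2]
  gcongr

theorem eventually_exists_model (hf : IsSmoothCircleMap f) (hσ : ∀ x, 0 < σ x)
    {xs xu x₁ x₂ : S1} (hsu : xs ≠ xu) (h₁₂ : x₁ ≠ x₂) (hxs : f xs = xs) (hxu : f xu = xu)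
    (hx₁ : f x₁ = x₂) (hx₂ : f x₂ = x₁) (hcs : 1 < |circleDeriv f xs|)
    (hcu : 1 < |circleDeriv f xu|) (hc : |circleDeriv f x₁ * circleDeriv f x₂| < 1)
    (hattr : ∀ x : S1, x ≠ xs → x ≠ xu →
      Tendsto (fun n : ℕ => Metric.infDist (f^[n] x) {x₁, x₂}) atTop (𝓝 0)) {r : ℝ} (hr : 0 < r) :
    ∃ κ > 0, ∃ J : ℕ, ∀ᶠ M : ℝ in atTop, ∃ K U₁ U₂ V νs νu ν₁ ν₂ es eu e₁ e₂,
      IsModel f σ xs xu x₁ x₂ r κ (noiseLevel M) J K U₁ U₂ V νs νu ν₁ ν₂ es eu e₁ e₂ := by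
  have hfix : ∀ p, f p = p → p ≠ x₁ ∧ p ≠ x₂ := fun p hp =>
    ⟨fun h => h₁₂ (by rw [← hx₁, ← h, hp]), fun h => h₁₂ (by rw [← hx₂, ← h, hp])⟩
  obtain ⟨Rs, Ru, R₁, R₂, hR⟩ :=
    exists_isAdmissibleRadii hf hσ hsu h₁₂ hxs hxu hx₁ hx₂ hcs hcu hc hattr
  -- `J` is chosen so that modes from order `J` on have limiting modulus at most `r` at both
  -- repellers and on the cycle.
  obtain ⟨J, hJ⟩ := eventually_atTop.1
    ((eventually_inv_mul_inv_pow_le hcs hr).and ((eventually_inv_mul_inv_pow_le hcu hr).and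
      ((tendsto_pow_atTop_nhds_zero_of_lt_one (abs_nonneg _) hc).eventually
        (gt_mem_nhds (by positivity : 0 < r ^ 2)))))
  set cs := circleDeriv f xs with hcs'
  set cu := circleDeriv f xu with hcu'
  set c₁ := circleDeriv f x₁ with hc₁'
  set c₂ := circleDeriv f x₂ with hc₂'
  have hc' : |c₂ * c₁| < 1 := by rwa [mul_comm]
  set α₁ := alphaScale c₁ c₂ (σ x₁) (σ x₂) with hα₁'
  set α₂ := alphaScale c₂ c₁ (σ x₂) (σ x₁) with hα₂'
  have hα₁ : 0 < α₁ := alphaScale_pos hc (hσ x₂)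
  have hα₂ : 0 < α₂ := alphaScale_pos hc' (hσ x₁)
  obtain ⟨Cs, hCs, κs, hκs, Bs, es, hes⟩ :=
    exists_repeller_family hσ hcs hR.pos_s J (zero_le_one' ℝ)
  -- The bounds `1` and `2` on the shifts allow different perturbations `e^{-M}` and `2 e^{-M}` at
  -- the two repelling points.
  obtain ⟨Cu, hCu, κu, hκu, Bu, eu, heu⟩ :=
    exists_repeller_family hσ hcu hR.pos_u J (zero_le_two : (0 : ℝ) ≤ 2)
  obtain ⟨C₁, hC₁, κ₁, hκ₁, e₁, he₁⟩ := exists_isCutHermite_family J hα₁ hR.pos₁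
  obtain ⟨C₂, hC₂, κ₂, hκ₂, e₂, he₂⟩ := exists_isCutHermite_family J hα₂ hR.pos₂
  obtain ⟨B₁, hB₁⟩ := eventually_attractor_blockLine hc (hσ x₁) (hσ x₂) hR.pos₁ hR.pos₂ hC₁ hκ₁
    hC₂ hκ₂ J
  obtain ⟨B₂, hB₂⟩ := eventually_attractor_blockLine hc' (hσ x₂) (hσ x₁) hR.pos₂ hR.pos₁ hC₂ hκ₂
    hC₁ hκ₁ J
  have hr2 : 0 < r / 2 := by positivity
  have ne_su := eventually_forall_lt J fun i _ => eventually_forall_lt J fun j _ =>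
    eventually_add_mul_exp_ne (|cs|⁻¹ * (cs ^ i)⁻¹) (|cu|⁻¹ * (cu ^ j)⁻¹) one_lt_two.ne
  have ne_sV := eventually_forall_lt J fun i _ => eventually_forall_lt J fun j _ =>
    eventually_sq_ne (|cs|⁻¹ * (cs ^ i)⁻¹) ((c₁ * c₂) ^ j) one_ne_zero
  have ne_uV := eventually_forall_lt J fun i _ => eventually_forall_lt J fun j _ =>
    eventually_sq_ne (|cu|⁻¹ * (cu ^ i)⁻¹) ((c₁ * c₂) ^ j) two_ne_zero
  have large : ∀ c u : ℝ, ∀ᶠ M : ℝ in atTop, ∀ j < J, r < |c|⁻¹ * (|c| ^ j)⁻¹ →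
      r < |(|c|⁻¹ * (c ^ j)⁻¹ + u * Real.exp (-M))| := by
    intro c u
    refine eventually_forall_lt J fun j _ => ?_
    by_cases h : r < |c|⁻¹ * (|c| ^ j)⁻¹
    · have h1 : r < |(|c|⁻¹ * (c ^ j)⁻¹)| := by
        rwa [abs_mul, abs_inv, abs_abs, abs_inv, abs_pow]
      filter_upwards [eventually_lt_abs_add h1 u] with M hM _ using hM
    · exact Eventually.of_forall fun M h' => absurd h' h
  refine ⟨min (min κs κu) (min κ₁ κ₂), lt_min (lt_min hκs hκu) (lt_min hκ₁ hκ₂), J, ?_⟩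
  have lκs : min (min κs κu) (min κ₁ κ₂) ≤ κs := (min_le_left _ _).trans (min_le_left _ _)
  have lκu : min (min κs κu) (min κ₁ κ₂) ≤ κu := (min_le_left _ _).trans (min_le_right _ _)
  have lκ₁ : min (min κs κu) (min κ₁ κ₂) ≤ κ₁ := (min_le_right _ _).trans (min_le_left _ _)
  have lκ₂ : min (min κs κu) (min κ₁ κ₂) ≤ κ₂ := (min_le_right _ _).trans (min_le_right _ _)
  -- The two disjointness conditions with enlarged radii `|c| R + σ` prevent one step from a
  -- repelling arc from reaching the other repelling arc.
  filter_upwards [eventually_gt_atTop 0, hes, heu, he₁, he₂, hB₁, hB₂, ne_su, ne_sV, ne_uV,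
    large cs 1, large cu 2, hR.no_return_s, hR.no_return_u, hR.chain,
    eventually_disjoint_disk hsu Rs Ru,
    eventually_disjoint_disk hsu (|cs| * Rs + σ xs) Ru,
    eventually_disjoint_disk hsu.symm (|cu| * Ru + σ xu) Rs,
    eventually_disjoint_disk (hfix xs hxs).1 Rs R₁, eventually_disjoint_disk (hfix xs hxs).2 Rs R₂,
    eventually_disjoint_disk (hfix xu hxu).1 Ru R₁, eventually_disjoint_disk (hfix xu hxu).2 Ru R₂,
    eventually_disjoint_disk h₁₂ R₁ R₂,
    eventually_exp_neg_sq_le Cs hCs.le hκs hR.pos_s, eventually_exp_neg_sq_le Cu hCu.le hκu hR.pos_u,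
    eventually_exp_neg_sq_le C₁ hC₁.le hκ₁ hR.pos₁, eventually_exp_neg_sq_le C₂ hC₂.le hκ₂ hR.pos₂,
    eventually_noiseLevel_mul_le Rs zero_lt_three, eventually_noiseLevel_mul_le Ru zero_lt_three,
    eventually_noiseLevel_mul_le R₁ zero_lt_three, eventually_noiseLevel_mul_le R₂ zero_lt_three,
    eventually_repeller_row hf hσ hxs Rs Bs J hr2, eventually_repeller_row hf hσ hxu Ru Bu J hr2,
    eventually_attractor_row hf hσ hx₁ R₁ R₂ B₁ α₁ α₂ J hr2,
    eventually_attractor_row hf hσ hx₂ R₂ R₁ B₂ α₂ α₁ J hr2,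
    eventually_noiseKernel_row hσ hr2, eventually_pow_mul_exp_le 2 4 one_pos]
    with M hM hes heu he₁ he₂ hB₁ hB₂ ne_su ne_sV ne_uV large_s large_u nr_s nr_u chain dUU dUU' dUU''
      dUV₁₁ dUV₁₂ dUV₂₁ dUV₂₂ dVV as au a₁ a₂ πs πu π₁ π₂ row_s row_u row₁ row₂ row₀ hexp
  have hε := noiseLevel_pos hM
  have hπ := Real.pi_gt_three
  have hexpM : 2 * Real.exp (-M) ≤ noiseLevel M := by
    rw [noiseLevel, ← one_div, le_div_iff₀ (by positivity)]; linarith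
  have hexp0 := Real.exp_pos (-M)
  set ε := noiseLevel M
  set νs : ℕ → ℝ := fun j => |cs|⁻¹ * (cs ^ j)⁻¹ + 1 * Real.exp (-M) with hνs
  set νu : ℕ → ℝ := fun j => |cu|⁻¹ * (cu ^ j)⁻¹ + 2 * Real.exp (-M) with hνu
  set ν₁ : ℕ → ℝ := hermMult α₁ α₂ (σ x₁)⁻¹ (σ x₁)⁻¹ (c₁ / σ x₁) with hν₁
  set ν₂ : ℕ → ℝ := hermMult α₂ α₁ (σ x₂)⁻¹ (σ x₂)⁻¹ (c₂ / σ x₂) with hν₂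
  have hdiff : ∀ (m : ℝ) {u : ℝ}, 0 ≤ u → |m + u * Real.exp (-M) - m| = u * Real.exp (-M) := by
    intro m u hu
    rw [add_sub_cancel_left, abs_of_nonneg (mul_nonneg hu hexp0.le)]
  obtain ⟨bs, row_s⟩ := row_s νs (es M) Cs κs hes.1
    (hes.2 νs fun j _ => (hdiff _ zero_le_one).le)
  obtain ⟨bu, row_u⟩ := row_u νu (eu M) Cu κu heu.1
    (heu.2 νu fun j _ => (hdiff _ zero_le_two).le)
  obtain ⟨b₁, row₁⟩ := row₁ ν₁ (e₁ M) (e₂ M) C₁ κ₁ C₂ κ₂ he₁ he₂ (hB₁ _ _ he₁ he₂)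
  obtain ⟨b₂, row₂⟩ := row₂ ν₂ (e₂ M) (e₁ M) C₂ κ₂ C₁ κ₁ he₂ he₁ (hB₂ _ _ he₂ he₁)
  have As := expand_scaled (M := M) (hσ xs) hM.le hR.expand_s
  have Au := expand_scaled (M := M) (hσ xu) hM.le hR.expand_u
  have A₁ := contract_scaled (M := M) (hσ x₁) hM.le hR.contract₁
  have A₂ := contract_scaled (M := M) (hσ x₂) hM.le hR.contract₂
  set K := gluedKernel (disk ε (Rs * M) xs) (disk ε (Ru * M) xu) (disk ε (R₁ * M) x₁)
    (disk ε (R₂ * M) x₂) (repellerKernel f σ ε M Rs J νs (es M) xs)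
    (repellerKernel f σ ε M Ru J νu (eu M) xu)
    (attractorKernel f σ α₁ ε M R₁ J ν₁ (e₁ M) (e₂ M) x₁ x₂)
    (attractorKernel f σ α₂ ε M R₂ J ν₂ (e₂ M) (e₁ M) x₂ x₁) (noiseKernel f σ ε M) with hK
  have Ks : ∀ x ∈ disk ε (Rs * M) xs, ∀ y,
      K x y = repellerKernel f σ ε M Rs J νs (es M) xs x y :=
    fun x hx y => gluedKernel_of_mem_U₁ hx y
  have Ku : ∀ x ∈ disk ε (Ru * M) xu, ∀ y,
      K x y = repellerKernel f σ ε M Ru J νu (eu M) xu x y :=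
    fun x hx y => gluedKernel_of_mem_U₂ dUU hx y
  have K₁ : ∀ x ∈ disk ε (R₁ * M) x₁, ∀ y,
      K x y = attractorKernel f σ α₁ ε M R₁ J ν₁ (e₁ M) (e₂ M) x₁ x₂ x y :=
    fun x hx y => gluedKernel_of_mem_V₁ dUV₁₁ dUV₂₁ hx y
  have K₂ : ∀ x ∈ disk ε (R₂ * M) x₂, ∀ y,
      K x y = attractorKernel f σ α₂ ε M R₂ J ν₂ (e₂ M) (e₁ M) x₂ x₁ x y :=
    fun x hx y => gluedKernel_of_mem_V₂ dUV₁₂ dUV₂₂ dVV hx y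
  have mult : ∀ j, ν₁ j * ν₂ j = (c₁ * c₂) ^ j := fun j =>
    hermMult_attractor (hσ x₁) (hσ x₂) hα₁ hα₂ j
  refine ⟨K, disk ε (Rs * M) xs, disk ε (Ru * M) xu, disk ε (R₁ * M) x₁ ∪ disk ε (R₂ * M) x₂,
    νs, νu, ν₁, ν₂, fun j x => es M j (coord ε xs x), fun j x => eu M j (coord ε xu x),
    fun j x => e₁ M j (coord ε x₁ x), fun j x => e₂ M j (coord ε x₂ x), ?_⟩
  refine
    { spectrum :=
        { split := ?_
          pos := hr
          sys_s := hasEigenSystem_repeller (hσ xs) hcs hε hCs.le hκs.le hes.1 As (by linarith) Ks hr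
            fun n hn => (hJ n hn).1
          sys_u := hasEigenSystem_repeller (hσ xu) hcu hε hCu.le hκu.le heu.1 Au (by linarith) Ku hr
            fun n hn => (hJ n hn).2.1
          sys_V := hasPairSystem_attractor (hσ x₁) (hσ x₂) hα₁ hα₂ hε hC₁.le hκ₁.le hC₂.le hκ₂.le
            he₁ he₂ A₁ A₂ (by linarith) (by linarith) dVV K₁ K₂ hr
            fun n hn => (hJ n hn).2.2.le
          inj_s := fun i _ j _ hij h => hij (inv_mul_inv_pow_injective hcs (add_right_cancel h))
          inj_u := fun i _ j _ hij h => hij (inv_mul_inv_pow_injective hcu (add_right_cancel h))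
          inj_V := fun i _ j _ hij h0 => ?_
          ne_su := ne_su
          ne_sV := fun i hi j hj => by rw [mult]; exact ne_sV i hi j hj
          ne_uV := fun i hi j hj => by rw [mult]; exact ne_uV i hi j hj }
      row := fun φ x => ?_
      approx_s := fun j hj x => hes.1.abs_sub_profile_le as lκs hj xs x
      approx_u := fun j hj x => heu.1.abs_sub_profile_le au lκu hj xu x
      approx₁ := fun j hj x => he₁.abs_sub_profile_le a₁ lκ₁ hj x₁ x
      approx₂ := fun j hj x => he₂.abs_sub_profile_le a₂ lκ₂ hj x₂ x
      near_s := fun j _ => (hdiff _ zero_le_one).le.trans (by linarith)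
      near_u := fun j _ => (hdiff _ zero_le_two).le.trans hexpM
      mult := fun j _ => mult j
      large_s := large_s
      large_u := large_u
      small_s := fun n hn => (hJ n hn).1
      small_u := fun n hn => (hJ n hn).2.1
      small_V := fun n hn => (hJ n hn).2.2.le }
  · refine isRepellerAttractor_gluedKernel (measurableSet_disk _ _ _) (measurableSet_disk _ _ _)
      (measurableSet_disk _ _ _) (measurableSet_disk _ _ _) dUU dUV₁₁ dUV₁₂ dUV₂₁ dUV₂₂ dVV bs bu b₁
      b₂ (isBddKernel_noiseKernel hσ hε M) (fun x hx y hy => ?_) (fun x hx y hy => ?_)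
      (fun x hx y hy => attractorKernel_eq_zero (hσ x₁) he₁ he₂ A₁ hx hy)
      (fun x hx y hy => attractorKernel_eq_zero (hσ x₂) he₂ he₁ A₂ hx hy) nr_s nr_u chain
    · exact repellerKernel_eq_zero (hσ xs) hcs hes.1 As hx (Set.disjoint_right.1 dUU' hy) hM.le
        hR.pos_s.le
    · exact repellerKernel_eq_zero (hσ xu) hcu heu.1 Au hx (Set.disjoint_right.1 dUU'' hy) hM.le
        hR.pos_u.le
  · rw [mult] at h0 ⊢
    rw [mult]
    exact pow_ne_pow_of_abs_lt_one hc hij h0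
  · by_cases h1 : x ∈ disk ε (Rs * M) xs
    · simpa only [kerInt, Ks x h1] using row_s x h1 φ
    by_cases h2 : x ∈ disk ε (Ru * M) xu
    · simpa only [kerInt, Ku x h2] using row_u x h2 φ
    by_cases h3 : x ∈ disk ε (R₁ * M) x₁
    · simpa only [kerInt, K₁ x h3] using row₁ x h3 φ
    by_cases h4 : x ∈ disk ε (R₂ * M) x₂
    · simpa only [kerInt, K₂ x h4] using row₂ x h4 φ
    have h5 : ∀ y, K x y = noiseKernel f σ ε M x y := fun y =>
      gluedKernel_of_notMem h1 h2 h3 h4 y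
    simpa only [kerInt, h5] using row₀ φ x

/-- Every small noise level is of the form `noiseLevel M` with `M` large. -/
theorem exists_forall_noiseLevel {P : ℝ → Prop} (h : ∀ᶠ M in atTop, P (noiseLevel M)) :
    ∃ ε₀ > 0, ∀ ε, 0 < ε → ε < ε₀ → P ε := by
  obtain ⟨M₀, hM₀⟩ := eventually_atTop.1 h
  have hM₁ : 0 < max M₀ 1 := lt_max_of_lt_right one_pos
  refine ⟨noiseLevel (max M₀ 1), noiseLevel_pos hM₁, fun ε hε hlt => ?_⟩
  -- The inverse of `noiseLevel`: the fourth root of `1 / ε`.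
  set M := (√(√ε))⁻¹ with hM
  have hMpos : 0 < M := inv_pos.2 (Real.sqrt_pos.2 (Real.sqrt_pos.2 hε))
  have h4 : √(√ε) ^ 4 = ε := by
    rw [show 4 = 2 * 2 by norm_num, pow_mul, Real.sq_sqrt (Real.sqrt_nonneg _), Real.sq_sqrt hε.le]
  have h1 : noiseLevel M = ε := by rw [noiseLevel, hM, inv_pow, inv_inv, h4]
  have h2 : max M₀ 1 < M := by
    rw [← h1, noiseLevel, noiseLevel, inv_lt_inv₀ (by positivity) (by positivity)] at hlt
    exact lt_of_pow_lt_pow_left₀ 4 hMpos.le hlt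
  rw [← h1]
  exact hM₀ M ((le_max_left _ _).trans h2.le)

end Existence

theorem theorem8 (f : C(S1, S1)) (hf : IsSmoothCircleMap f)
    (σ : C(S1, ℝ)) (hσ : IsSmoothCircleFun σ) (hσ_pos : ∀ x, 0 < σ x)
    (xs xu x₁ x₂ : S1) (hsu : xs ≠ xu) (h₁₂ : x₁ ≠ x₂)
    (hxs : f xs = xs) (hxu : f xu = xu) (hx₁ : f x₁ = x₂) (hx₂ : f x₂ = x₁)
    (hcs : 1 < |circleDeriv f xs|) (hcu : 1 < |circleDeriv f xu|)
    (hc : circleDeriv f x₁ * circleDeriv f x₂ ∈ Set.Ioo (-1 : ℝ) 1)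
    (hattr : ∀ x : S1, x ≠ xs → x ≠ xu →
      Tendsto (fun n : ℕ => Metric.infDist (f^[n] x) {x₁, x₂}) atTop (𝓝 0))
    (r : ℝ) (hr : 0 < r) :
    ∃ ε₀ > 0, ∃ L > 0, ∃ K > 0, ∃ κ > 0, ∀ ε : ℝ, 0 < ε → ε < ε₀ →
      ∃ Tlp Tup : BddMeas →L[ℂ] BddMeas,
        IsRealOp Tlp ∧ IsRealOp Tup ∧
        transitionOp f σ ε = Tlp + Tup ∧
        ‖Tlp‖ < r ∧
        -- every eigenvalue of modulus greater than `r` is of one of the two kinds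
        (∀ lam : ℂ, Module.End.HasEigenvalue (Tup : BddMeas →ₗ[ℂ] BddMeas) lam → r < ‖lam‖ →
          (∃ (j : ℕ) (z : ℂ),
            z ^ 2 = (((circleDeriv f x₁ * circleDeriv f x₂) ^ j : ℝ) : ℂ) ∧
            IsStableEigenvalue f σ L K κ ε Tup x₁ x₂ j z lam) ∨
          (∃ (p : S1) (j : ℕ), (p = xs ∨ p = xu) ∧
            IsUnstableEigenvalue f σ L K κ ε Tup p j lam)) ∧
        -- every limiting value of modulus greater than `r` occurs
        (∀ (j : ℕ) (z : ℂ),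
          z ^ 2 = (((circleDeriv f x₁ * circleDeriv f x₂) ^ j : ℝ) : ℂ) → r < ‖z‖ →
          ∃ lam : ℂ, IsStableEigenvalue f σ L K κ ε Tup x₁ x₂ j z lam) ∧
        (∀ (p : S1) (j : ℕ), p = xs ∨ p = xu →
          r < |circleDeriv f p|⁻¹ * (|circleDeriv f p| ^ j)⁻¹ →
          ∃ lam : ℂ, IsUnstableEigenvalue f σ L K κ ε Tup p j lam) := by
  obtain ⟨κ, hκ, J, h⟩ := eventually_exists_model hf hσ_pos hsu h₁₂ hxs hxu hx₁ hx₂ hcs hcu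
    (abs_lt.2 hc) hattr hr
  obtain ⟨ε₀, hε₀, h⟩ := exists_forall_noiseLevel (P := fun ε => ∃ K U₁ U₂ V νs νu ν₁ ν₂ es eu e₁ e₂,
    IsModel f σ xs xu x₁ x₂ r κ ε J K U₁ U₂ V νs νu ν₁ ν₂ es eu e₁ e₂) h
  -- `L = K = 1` suffices because all eigenvalue and profile errors of the model are exponentially
  -- small in `M = ε^{-1/4}`, hence at most `ε`.
  refine ⟨ε₀, hε₀, 1, one_pos, 1, one_pos, κ, hκ, fun ε hε hlt => ?_⟩
  obtain ⟨K, U₁, U₂, V, νs, νu, ν₁, ν₂, es, eu, e₁, e₂, hm⟩ := h ε hε hlt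
  exact hm.exists_decomposition hε
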